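/- (Parametric Morse Theorem) Let $M$ be a compact smooth manifold (Hausdorff, finite-dimensional, without boundary), and let $f:M\times[0,1]\to\mathbb{R}$, $(x,t)\mapsto f_t(x)$, be a $C^1$-map such that each $f_t$ has a Lipschitz differential and $\partial_t f\leq 0$ (derivatives in $t$ being one-sided at $t=0,1$). Let $a\in\mathbb{R}$ and put $$\operatorname{Crit}_{f,a}:=\{(x,t)\in M\times[0,1]\;|\; d_xf_t=0 \text{ and } f_t(x)=a\}.$$ Assume that for each $(x,t)\in\operatorname{Crit}_{f,a}$ the point $x$ is a non-degenerate critical point of $f_t$ of index $\lambda_{x,t}$ (that is, $f_t$ is smooth around $x$, and in some smooth chart around $x$ the Hessian matrix of $f_t$ at $x$ is non-singular, $\lambda_{x,t}$ being the largest dimension of a subspace on which it is negative definite), and that $f$ is smooth with $\partial_t f<0$ on a neighbourhood of $(x,t)$ in $M\times[0,1]$. Assume moreover that $a$ is a regular value of $f_0$, i.e. $\operatorname{Crit}_{f,a}$ contains no point with $t=0$. Then $\operatorname{Crit}_{f,a}$ is finite, and $\{f_1\leq a\}$ is homotopy equivalent to a space that arises from $\{f_0\leq a\}$ by successively attaching,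 for each $(x,t)\in\operatorname{Crit}_{f,a}$, one cell of dimension $\lambda_{x,t}$, the cells being attached in an order in which $t$ is non-decreasing. Here attaching a $k$-cell to a space $Y$ along a continuous map $\phi:\partial D^k\to Y$ means passing to the quotient of $Y\sqcup D^k$ by the equivalence relation generated by $x\sim\phi(x)$ for $x\in\partial D^k$, where $D^k\subset\mathbb{R}^k$ is the closed unit ball (so for $k=0$ it adds a disjoint point), and each attaching map takes values in the space constructed so far. -/

import Mathlib

open scoped Manifold ContDiff

/-! ### Cell attachments -/

/-- The closed unit ball `Dᵏ` of `ℝᵏ`. -/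
abbrev Cell (k : ℕ) : Type := Metric.closedBall (0 : EuclideanSpace ℝ (Fin k)) 1

/-- The boundary sphere `∂Dᵏ` of `Dᵏ`; it is empty for `k = 0`. -/
abbrev CellBoundary (k : ℕ) : Type := Metric.sphere (0 : EuclideanSpace ℝ (Fin k)) 1

/-- The inclusion `∂Dᵏ → Dᵏ`. -/
def CellBoundary.incl {k : ℕ} (x : CellBoundary k) : Cell k :=
  ⟨x.1, Metric.sphere_subset_closedBall x.2⟩

/-- The gluing relation on `Y ⊔ Dᵏ`: every `x ∈ ∂Dᵏ` is glued to `φ x ∈ Y`. -/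
inductive AttachCellRel {Y : Type*} [TopologicalSpace Y] {k : ℕ} (φ : C(CellBoundary k, Y)) :
    Y ⊕ Cell k → Y ⊕ Cell k → Prop
  | glue (x : CellBoundary k) : AttachCellRel φ (Sum.inr x.incl) (Sum.inl (φ x))

/-- The space `Y ∪_φ Dᵏ`: the quotient (with the quotient topology) of the disjoint union
`Y ⊔ Dᵏ` by the equivalence relation generated by the gluing relation. -/
def AttachCell {Y : Type*} [TopologicalSpace Y] {k : ℕ} (φ : C(CellBoundary k, Y)) : Type _ :=
  Quot (AttachCellRel φ)

instance {Y : Type*} [TopologicalSpace Y] {k : ℕ} (φ : C(CellBoundary k, Y)) :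
    TopologicalSpace (AttachCell φ) :=
  inferInstanceAs (TopologicalSpace (Quot (AttachCellRel φ)))

/-- `Z` is homotopy equivalent to a space which arises from `X` by successively attaching cells
whose dimensions are, in this order, the entries of the list. Each attaching map goes into the
space obtained so far. -/
def HomotopyEquivAttachCells (Z : Type*) [TopologicalSpace Z] :
    (ks : List ℕ) → (X : Type*) → [TopologicalSpace X] → Prop
  | [], X, _ => Nonempty (ContinuousMap.HomotopyEquiv Z X)
  | k :: ks, X, _ => ∃ φ : C(CellBoundary k, X), HomotopyEquivAttachCells Z ks (AttachCell φ)

/-! ### Critical points -/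

section Critical

variable {n : ℕ} {M : Type*} [TopologicalSpace M] [ChartedSpace (EuclideanSpace ℝ (Fin n)) M]

/-- The Hessian matrix at `y` of a function on `ℝⁿ`. -/
noncomputable def hessianMatrix (g : EuclideanSpace ℝ (Fin n) → ℝ)
    (y : EuclideanSpace ℝ (Fin n)) : Matrix (Fin n) (Fin n) ℝ :=
  Matrix.of fun i j =>
    fderiv ℝ (fderiv ℝ g) y (EuclideanSpace.single i 1) (EuclideanSpace.single j 1)

/-- `k` is the largest dimension of a subspace of `ℝⁿ` on which `H` is negative definite. -/
def IsMatrixIndex (H : Matrix (Fin n) (Fin n) ℝ) (k : ℕ) : Prop :=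
  IsGreatest {d : ℕ | ∃ W : Submodule ℝ (Fin n → ℝ), Module.finrank ℝ W = d ∧
    ∀ v ∈ W, v ≠ 0 → v ⬝ᵥ H.mulVec v < 0} k

variable (n) in
/-- `p` is a critical point of `g`: the differential `d_p g` exists and vanishes. -/
def IsCriticalPt (g : M → ℝ) (p : M) : Prop :=
  MDifferentiableAt (𝓡 n) 𝓘(ℝ, ℝ) g p ∧ mfderiv (𝓡 n) 𝓘(ℝ, ℝ) g p = 0

variable (n) in
/-- `p` is a non-degenerate critical point of `g` of index `k`: `g` is smooth around `p` and
there is a smooth chart around `p` in which the Hessian matrix at `p` is non-singular and has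
index `k`. -/
def IsNondegenerateCriticalPt (g : M → ℝ) (p : M) (k : ℕ) : Prop :=
  IsCriticalPt n g p ∧
  (∃ U : Set M, IsOpen U ∧ p ∈ U ∧ ContMDiffOn (𝓡 n) 𝓘(ℝ, ℝ) ∞ g U) ∧
  ∃ e ∈ IsManifold.maximalAtlas (𝓡 n) ∞ M, p ∈ e.source ∧
    (hessianMatrix (g ∘ e.symm) (e p)).det ≠ 0 ∧
    IsMatrixIndex (hessianMatrix (g ∘ e.symm) (e p)) k

variable (n) in
/-- The differential of `g` is Lipschitz: in every smooth chart it is locally Lipschitz. On a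
compact manifold this is the same as being Lipschitz for one (equivalently, any) Riemannian
metric. -/
def HasLipschitzDifferential (g : M → ℝ) : Prop :=
  MDifferentiable (𝓡 n) 𝓘(ℝ, ℝ) g ∧
  ∀ e ∈ IsManifold.maximalAtlas (𝓡 n) ∞ M, LocallyLipschitzOn e.target (fderiv ℝ (g ∘ e.symm))

/-! ### Families of functions

A family `f : M × [0,1] → ℝ` is given by a function on `M × ℝ`, of which only the restriction to
`M × [0,1]` is used. -/

variable (M) in
/-- The domain `M × [0,1]` of a family, as a subset of `M × ℝ`. -/
def familyDomain : Set (M × ℝ) := Set.univ ×ˢ Set.Icc (0 : ℝ) 1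

/-- The function `f_t`. -/
def slice (f : M × ℝ → ℝ) (t : ℝ) : M → ℝ := fun x => f (x, t)

/-- The time derivative `∂_t f` at `(x, t)` for `t ∈ [0,1]` (one-sided at the end points). -/
noncomputable def timeDeriv (f : M × ℝ → ℝ) (q : M × ℝ) : ℝ :=
  derivWithin (fun s => f (q.1, s)) (Set.Icc 0 1) q.2

variable (n) in
/-- The set of all `(x, t) ∈ M × [0,1]` such that `x` is a critical point of `f_t` with
value `a`. -/
def critSet (f : M × ℝ → ℝ) (a : ℝ) : Set (M × ℝ) :=
  {q | q ∈ familyDomain M ∧ IsCriticalPt n (slice f q.2) q.1 ∧ f q = a}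

end Critical

/-! ### Homotopies out of cell attachments -/

section AttachCell

open ContinuousMap unitInterval

universe uX uY uZ

variable {X : Type uX} {Y : Type uY} {Z : Type uZ} {Z' : Type*} [TopologicalSpace X]
  [TopologicalSpace Y] [TopologicalSpace Z] [TopologicalSpace Z'] {k : ℕ}

theorem CellBoundary.continuous_incl : Continuous (CellBoundary.incl (k := k)) :=
  Continuous.subtype_mk continuous_subtype_val _

namespace AttachCell

variable {φ : C(CellBoundary k, X)}

/-- The base of a cell attachment. -/
def inl (φ : C(CellBoundary k, X)) : C(X, AttachCell φ) :=
  ⟨fun x => Quot.mk _ (Sum.inl x), continuous_quot_mk.comp continuous_inl⟩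

/-- The characteristic map of the attached cell. -/
def cell (φ : C(CellBoundary k, X)) : C(Cell k, AttachCell φ) :=
  ⟨fun x => Quot.mk _ (Sum.inr x), continuous_quot_mk.comp continuous_inr⟩

theorem cell_incl (x : CellBoundary k) : cell φ x.incl = inl φ (φ x) :=
  Quot.sound (AttachCellRel.glue x)

/-- A continuous map out of a cell attachment. -/
def desc (p : C(X, Z)) (c : C(Cell k, Z)) (h : ∀ x : CellBoundary k, c x.incl = p (φ x)) :
    C(AttachCell φ, Z) where
  toFun := Quot.lift (Sum.elim p c) (by rintro _ _ ⟨x⟩; exact h x)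
  continuous_toFun := continuous_quot_lift _ (p.continuous.sumElim c.continuous)

@[simp] theorem desc_inl (p : C(X, Z)) (c : C(Cell k, Z)) (h) (x : X) :
    desc (φ := φ) p c h (inl φ x) = p x := rfl

@[simp] theorem desc_cell (p : C(X, Z)) (c : C(Cell k, Z)) (h) (y : Cell k) :
    desc (φ := φ) p c h (cell φ y) = c y := rfl

theorem hom_ext {F G : C(AttachCell φ, Z)} (h₁ : ∀ x, F (inl φ x) = G (inl φ x))
    (h₂ : ∀ y, F (cell φ y) = G (cell φ y)) : F = G := by
  ext z
  induction z using Quot.ind with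
  | mk a => cases a with
    | inl x => exact h₁ x
    | inr y => exact h₂ y

theorem homotopic_of_curried {F G : C(AttachCell φ, Z)} (p : C(X, C(I, Z)))
    (c : C(Cell k, C(I, Z))) (h : ∀ x : CellBoundary k, c x.incl = p (φ x))
    (hp₀ : ∀ x, p x 0 = F (inl φ x)) (hp₁ : ∀ x, p x 1 = G (inl φ x))
    (hc₀ : ∀ y, c y 0 = F (cell φ y)) (hc₁ : ∀ y, c y 1 = G (cell φ y)) : Homotopic F G := by
  let D : C(AttachCell φ, C(I, Z)) := desc p c h
  refine ⟨⟨(ContinuousMap.uncurry D).comp ⟨Prod.swap, continuous_swap⟩, fun z => ?_, fun z => ?_⟩⟩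
  · obtain ⟨a, rfl⟩ := Quot.exists_rep z
    cases a with
    | inl x => exact hp₀ x
    | inr y => exact hc₀ y
  · obtain ⟨a, rfl⟩ := Quot.exists_rep z
    cases a with
    | inl x => exact hp₁ x
    | inr y => exact hc₁ y

end AttachCell

/-! ### Extending maps of a disc radially -/

/-- The radial retraction of the disc which maps the disc of radius `1/2` onto the whole disc. -/
noncomputable def Cell.stretch (y : Cell k) : Cell k :=
  ⟨(max (1 / 2) ‖y.1‖)⁻¹ • y.1, by
    have h : (0 : ℝ) < max (1 / 2) ‖y.1‖ := lt_max_of_lt_left (by norm_num)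
    rw [mem_closedBall_zero_iff, norm_smul, norm_inv, Real.norm_of_nonneg h.le,
      inv_mul_le_iff₀ h, mul_one]
    exact le_max_right _ _⟩

theorem Cell.continuous_stretch : Continuous (Cell.stretch (k := k)) := by
  refine Continuous.subtype_mk (Continuous.smul (Continuous.inv₀
    (continuous_const.max continuous_subtype_val.norm) fun y => ?_) continuous_subtype_val) _
  exact (lt_max_of_lt_left (by norm_num : (0 : ℝ) < 1 / 2)).ne'

theorem Cell.stretch_incl (x : CellBoundary k) : Cell.stretch x.incl = x.incl := by
  have h : ‖x.1‖ = 1 := mem_sphere_zero_iff_norm.1 x.2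
  apply Subtype.ext
  simp only [Cell.stretch, CellBoundary.incl, h]
  norm_num

/-- The radial projection to the sphere away from the centre. -/
noncomputable def Cell.direction (y : {y : Cell k // 1 / 2 ≤ ‖y.1‖}) : CellBoundary k :=
  ⟨‖y.1.1‖⁻¹ • y.1.1, by
    have h : (0 : ℝ) < ‖y.1.1‖ := lt_of_lt_of_le (by norm_num) y.2
    rw [mem_sphere_zero_iff_norm, norm_smul, norm_inv, norm_norm, inv_mul_cancel₀ h.ne']⟩

theorem Cell.continuous_direction : Continuous (Cell.direction (k := k)) := by
  refine Continuous.subtype_mk (Continuous.smul (Continuous.inv₀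
    (continuous_subtype_val.comp continuous_subtype_val).norm fun y => ?_)
    (continuous_subtype_val.comp continuous_subtype_val)) _
  exact (lt_of_lt_of_le (by norm_num : (0 : ℝ) < 1 / 2) y.2).ne'

/-- The radial parameter of the collar `1/2 ≤ ‖y‖ ≤ 1`. -/
noncomputable def Cell.collarTime (y : Cell k) : I := Set.projIcc 0 1 zero_le_one (2 * ‖y.1‖ - 1)

theorem Cell.continuous_collarTime : Continuous (Cell.collarTime (k := k)) :=
  continuous_projIcc.comp (by fun_prop)

open Classical in
/-- The map of the disc which is `c` on the disc of radius `1/2` and the homotopy `P` on the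
collar. -/
noncomputable def radialFun (c : C(Cell k, Z)) (P : C(CellBoundary k × I, Z)) (y : Cell k) : Z :=
  if h : 1 / 2 ≤ ‖y.1‖ then P (Cell.direction ⟨y, h⟩, Cell.collarTime y) else c y.stretch

theorem radialFun_of_le (c : C(Cell k, Z)) (P : C(CellBoundary k × I, Z))
    (h : ∀ x, P (x, 0) = c x.incl) {y : Cell k} (hy : ‖y.1‖ ≤ 1 / 2) :
    radialFun c P y = c y.stretch := by
  unfold radialFun
  split_ifs with h'
  · have h2 : ‖y.1‖ = 1 / 2 := le_antisymm hy h'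
    have h3 : y.collarTime = 0 := by
      unfold Cell.collarTime
      rw [h2]; norm_num
    rw [h3, h]
    congr 1
    apply Subtype.ext
    simp only [Cell.stretch, CellBoundary.incl, Cell.direction, h2, max_self]
  · rfl

theorem continuous_radialFun (c : C(Cell k, Z)) (P : C(CellBoundary k × I, Z))
    (h : ∀ x, P (x, 0) = c x.incl) : Continuous (radialFun c P) := by
  have h1 : IsClosed {y : Cell k | ‖y.1‖ ≤ 1 / 2} :=
    isClosed_le (by fun_prop) continuous_const
  have h2 : IsClosed {y : Cell k | 1 / 2 ≤ ‖y.1‖} :=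
    isClosed_le continuous_const (by fun_prop)
  have c1 : ContinuousOn (radialFun c P) {y : Cell k | ‖y.1‖ ≤ 1 / 2} :=
    (c.continuous.comp Cell.continuous_stretch).continuousOn.congr
      fun y hy => radialFun_of_le c P h hy
  have c2 : ContinuousOn (radialFun c P) {y : Cell k | 1 / 2 ≤ ‖y.1‖} := by
    rw [continuousOn_iff_continuous_domRestrict]
    have : Continuous fun y : {y : Cell k // 1 / 2 ≤ ‖y.1‖} =>
        P (Cell.direction y, Cell.collarTime y.1) :=
      P.continuous.comp (Cell.continuous_direction.prodMk
        (Cell.continuous_collarTime.comp continuous_subtype_val))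
    refine this.congr fun y => ?_
    simp only [Set.domRestrict_apply, radialFun]
    rw [dif_pos y.2]
  have := c1.union_of_isClosed c2 h1 h2
  rwa [show {y : Cell k | ‖y.1‖ ≤ 1 / 2} ∪ {y : Cell k | 1 / 2 ≤ ‖y.1‖} = Set.univ from
    Set.eq_univ_of_forall fun y => le_total ‖y.1‖ (1 / 2), continuousOn_univ] at this

/-- The map `radialFun` as a continuous map. -/
noncomputable def radialExtend (c : C(Cell k, Z)) (P : C(CellBoundary k × I, Z))
    (h : ∀ x, P (x, 0) = c x.incl) : C(Cell k, Z) := ⟨radialFun c P, continuous_radialFun c P h⟩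

theorem radialExtend_incl (c : C(Cell k, Z)) (P : C(CellBoundary k × I, Z)) (h) (x : CellBoundary k) :
    radialExtend c P h x.incl = P (x, 1) := by
  have h1 : ‖x.incl.1‖ = 1 := mem_sphere_zero_iff_norm.1 x.2
  change radialFun c P x.incl = _
  rw [radialFun, dif_pos (by rw [h1]; norm_num)]
  congr 2
  · apply Subtype.ext
    simp only [Cell.direction, h1]
    simp [CellBoundary.incl]
  · unfold Cell.collarTime
    rw [h1]; norm_num

theorem map_radialExtend (F : C(Z, Z')) (c : C(Cell k, Z)) (P : C(CellBoundary k × I, Z)) (h)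
    (c' : C(Cell k, Z')) (P' : C(CellBoundary k × I, Z')) (h') (hc : ∀ y, F (c y) = c' y)
    (hP : ∀ q, F (P q) = P' q) (y : Cell k) :
    F (radialExtend c P h y) = radialExtend c' P' h' y := by
  change F (radialFun c P y) = radialFun c' P' y
  unfold radialFun
  split_ifs
  · exact hP _
  · exact hc _

theorem radialExtend_const (c : C(Cell k, Z)) (P : C(CellBoundary k × I, Z)) (h)
    (hP : ∀ q, P q = c q.1.incl) (y : Cell k) : radialExtend c P h y = c y.stretch := by
  change radialFun c P y = _
  rcases le_total ‖y.1‖ (1 / 2) with hy | hy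
  · exact radialFun_of_le c P h hy
  · rw [radialFun, dif_pos hy, hP]
    congr 1
    apply Subtype.ext
    simp only [Cell.stretch, CellBoundary.incl, Cell.direction, max_eq_right hy]

/-- Evaluation of a path at a parameter. -/
def evalPath (Z : Type*) [TopologicalSpace Z] (s : I) : C(C(I, Z), Z) :=
  ⟨fun p => p s, by fun_prop⟩

/-- The straight homotopy from the identity of the disc to `Cell.stretch`. -/
noncomputable def Cell.stretchHomotopy (k : ℕ) : C(Cell k × I, Cell k) where
  toFun q := ⟨(1 - q.2 : ℝ) • q.1.1 + (q.2 : ℝ) • q.1.stretch.1,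
    (convex_closedBall 0 1) q.1.2 q.1.stretch.2 (sub_nonneg.2 q.2.2.2) q.2.2.1 (by ring)⟩
  continuous_toFun := by
    have := Cell.continuous_stretch (k := k)
    have h : Continuous fun q : Cell k × I => (q.1.stretch).1 :=
      continuous_subtype_val.comp (this.comp continuous_fst)
    exact Continuous.subtype_mk (f := fun q : Cell k × I =>
      (1 - q.2 : ℝ) • q.1.1 + (q.2 : ℝ) • (q.1.stretch).1) (by fun_prop) _

namespace AttachCell

theorem desc_homotopic_stretch {φ : C(CellBoundary k, X)} (p : C(X, Z)) (c c' : C(Cell k, Z)) (h)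
    (h') (hc : ∀ y, c' y = c y.stretch) : Homotopic (desc (φ := φ) p c h) (desc p c' h') := by
  refine homotopic_of_curried
    (ContinuousMap.curry (p.comp ContinuousMap.fst))
    (ContinuousMap.curry (c.comp (Cell.stretchHomotopy k))) (fun x => ?_) (fun x => rfl)
    (fun x => rfl) (fun y => ?_) (fun y => ?_)
  · ext s
    simp only [curry_apply, comp_apply, ContinuousMap.fst_apply, ← h]
    congr 1
    apply Subtype.ext
    simp only [Cell.stretchHomotopy, ContinuousMap.coe_mk, Cell.stretch_incl, ← add_smul]
    simp
  · simp only [curry_apply, comp_apply, desc_cell]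
    congr 1
    apply Subtype.ext
    simp [Cell.stretchHomotopy]
  · simp only [curry_apply, comp_apply, desc_cell, hc]
    congr 1
    apply Subtype.ext
    simp [Cell.stretchHomotopy]

/-- The map between cell attachments along homotopic maps. -/
noncomputable def slide {φ₀ φ₁ : C(CellBoundary k, X)} (γ : C(CellBoundary k × I, X))
    (h₀ : ∀ x, γ (x, 0) = φ₀ x) (h₁ : ∀ x, γ (x, 1) = φ₁ x) : C(AttachCell φ₁, AttachCell φ₀) :=
  desc (inl φ₀) (radialExtend (cell φ₀) ((inl φ₀).comp γ) fun x => by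
    rw [comp_apply, h₀, cell_incl]) fun x => by rw [radialExtend_incl, comp_apply, h₁]

theorem slide_comp_slide {φ₀ φ₁ : C(CellBoundary k, X)} (γ γ' : C(CellBoundary k × I, X))
    (h₀ : ∀ x, γ (x, 0) = φ₀ x) (h₁ : ∀ x, γ (x, 1) = φ₁ x)
    (h₀' : ∀ x, γ' (x, 0) = φ₁ x) (h₁' : ∀ x, γ' (x, 1) = φ₀ x)
    (hγ : ∀ x τ, γ' (x, τ) = γ (x, σ τ)) :
    Homotopic ((slide γ h₀ h₁).comp (slide γ' h₀' h₁')) (ContinuousMap.id _) := by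
  let A := AttachCell φ₀
  let P : C(CellBoundary k × I, C(I, A)) := ContinuousMap.curry
    ⟨fun q => inl φ₀ (γ (q.1.1, q.2 * q.1.2)), by fun_prop⟩
  let P' : C(CellBoundary k × I, C(I, A)) := ContinuousMap.curry
    ⟨fun q => inl φ₀ (γ (q.1.1, q.2 * σ q.1.2)), by fun_prop⟩
  let c : C(Cell k, C(I, A)) := ContinuousMap.curry ((cell φ₀).comp ContinuousMap.fst)
  have hP : ∀ x, P (x, 0) = c x.incl := fun x => by
    ext τ
    simp [P, c, h₀, cell_incl]
  have hP' : ∀ x, P' (x, 0) = radialExtend c P hP x.incl := fun x => by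
    rw [radialExtend_incl]
    ext τ
    simp [P, P']
  have hP₀ : ∀ x, (P (x, 0)) 0 = cell φ₀ x.incl := fun x => by rw [hP]; rfl
  let P₀ : C(CellBoundary k × I, A) := (evalPath A 0).comp P
  let P₀' : C(CellBoundary k × I, A) := (evalPath A 0).comp P'
  have e₀ : ∀ q, P₀ q = cell φ₀ q.1.incl := fun q => by
    simp [P₀, P, evalPath, h₀, cell_incl]
  have e₀' : ∀ q, P₀' q = cell φ₀ q.1.incl := fun q => by
    simp [P₀', P', evalPath, h₀, cell_incl]
  have k₁ : ∀ x, P₀ (x, 0) = cell φ₀ x.incl := fun x => e₀ _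
  have k₂ : ∀ x, P₀' (x, 0) = radialExtend (cell φ₀) P₀ k₁ x.incl := fun x => by
    rw [radialExtend_incl, e₀, e₀']
  have k₃ : ∀ x : CellBoundary k, radialExtend (cell φ₀) P₀ k₁ x.incl = inl φ₀ (φ₀ x) := fun x => by
    rw [radialExtend_incl, e₀, cell_incl]
  have k₄ : ∀ x : CellBoundary k,
      radialExtend (radialExtend (cell φ₀) P₀ k₁) P₀' k₂ x.incl = inl φ₀ (φ₀ x) := fun x => by
    rw [radialExtend_incl, e₀', cell_incl]
  have H₁ : Homotopic (ContinuousMap.id (AttachCell φ₀)) (desc (inl φ₀) _ k₃) := by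
    have : ContinuousMap.id (AttachCell φ₀) = desc (inl φ₀) (cell φ₀) (fun x => cell_incl x) :=
      hom_ext (fun x => rfl) fun y => rfl
    rw [this]
    exact desc_homotopic_stretch _ _ _ _ _ fun y => radialExtend_const _ _ _ (fun q => e₀ _) y
  have H₂ : Homotopic (desc (inl φ₀) _ k₃) (desc (inl φ₀) _ k₄) :=
    desc_homotopic_stretch _ _ _ _ _ fun y => radialExtend_const _ _ _
      (fun q => by rw [radialExtend_incl, e₀, e₀']) y
  refine ((H₁.trans H₂).trans ?_).symm
  refine homotopic_of_curried (ContinuousMap.curry ((inl φ₀).comp ContinuousMap.fst))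
    (radialExtend (radialExtend c P hP) P' hP') (fun x => ?_) (fun x => rfl) (fun x => rfl) (fun y => ?_)
    (fun y => ?_)
  · rw [radialExtend_incl]
    ext τ
    simp [P', h₀]
  · rw [desc_cell]
    exact map_radialExtend (evalPath A 0) _ _ _ _ _ _
      (fun y => map_radialExtend (evalPath A 0) _ _ _ _ _ _ (fun y => rfl) (fun q => rfl) y)
      (fun q => rfl) y
  · refine (map_radialExtend (evalPath A 1) _ _ hP' (radialExtend (cell φ₀) ((inl φ₀).comp γ) fun x => by
      rw [comp_apply, h₀, cell_incl]) ((inl φ₀).comp γ') (fun x => by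
        rw [radialExtend_incl, comp_apply, comp_apply, h₀', h₁])
      (fun y => map_radialExtend (evalPath A 1) _ _ _ _ _ _ (fun y => rfl)
        (fun q => by simp [evalPath, P]) y) (fun q => by simp [evalPath, P', hγ]) y).trans ?_
    rw [comp_apply]
    exact (map_radialExtend (slide γ h₀ h₁) _ _ (fun x => by
      rw [comp_apply, h₀', cell_incl]) _ _ _ (fun y => rfl) (fun q => rfl) y).symm

/-- The map between cell attachments induced by a map of the bases. -/
def push (h : C(X, Y)) (φ : C(CellBoundary k, X)) (ψ : C(CellBoundary k, Y))
    (e : ∀ x, ψ x = h (φ x)) : C(AttachCell φ, AttachCell ψ) :=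
  desc ((inl ψ).comp h) (cell ψ) fun x => by rw [cell_incl, e, comp_apply]

theorem slide_comp_push {g : C(X, X)} (G : Homotopy (ContinuousMap.id X) g)
    (φ ψ : C(CellBoundary k, X)) (e : ∀ x, ψ x = g (φ x)) :
    Homotopic ((slide (φ₀ := φ) (φ₁ := ψ) ⟨fun q => G (q.2, φ q.1), by fun_prop⟩
      (fun x => by simp) (fun x => by simp [e])).comp (push g φ ψ e)) (ContinuousMap.id _) := by
  let A := AttachCell φ
  let P : C(CellBoundary k × I, C(I, A)) := ContinuousMap.curry
    ⟨fun q => inl φ (G (q.2 * q.1.2, φ q.1.1)), by fun_prop⟩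
  let c : C(Cell k, C(I, A)) := ContinuousMap.curry ((cell φ).comp ContinuousMap.fst)
  have hP : ∀ x, P (x, 0) = c x.incl := fun x => by
    ext τ
    simp [P, c, cell_incl]
  let P₀ : C(CellBoundary k × I, A) := (evalPath A 0).comp P
  have e₀ : ∀ q, P₀ q = cell φ q.1.incl := fun q => by
    simp [P₀, P, evalPath, cell_incl]
  have k₁ : ∀ x, P₀ (x, 0) = cell φ x.incl := fun x => e₀ _
  have k₃ : ∀ x : CellBoundary k, radialExtend (cell φ) P₀ k₁ x.incl = inl φ (φ x) := fun x => by
    rw [radialExtend_incl, e₀, cell_incl]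
  have H₁ : Homotopic (ContinuousMap.id (AttachCell φ)) (desc (inl φ) _ k₃) := by
    have : ContinuousMap.id (AttachCell φ) = desc (inl φ) (cell φ) (fun x => cell_incl x) :=
      hom_ext (fun x => rfl) fun y => rfl
    rw [this]
    exact desc_homotopic_stretch _ _ _ _ _ fun y => radialExtend_const _ _ _ (fun q => e₀ _) y
  refine (H₁.trans ?_).symm
  refine homotopic_of_curried (ContinuousMap.curry ⟨fun q => inl φ (G (q.2, q.1)), by fun_prop⟩)
    (radialExtend c P hP) (fun x => ?_) (fun x => ?_) (fun x => ?_) (fun y => ?_) (fun y => ?_)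
  · rw [radialExtend_incl]
    ext τ
    simp [P]
  · simp
  · simp only [curry_apply, ContinuousMap.coe_mk, Homotopy.apply_one, comp_apply]
    rfl
  · rw [desc_cell]
    exact map_radialExtend (evalPath A 0) _ _ _ _ _ _ (fun y => rfl) (fun q => rfl) y
  · rw [comp_apply]
    exact map_radialExtend (evalPath A 1) _ _ _ _ _ (fun x => by
      rw [cell_incl]; simp) (fun y => rfl) (fun q => by simp [evalPath, P]) y

/-- A continuous map is a homotopy equivalence if it has a two-sided homotopy inverse. -/
def _root_.ContinuousMap.IsHomotopyEquiv (f : C(X, Y)) : Prop :=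
  ∃ g : C(Y, X), Homotopic (g.comp f) (ContinuousMap.id X) ∧
    Homotopic (f.comp g) (ContinuousMap.id Y)

theorem _root_.ContinuousMap.IsHomotopyEquiv.of_comp_homotopic_id {f : C(X, Y)} {g : C(Y, X)}
    (hg : g.IsHomotopyEquiv) (h : Homotopic (g.comp f) (ContinuousMap.id X)) :
    f.IsHomotopyEquiv := by
  obtain ⟨g', h₁, h₂⟩ := hg
  refine ⟨g, h, ?_⟩
  have k₁ : Homotopic (g'.comp ((g.comp f).comp g)) (g'.comp g) :=
    (Homotopic.refl g').comp (h.comp (Homotopic.refl g))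
  have k₂ : Homotopic ((g'.comp g).comp (f.comp g)) (f.comp g) :=
    h₁.comp (Homotopic.refl (f.comp g))
  exact (k₂.symm.trans k₁).trans h₁

theorem isHomotopyEquiv_slide {φ₀ φ₁ : C(CellBoundary k, X)} (γ : C(CellBoundary k × I, X))
    (h₀ : ∀ x, γ (x, 0) = φ₀ x) (h₁ : ∀ x, γ (x, 1) = φ₁ x) : (slide γ h₀ h₁).IsHomotopyEquiv :=
  ⟨slide ⟨fun q => γ (q.1, σ q.2), by fun_prop⟩ (fun x => by simp [h₁]) (fun x => by simp [h₀]),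
    slide_comp_slide _ _ _ _ _ _ fun x τ => by simp, slide_comp_slide _ _ _ _ _ _ fun x τ => rfl⟩

theorem isHomotopyEquiv_push {g : C(X, X)} (hg : Homotopic g (ContinuousMap.id X))
    (φ ψ : C(CellBoundary k, X)) (e : ∀ x, ψ x = g (φ x)) : (push g φ ψ e).IsHomotopyEquiv := by
  obtain ⟨G⟩ := hg.symm
  exact (isHomotopyEquiv_slide _ _ _).of_comp_homotopic_id (slide_comp_push G φ ψ e)

theorem isHomotopyEquiv_push_of_equiv (h : ContinuousMap.HomotopyEquiv X Y)
    (φ : C(CellBoundary k, X)) :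
    (push h.toFun φ (h.toFun.comp φ) fun _ => rfl).IsHomotopyEquiv := by
  let H := push h.toFun φ (h.toFun.comp φ) fun _ => rfl
  let K := push h.invFun (h.toFun.comp φ) (h.invFun.comp (h.toFun.comp φ)) fun _ => rfl
  let H' := push h.toFun (h.invFun.comp (h.toFun.comp φ))
    (h.toFun.comp (h.invFun.comp (h.toFun.comp φ))) fun _ => rfl
  have e₁ : K.comp H = push (h.invFun.comp h.toFun) φ _ fun _ => rfl :=
    hom_ext (fun x => rfl) fun y => rfl
  have e₂ : H'.comp K = push (h.toFun.comp h.invFun) _ _ fun _ => rfl :=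
    hom_ext (fun x => rfl) fun y => rfl
  obtain ⟨a, a₁, a₂⟩ : (K.comp H).IsHomotopyEquiv := by
    rw [e₁]; exact isHomotopyEquiv_push h.left_inv _ _ _
  obtain ⟨b, b₁, b₂⟩ : (H'.comp K).IsHomotopyEquiv := by
    rw [e₂]; exact isHomotopyEquiv_push h.right_inv _ _ _
  have c₁ : Homotopic ((b.comp H').comp K) (ContinuousMap.id _) := b₁
  have c₂ : Homotopic (K.comp (H.comp a)) (ContinuousMap.id _) := a₂
  have c₃ : Homotopic (b.comp H') (H.comp a) := by
    have k₁ : Homotopic ((b.comp H').comp (K.comp (H.comp a))) (b.comp H') :=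
      (Homotopic.refl (b.comp H')).comp c₂
    have k₂ : Homotopic (((b.comp H').comp K).comp (H.comp a)) (H.comp a) :=
      c₁.comp (Homotopic.refl _)
    exact k₁.symm.trans k₂
  have hK : K.IsHomotopyEquiv :=
    ⟨b.comp H', c₁, ((Homotopic.refl K).comp c₃).trans c₂⟩
  have hKa : (a.comp K).IsHomotopyEquiv := by
    refine ⟨H, ?_, a₁⟩
    have k₁ : Homotopic ((H.comp a).comp K) ((b.comp H').comp K) :=
      c₃.symm.comp (Homotopic.refl K)
    exact k₁.trans c₁
  exact hKa.of_comp_homotopic_id a₁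

/-- Attaching cells to homotopy equivalent spaces along corresponding maps. -/
theorem nonempty_homotopyEquiv (h : ContinuousMap.HomotopyEquiv X Y) (φ : C(CellBoundary k, X)) :
    Nonempty (ContinuousMap.HomotopyEquiv (AttachCell φ) (AttachCell (h.toFun.comp φ))) := by
  obtain ⟨g, h₁, h₂⟩ := isHomotopyEquiv_push_of_equiv h φ
  exact ⟨⟨_, g, h₁, h₂⟩⟩

end AttachCell

/-! ### Attaching several cells -/

theorem HomotopyEquivAttachCells.congr_base (ks : List ℕ) {X : Type uX} {Y : Type uY}
    [TopologicalSpace X] [TopologicalSpace Y] (h : ContinuousMap.HomotopyEquiv X Y)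
    (H : HomotopyEquivAttachCells Z ks X) : HomotopyEquivAttachCells Z ks Y := by
  induction ks generalizing X Y with
  | nil => exact H.map fun e => e.trans h
  | cons k ks ih =>
    obtain ⟨φ, hφ⟩ := H
    obtain ⟨e⟩ := AttachCell.nonempty_homotopyEquiv h φ
    exact ⟨h.toFun.comp φ, ih e hφ⟩

theorem HomotopyEquivAttachCells.trans (ks ks' : List ℕ) {X : Type uX} [TopologicalSpace X]
    (H : HomotopyEquivAttachCells Z ks X) (H' : HomotopyEquivAttachCells Z' ks' Z) :
    HomotopyEquivAttachCells Z' (ks ++ ks') X := by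
  induction ks generalizing X with
  | nil => obtain ⟨e⟩ := H; exact H'.congr_base _ e
  | cons k ks ih =>
    obtain ⟨φ, hφ⟩ := H
    exact ⟨φ, ih hφ⟩

theorem HomotopyEquivAttachCells.congr_left (ks : List ℕ) {X : Type uX} [TopologicalSpace X]
    (H : HomotopyEquivAttachCells Z ks X) (e : ContinuousMap.HomotopyEquiv Z' Z) :
    HomotopyEquivAttachCells Z' ks X := by
  simpa using HomotopyEquivAttachCells.trans (Z' := Z') ks [] H ⟨e⟩

/-- The union of a closed set and of an embedded disc which meets it exactly in the boundary
sphere is a cell attachment. -/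
theorem exists_homeomorph_attachCell {M : Type uX} [TopologicalSpace M] [T2Space M] {A : Set M}
    (hA : IsClosed A) (c : C(Cell k, M)) (hc : Function.Injective c)
    (hcA : ∀ y, c y ∈ A ↔ ‖y.1‖ = 1) :
    ∃ φ : C(CellBoundary k, A), Nonempty (AttachCell φ ≃ₜ ↥(A ∪ Set.range c)) := by
  let φ : C(CellBoundary k, A) := ⟨fun x => ⟨c x.incl, (hcA _).2 (mem_sphere_zero_iff_norm.1 x.2)⟩,
    Continuous.subtype_mk (c.continuous.comp CellBoundary.continuous_incl) _⟩
  refine ⟨φ, ?_⟩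
  let F : C(AttachCell φ, ↥(A ∪ Set.range c)) := AttachCell.desc
    ⟨fun x => ⟨x.1, Or.inl x.2⟩, by fun_prop⟩ ⟨fun y => ⟨c y, Or.inr ⟨y, rfl⟩⟩, by fun_prop⟩
    fun x => rfl
  have key : ∀ (y : Cell k) (x : A), c y = x.1 → AttachCell.cell φ y = AttachCell.inl φ x := by
    intro y x h
    have hy := (hcA y).1 (h ▸ x.2)
    have : y = CellBoundary.incl ⟨y.1, mem_sphere_zero_iff_norm.2 hy⟩ := rfl
    rw [this, AttachCell.cell_incl]
    congr 1
    exact Subtype.ext h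
  have inj : Function.Injective F := by
    rintro a b hab
    obtain ⟨a, rfl⟩ := Quot.exists_rep a
    obtain ⟨b, rfl⟩ := Quot.exists_rep b
    have hab := congrArg Subtype.val hab
    cases a with
    | inl x => cases b with
      | inl x' => exact congrArg (AttachCell.inl φ) (Subtype.ext hab)
      | inr y => exact (key y x hab.symm).symm
    | inr y => cases b with
      | inl x => exact key y x hab
      | inr y' => exact congrArg (AttachCell.cell φ) (hc hab)
  have surj : Function.Surjective F := by
    rintro ⟨m, h | ⟨y, h⟩⟩
    · exact ⟨AttachCell.inl φ ⟨m, h⟩, rfl⟩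
    · exact ⟨AttachCell.cell φ y, Subtype.ext h⟩
  have closed : IsClosedMap F := by
    intro C hC
    have e : F '' C = (fun z : ↥(A ∪ Set.range c) => z.1) ⁻¹'
        ((Subtype.val '' (AttachCell.inl φ ⁻¹' C)) ∪ (c '' (AttachCell.cell φ ⁻¹' C))) := by
      ext z
      constructor
      · rintro ⟨a, ha, rfl⟩
        obtain ⟨a, rfl⟩ := Quot.exists_rep a
        cases a with
        | inl x => exact Or.inl ⟨x, ha, rfl⟩
        | inr y => exact Or.inr ⟨y, ha, rfl⟩
      · rintro (⟨x, hx, h⟩ | ⟨y, hy, h⟩)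
        · exact ⟨_, hx, Subtype.ext h⟩
        · exact ⟨_, hy, Subtype.ext h⟩
    rw [e]
    have : CompactSpace (Cell k) := isCompact_iff_compactSpace.1 (isCompact_closedBall _ _)
    exact IsClosed.preimage continuous_subtype_val
      ((hA.isClosedEmbedding_subtypeVal.isClosedMap _ (hC.preimage (map_continuous _))).union
        (((hC.preimage (map_continuous _)).isCompact.image (map_continuous c)).isClosed))
  exact ⟨(Equiv.ofBijective F ⟨inj, surj⟩).toHomeomorphOfContinuousClosed F.continuous closed⟩

/-- Attaching a list of embedded discs with disjoint images. -/
theorem homotopyEquivAttachCells_union {M : Type uX} [TopologicalSpace M] [T2Space M] {ι : Type*}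
    (l : List ι) (hl : l.Nodup) (d : ι → ℕ) (c : ∀ i, C(Cell (d i), M)) {A : Set M}
    (hA : IsClosed A) (hc : ∀ i ∈ l, Function.Injective (c i))
    (hcA : ∀ i ∈ l, ∀ y, c i y ∈ A ↔ ‖y.1‖ = 1)
    (hdisj : ∀ i ∈ l, ∀ j ∈ l, i ≠ j → Disjoint (Set.range (c i)) (Set.range (c j))) :
    HomotopyEquivAttachCells ↥(A ∪ ⋃ i ∈ l, Set.range (c i)) (l.map d) A := by
  induction l generalizing A with
  | nil =>
    refine ⟨?_⟩
    rw [show A ∪ ⋃ i ∈ ([] : List ι), Set.range (c i) = A by simp]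
    exact .refl A
  | cons i l ih =>
    obtain ⟨φ, ⟨e⟩⟩ := exists_homeomorph_attachCell hA (c i) (hc i (by simp)) (hcA i (by simp))
    refine ⟨φ, HomotopyEquivAttachCells.congr_base _ e.symm.toHomotopyEquiv ?_⟩
    have hcl : IsClosed (Set.range (c i)) := by
      have : CompactSpace (Cell (d i)) := isCompact_iff_compactSpace.1 (isCompact_closedBall _ _)
      exact (isCompact_range (map_continuous (c i))).isClosed
    have := ih (List.nodup_cons.1 hl).2 (hA.union hcl) (fun j hj => hc j (by simp [hj]))
      (fun j hj y => ?_) (fun j hj j' hj' => hdisj j (by simp [hj]) j' (by simp [hj']))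
    · have e₂ : A ∪ ⋃ j ∈ i :: l, Set.range (c j) =
          A ∪ Set.range (c i) ∪ ⋃ j ∈ l, Set.range (c j) := by
        ext z; simp [or_assoc]
      rw [e₂]
      exact this
    · have hne : j ≠ i := fun h => (List.nodup_cons.1 hl).1 (h ▸ hj)
      rw [← hcA j (by simp [hj]) y]
      refine ⟨fun h => h.resolve_right fun h' => ?_, Or.inl⟩
      exact Set.disjoint_left.1 (hdisj j (by simp [hj]) i (by simp) hne) ⟨y, rfl⟩ h'

/-- Two subsets which are mapped into each other by the end of a deformation of the ambient space
preserving both of them are homotopy equivalent. -/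
theorem nonempty_homotopyEquiv_of_deformation {M : Type uX} [TopologicalSpace M] {A B : Set M}
    (H : C(I × M, M)) (H₀ : ∀ x, H (0, x) = x) (HA : ∀ s, ∀ x ∈ A, H (s, x) ∈ A)
    (HB : ∀ s, ∀ x ∈ B, H (s, x) ∈ B) (hAB : ∀ x ∈ A, H (1, x) ∈ B)
    (hBA : ∀ x ∈ B, H (1, x) ∈ A) : Nonempty (ContinuousMap.HomotopyEquiv A B) := by
  refine ⟨⟨⟨fun x => ⟨H (1, x.1), hAB _ x.2⟩, by fun_prop⟩,
    ⟨fun x => ⟨H (1, x.1), hBA _ x.2⟩, by fun_prop⟩, ?_, ?_⟩⟩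
  · exact Homotopic.symm ⟨⟨⟨fun q => ⟨H (q.1, H (q.1, q.2.1)), HA _ _ (HA _ _ q.2.2)⟩,
      by fun_prop⟩, fun x => by simp [H₀], fun x => by simp⟩⟩
  · exact Homotopic.symm ⟨⟨⟨fun q => ⟨H (q.1, H (q.1, q.2.1)), HB _ _ (HB _ _ q.2.2)⟩,
      by fun_prop⟩, fun x => by simp [H₀], fun x => by simp⟩⟩

end AttachCell

/-! ### Pushing sublevel sets down -/

section Push

open unitInterval Filter Topology

variable {M : Type*} [TopologicalSpace M] {T : Type*}

theorem continuous_of_chart [T2Space M] {Y Z F : Type*} [TopologicalSpace Y] [TopologicalSpace Z]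
    [TopologicalSpace F] (e : OpenPartialHomeomorph M F) {K : Set F} (hK : IsCompact K)
    (hKe : K ⊆ e.target) {h : Y × M → Z}
    (h₁ : ContinuousOn (fun q : Y × F => h (q.1, e.symm q.2)) (Set.univ ×ˢ e.target))
    (h₂ : ContinuousOn h (Set.univ ×ˢ (e.symm '' K)ᶜ)) : Continuous h := by
  have hc : IsClosed (e.symm '' K) :=
    (hK.image_of_continuousOn (e.continuousOn_symm.mono hKe)).isClosed
  have ho₁ : IsOpen (Set.univ ×ˢ (e.symm '' K)ᶜ : Set (Y × M)) := isOpen_univ.prod hc.isOpen_compl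
  have ho₂ : IsOpen (Set.univ ×ˢ e.source : Set (Y × M)) := isOpen_univ.prod e.open_source
  have h₃ : ContinuousOn h (Set.univ ×ˢ e.source) := by
    have : ContinuousOn (fun q : Y × M => (q.1, e q.2)) (Set.univ ×ˢ e.source) :=
      continuous_fst.continuousOn.prodMk
        (e.continuousOn.comp continuous_snd.continuousOn fun q hq => hq.2)
    refine (h₁.comp this fun q hq => ⟨trivial, e.map_source hq.2⟩).congr fun q hq => ?_
    simp [e.left_inv hq.2]
  refine continuous_iff_continuousAt.2 fun q => ?_
  by_cases hq : q.2 ∈ e.source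
  · exact h₃.continuousAt (ho₂.mem_nhds ⟨trivial, hq⟩)
  · refine h₂.continuousAt (ho₁.mem_nhds ⟨trivial, fun h => hq ?_⟩)
    obtain ⟨y, hy, h⟩ := h
    rw [← h]
    exact e.map_target (hKe hy)

/-- A deformation of a chart domain with compact support extends to the whole space. -/
theorem exists_deformation_of_chart [T2Space M] {F : Type*} [TopologicalSpace F]
    (e : OpenPartialHomeomorph M F) {K : Set F} (hK : IsCompact K) (hKe : K ⊆ e.target)
    (m : I × F → F) (hm : Continuous m) (hmK : ∀ s, ∀ y ∈ K, m (s, y) ∈ K)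
    (hm' : ∀ s, ∀ y ∉ K, m (s, y) = y) :
    ∃ H : C(I × M, M), (∀ s, ∀ y ∈ e.target, H (s, e.symm y) = e.symm (m (s, y))) ∧
      ∀ s, ∀ x ∉ e.symm '' K, H (s, x) = x := by
  classical
  let h : I × M → M := fun q => if q.2 ∈ e.source then e.symm (m (q.1, e q.2)) else q.2
  have k₁ : ∀ s, ∀ y ∈ e.target, h (s, e.symm y) = e.symm (m (s, y)) := fun s y hy => by
    simp [h, e.map_target hy, e.right_inv hy]
  have k₂ : ∀ s, ∀ x ∉ e.symm '' K, h (s, x) = x := fun s x hx => by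
    by_cases hxe : x ∈ e.source
    · have : e x ∉ K := fun hK => hx ⟨e x, hK, e.left_inv hxe⟩
      simp [h, hxe, hm' s _ this, e.left_inv hxe]
    · simp [h, hxe]
  refine ⟨⟨h, continuous_of_chart e hK hKe ?_ ?_⟩, k₁, k₂⟩
  · refine (e.continuousOn_symm.comp hm.continuousOn fun q hq => ?_).congr
      fun q hq => k₁ q.1 q.2 hq.2
    by_cases hqK : q.2 ∈ K
    · exact hKe (hmK q.1 _ hqK)
    · have := hm' q.1 _ hqK
      rw [Prod.mk.eta] at this
      rw [this]; exact hq.2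
  · exact continuous_snd.continuousOn.congr fun q hq => k₂ q.1 q.2 hq.2

theorem exists_continuousMap_of_chart [T2Space M] {F : Type*} [TopologicalSpace F]
    (e : OpenPartialHomeomorph M F) {K : Set F} (hK : IsCompact K) (hKe : K ⊆ e.target)
    (g : F → ℝ) (hg : ContinuousOn g e.target) (hg' : ∀ y ∉ K, g y = 0) :
    ∃ d : C(M, ℝ), (∀ y ∈ e.target, d (e.symm y) = g y) ∧ ∀ x ∉ e.symm '' K, d x = 0 := by
  classical
  let h : Unit × M → ℝ := fun q => if q.2 ∈ e.source then g (e q.2) else 0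
  have k₁ : ∀ y ∈ e.target, h ((), e.symm y) = g y := fun y hy => by
    simp [h, e.map_target hy, e.right_inv hy]
  have k₂ : ∀ x ∉ e.symm '' K, h ((), x) = 0 := fun x hx => by
    by_cases hxe : x ∈ e.source
    · have : e x ∉ K := fun hK => hx ⟨e x, hK, e.left_inv hxe⟩
      simp [h, hxe, hg' _ this]
    · simp [h, hxe]
  have hh : Continuous h := by
    refine continuous_of_chart e hK hKe ?_ ?_
    · exact (hg.comp continuous_snd.continuousOn fun q hq => hq.2).congr fun q hq => k₁ q.2 hq.2
    · exact continuousOn_const.congr fun q hq => k₂ q.2 hq.2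
  exact ⟨⟨fun x => h ((), x), by fun_prop⟩, k₁, k₂⟩

/-- A deformation of `M` supported in `W` which does not increase the functions `Φ τ` and whose
end decreases them by at least the function `d`. -/
structure IsPush (l : Filter T) (Φ : T → M → ℝ) (W : Set M) (H : C(I × M, M)) (d : C(M, ℝ)) :
    Prop where
  zero (x) : H (0, x) = x
  nonneg (x) : 0 ≤ d x
  fixed (s x) : d x = 0 → H (s, x) = x
  off (x) : x ∉ W → d x = 0
  mem (s x) : x ∈ W → H (s, x) ∈ W
  decr : ∀ᶠ τ in l, ∀ x, (∀ s, Φ τ (H (s, x)) ≤ Φ τ x) ∧ Φ τ (H (1, x)) ≤ Φ τ x - d x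

/-- The functions `Φ τ` can be pushed down near `x₀`. -/
def LocalPush (l : Filter T) (Φ : T → M → ℝ) (x₀ : M) : Prop :=
  ∀ W ∈ 𝓝 x₀, ∃ H d, IsPush l Φ W H d ∧ 0 < d x₀

variable {l : Filter T} {Φ : T → M → ℝ}

theorem IsPush.comp {W : Set M} {H₁ H₂ : C(I × M, M)} {d₁ d₂ : C(M, ℝ)} (h₁ : IsPush l Φ W H₁ d₁)
    (h₂ : IsPush l Φ W H₂ d₂) : IsPush l Φ W ⟨fun q => H₁ (q.1, H₂ q),
      H₁.continuous.comp (continuous_fst.prodMk H₂.continuous)⟩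
      ⟨fun x => d₂ x + d₁ (H₂ (1, x)), by fun_prop⟩ where
  zero x := by simp [h₁.zero, h₂.zero]
  nonneg x := add_nonneg (h₂.nonneg _) (h₁.nonneg _)
  fixed s x hx := by
    have e₁ := h₁.nonneg (H₂ (1, x))
    have e₂ := h₂.nonneg x
    simp only [ContinuousMap.coe_mk] at hx ⊢
    have e₃ : d₂ x = 0 := by linarith
    rw [h₂.fixed _ _ e₃] at hx ⊢
    exact h₁.fixed _ _ (by linarith)
  off x hx := by simp [h₂.off x hx, h₂.fixed 1 x (h₂.off x hx), h₁.off x hx]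
  mem s x hx := h₁.mem s _ (h₂.mem s x hx)
  decr := by
    filter_upwards [h₁.decr, h₂.decr] with τ k₁ k₂ x
    refine ⟨fun s => ((k₁ _).1 s).trans ((k₂ x).1 s), ?_⟩
    have e₁ := (k₁ (H₂ (1, x))).2
    have e₂ := (k₂ x).2
    simp only [ContinuousMap.coe_mk]
    linarith

theorem exists_isPush {K W : Set M} (hK : IsCompact K) (hW : ∀ x ∈ K, W ∈ 𝓝 x)
    (h : ∀ x ∈ K, LocalPush l Φ x) : ∃ H d, IsPush l Φ W H d ∧ ∀ x ∈ K, 0 < d x := by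
  refine hK.induction_on (p := fun S => ∃ H d, IsPush l Φ W H d ∧ ∀ x ∈ S, 0 < d x)
    ?_ ?_ ?_ ?_
  · exact ⟨⟨fun q => q.2, by fun_prop⟩, ⟨fun _ => 0, by fun_prop⟩,
      ⟨fun x => rfl, fun x => le_rfl, fun _ _ _ => rfl, fun _ _ => rfl, fun _ _ hx => hx,
        by simp⟩, by simp⟩
  · rintro S S' hS ⟨H, d, hH, hd⟩
    exact ⟨H, d, hH, fun x hx => hd x (hS hx)⟩
  · rintro S S' ⟨H₁, d₁, hH₁, hd₁⟩ ⟨H₂, d₂, hH₂, hd₂⟩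
    refine ⟨_, _, hH₁.comp hH₂, ?_⟩
    intro x hx
    change 0 < d₂ x + d₁ (H₂ (1, x))
    rcases (hH₂.nonneg x).eq_or_lt with h0 | h0
    · rw [hH₂.fixed 1 x h0.symm, ← h0, zero_add]
      rcases hx with hx | hx
      · exact hd₁ x hx
      · exact absurd (hd₂ x hx) (by rw [← h0]; simp)
    · exact add_pos_of_pos_of_nonneg h0 (hH₁.nonneg _)
  · intro x hx
    obtain ⟨H, d, hH, hd⟩ := h x hx W (hW x hx)
    exact ⟨{y | 0 < d y}, mem_nhdsWithin_of_mem_nhds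
      ((isOpen_lt continuous_const d.continuous).mem_nhds hd), H, d, hH, fun y hy => hy⟩

/-- If moving along a fixed direction of a chart decreases the functions at a definite speed, then
they can be pushed down. -/
theorem localPush_of_chart [T2Space M] {F : Type*} [NormedAddCommGroup F] [NormedSpace ℝ F] [ProperSpace F]
    (e : OpenPartialHomeomorph M F) {x₀ : M} (hx₀ : x₀ ∈ e.source) (v : F) {c : ℝ} (hc : 0 < c)
    (h : ∀ᶠ p in l ×ˢ (𝓝 (e x₀) ×ˢ 𝓝[≥] (0 : ℝ)),
      Φ p.1 (e.symm (p.2.1 + p.2.2 • v)) ≤ Φ p.1 (e.symm p.2.1) - c * p.2.2) :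
    LocalPush l Φ x₀ := by
  intro W hW
  set y₀ := e x₀ with hy₀
  obtain ⟨L, hL, Q, hQ, hLQ⟩ := eventually_prod_iff.1 h
  obtain ⟨Q₁, hQ₁, Q₂, hQ₂, hQQ⟩ := eventually_prod_iff.1 hQ
  have hW' : e.symm ⁻¹' W ∈ 𝓝 y₀ :=
    (e.continuousAt_symm (e.map_source hx₀)).preimage_mem_nhds (by rwa [e.left_inv hx₀])
  obtain ⟨r₁, hr₁, hball⟩ := Metric.nhds_basis_closedBall.mem_iff.1
    (inter_mem (inter_mem hW' (e.open_target.mem_nhds (e.map_source hx₀))) hQ₁)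
  obtain ⟨r₂, hr₂, hr₂'⟩ := mem_nhdsGE_iff_exists_Ico_subset.1 hQ₂
  let r : ℝ := min r₁ (r₂ / 2)
  have hr₂ : 0 < r₂ := hr₂
  have hr : 0 < r := lt_min hr₁ (by positivity)
  let η : ℝ := (1 + ‖v‖)⁻¹
  have hη : 0 < η := by positivity
  have hη1 : η ≤ 1 := inv_le_one_of_one_le₀ (by linarith [norm_nonneg v])
  have hηv : η * ‖v‖ ≤ 1 := by
    rw [inv_mul_le_iff₀ (by positivity)]; linarith
  let ρ : F → ℝ := fun y => max 0 (r - dist y y₀)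
  have hρ : Continuous ρ := by fun_prop
  have hρ0 : ∀ y, 0 ≤ ρ y := fun y => le_max_left _ _
  have hρr : ∀ y, ρ y ≤ r := fun y => max_le hr.le (by linarith [dist_nonneg (x := y) (y := y₀)])
  have hρK : ∀ y ∉ Metric.closedBall y₀ r, ρ y = 0 := fun y hy => by
    rw [Metric.mem_closedBall, not_le] at hy
    exact max_eq_left (by linarith)
  let m : I × F → F := fun q => q.2 + ((q.1 : ℝ) * η * ρ q.2) • v
  have hm : Continuous m := by fun_prop
  have hK : IsCompact (Metric.closedBall y₀ r) := isCompact_closedBall _ _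
  have hsub : Metric.closedBall y₀ r ⊆ Metric.closedBall y₀ r₁ :=
    Metric.closedBall_subset_closedBall (min_le_left _ _)
  have hKe : Metric.closedBall y₀ r ⊆ e.target := fun y hy => (hball (hsub hy)).1.2
  have hmK : ∀ s, ∀ y ∈ Metric.closedBall y₀ r, m (s, y) ∈ Metric.closedBall y₀ r := by
    intro s y hy
    have h1 : ρ y = r - dist y y₀ := max_eq_right (by linarith [Metric.mem_closedBall.1 hy])
    have h2 : dist (m (s, y)) y ≤ ρ y := by
      simp only [m, dist_eq_norm, add_sub_cancel_left, norm_smul, norm_mul, Real.norm_eq_abs,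
        abs_of_nonneg s.2.1, abs_of_nonneg hη.le, abs_of_nonneg (hρ0 y)]
      calc (s : ℝ) * η * ρ y * ‖v‖ = s * ρ y * (η * ‖v‖) := by ring
        _ ≤ s * ρ y * 1 := by
          gcongr
          exact mul_nonneg s.2.1 (hρ0 y)
        _ ≤ 1 * ρ y * 1 := by
          gcongr
          exact s.2.2
        _ = ρ y := by ring
    rw [Metric.mem_closedBall]
    linarith [dist_triangle (m (s, y)) y y₀]
  obtain ⟨H, hH₁, hH₂⟩ := exists_deformation_of_chart e hK hKe m hm hmK fun s y hy => by
    simp [m, hρK y hy]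
  obtain ⟨d, hd₁, hd₂⟩ := exists_continuousMap_of_chart e hK hKe (fun y => c * η * ρ y)
    (by fun_prop) fun y hy => by simp [hρK y hy]
  have hdx₀ : 0 < d x₀ := by
    rw [← e.left_inv hx₀, hd₁ _ (e.map_source hx₀)]
    have : ρ y₀ = r := by simp [ρ, hr.le]
    rw [← hy₀, this]
    positivity
  refine ⟨H, d, ⟨fun x => ?_, fun x => ?_, fun s x hx => ?_, fun x hx => ?_, fun s x hx => ?_, ?_⟩,
    hdx₀⟩
  · by_cases hx : x ∈ e.symm '' Metric.closedBall y₀ r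
    · obtain ⟨y, hy, rfl⟩ := hx
      rw [hH₁ _ _ (hKe hy)]
      simp [m]
    · exact hH₂ _ _ hx
  · by_cases hx : x ∈ e.symm '' Metric.closedBall y₀ r
    · obtain ⟨y, hy, rfl⟩ := hx
      rw [hd₁ _ (hKe hy)]
      have := hρ0 y
      positivity
    · rw [hd₂ _ hx]
  · by_cases hx' : x ∈ e.symm '' Metric.closedBall y₀ r
    · obtain ⟨y, hy, rfl⟩ := hx'
      rw [hd₁ _ (hKe hy)] at hx
      have : ρ y = 0 := by
        rcases mul_eq_zero.1 hx with h | h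
        · exact absurd h (by positivity)
        · exact h
      rw [hH₁ _ _ (hKe hy)]
      simp [m, this]
    · exact hH₂ _ _ hx'
  · refine hd₂ _ fun hx' => hx ?_
    obtain ⟨y, hy, rfl⟩ := hx'
    exact (hball (hsub hy)).1.1
  · by_cases hx' : x ∈ e.symm '' Metric.closedBall y₀ r
    · obtain ⟨y, hy, rfl⟩ := hx'
      rw [hH₁ _ _ (hKe hy)]
      exact (hball (hsub (hmK s y hy))).1.1
    · rwa [hH₂ _ _ hx']
  · filter_upwards [hL] with τ hτ x
    by_cases hx' : x ∈ e.symm '' Metric.closedBall y₀ r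
    · obtain ⟨y, hy, rfl⟩ := hx'
      have key : ∀ s : I, Φ τ (H (s, e.symm y)) ≤ Φ τ (e.symm y) - c * (s * η * ρ y) := by
        intro s
        have h0 : 0 ≤ (s : ℝ) * η * ρ y := mul_nonneg (mul_nonneg s.2.1 hη.le) (hρ0 y)
        have h1 : (s : ℝ) * η * ρ y ≤ r := by
          calc (s : ℝ) * η * ρ y ≤ 1 * 1 * r := by
                gcongr
                · exact s.2.2
                · exact hρr y
            _ = r := by ring
        have h2 : r ≤ r₂ / 2 := min_le_right _ _
        rw [hH₁ _ _ (hKe hy)]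
        exact hLQ hτ (hQQ (x := y) (hball (hsub hy)).2
          (y := (s : ℝ) * η * ρ y) (hr₂' ⟨h0, by linarith⟩))
      refine ⟨fun s => (key s).trans ?_, ?_⟩
      · have := mul_nonneg hc.le (mul_nonneg (mul_nonneg s.2.1 hη.le) (hρ0 y))
        linarith
      · have := key 1
        rw [hd₁ _ (hKe hy)]
        simp only [Set.Icc.coe_one, one_mul] at this
        linarith
    · simp [hH₂ _ _ hx', hd₂ _ hx']

/-- On a compact set where the level set of the limit function can be pushed down, the nearby
sublevel sets are pushed below the level by a definite amount. -/
theorem exists_isPush_drop {W K : Set M} (hK : IsCompact K) {g : M → ℝ} (hg : Continuous g)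
    (hΦ : ∀ ε > 0, ∀ᶠ τ in l, ∀ x, |Φ τ x - g x| < ε) (a : ℝ)
    (hW : ∀ x ∈ K, g x = a → W ∈ 𝓝 x) (h : ∀ x ∈ K, g x = a → LocalPush l Φ x) :
    ∃ H d, IsPush l Φ W H d ∧ ∃ m > 0, ∀ᶠ τ in l, ∀ x ∈ K, Φ τ x ≤ a → Φ τ (H (1, x)) ≤ a - m := by
  obtain ⟨H, d, hH, hd⟩ := exists_isPush (l := l) (Φ := Φ) (W := W)
    (hK.inter_right (isClosed_singleton.preimage hg : IsClosed (g ⁻¹' {a})))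
    (fun x hx => hW x hx.1 hx.2) (fun x hx => h x hx.1 hx.2)
  obtain ⟨m, hm, hmK⟩ : ∃ m > 0, ∀ x ∈ K, m ≤ max |g x - a| (d x) := by
    rcases K.eq_empty_or_nonempty with rfl | hne
    · exact ⟨1, one_pos, by simp⟩
    · obtain ⟨x, hx, hmin⟩ := hK.exists_isMinOn hne
        (f := fun x => max |g x - a| (d x)) (by fun_prop)
      refine ⟨max |g x - a| (d x), ?_, fun y hy => hmin hy⟩
      by_cases hxa : g x = a
      · exact lt_max_of_lt_right (hd x ⟨hx, hxa⟩)
      · exact lt_max_of_lt_left (abs_pos.2 (sub_ne_zero.2 hxa))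
  refine ⟨H, d, hH, m / 2, by positivity, ?_⟩
  filter_upwards [hΦ (m / 4) (by positivity), hH.decr] with τ h₁ h₂ x hx hxa
  have h₃ := abs_lt.1 (h₁ x)
  obtain ⟨h₄, h₅⟩ := h₂ x
  have h₆ := h₄ 1
  have h₇ := hH.nonneg x
  rcases le_max_iff.1 (hmK x hx) with h | h
  · rcases le_abs'.1 h with h | h <;> linarith
  · linarith

/-- The homotopy type of the sublevel sets is constant along a path of functions which can be
pushed down at the level. -/
theorem nonempty_homotopyEquiv_of_path [T2Space M] [CompactSpace M] (Φ : ℝ → M → ℝ)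
    (hΦ : Continuous (Function.uncurry Φ)) (a : ℝ)
    (h : ∀ θ ∈ Set.Icc (0 : ℝ) 1, ∀ x, Φ θ x = a → LocalPush (𝓝[Set.Icc 0 1] θ) Φ x) :
    Nonempty (ContinuousMap.HomotopyEquiv {x | Φ 0 x ≤ a} {x | Φ 1 x ≤ a}) := by
  have hloc : ∀ θ ∈ Set.Icc (0 : ℝ) 1, ∀ᶠ τ in 𝓝[Set.Icc 0 1] θ,
      Nonempty (ContinuousMap.HomotopyEquiv {x | Φ θ x ≤ a} {x | Φ τ x ≤ a}) := by
    intro θ hθ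
    have hun : ∀ ε > 0, ∀ᶠ τ in 𝓝[Set.Icc 0 1] θ, ∀ x, |Φ τ x - Φ θ x| < ε := by
      intro ε hε
      have := isCompact_univ.eventually_forall_of_forall_eventually (x₀ := θ)
        (P := fun τ x => |Φ τ x - Φ θ x| < ε) fun x _ => by
          have hc : Continuous fun q : ℝ × M => |Φ q.1 q.2 - Φ θ q.2| := by
            have h2 : Continuous fun q : ℝ × M => Φ θ q.2 :=
              hΦ.comp (continuous_const.prodMk continuous_snd)
            exact (hΦ.sub h2).abs
          have := hc.continuousAt (x := (θ, x))
          exact this.eventually_lt_const (by simpa using hε)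
      simpa using this.filter_mono nhdsWithin_le_nhds
    obtain ⟨H, d, hH, m, hm, hdrop⟩ := exists_isPush_drop (l := 𝓝[Set.Icc 0 1] θ) (Φ := Φ) (W := Set.univ)
      (K := Set.univ) isCompact_univ (hΦ.comp (continuous_const.prodMk continuous_id)) hun a
      (fun x _ _ => univ_mem) (fun x _ hx => h θ hθ x hx)
    have h₀ := hdrop.self_of_nhdsWithin hθ
    have h₁ := hH.decr.self_of_nhdsWithin hθ
    filter_upwards [hun m hm, hH.decr, hdrop] with τ k₁ k₂ k₃
    refine nonempty_homotopyEquiv_of_deformation H hH.zero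
      (fun s x hx => ((h₁ x).1 s).trans hx) (fun s x hx => ((k₂ x).1 s).trans hx)
      (fun x hx => ?_) (fun x hx => ?_)
    · have e₁ := h₀ x trivial hx
      have e₂ := abs_lt.1 (k₁ (H (1, x)))
      simp only [Set.mem_ofPred_eq]
      linarith
    · have e₁ := k₃ x trivial hx
      have e₂ := abs_lt.1 (k₁ (H (1, x)))
      simp only [Set.mem_ofPred_eq]
      linarith
  exact isPreconnected_Icc.induction₂ (fun θ τ =>
    Nonempty (ContinuousMap.HomotopyEquiv {x | Φ θ x ≤ a} {x | Φ τ x ≤ a}))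
    (fun θ hθ => hloc θ hθ)
    (fun _ _ _ _ _ _ h₁ h₂ => h₁.elim fun e₁ => h₂.map fun e₂ => e₁.trans e₂)
    (fun _ _ _ _ h₁ => h₁.map fun e => e.symm)
    (Set.left_mem_Icc.2 zero_le_one) (Set.right_mem_Icc.2 zero_le_one)

end Push

/-! ### Diagonalizing a non-degenerate symmetric bilinear form -/

section LinearNormalForm

/-- The space `ℝᵏ × ℝᵐ`, with the maximum of the two Euclidean norms. -/
abbrev SplitSpace (k m : ℕ) : Type := EuclideanSpace ℝ (Fin k) × EuclideanSpace ℝ (Fin m)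

/-- The quadratic form `-|u|² + |v|²`. -/
noncomputable def splitForm {k m : ℕ} (x : SplitSpace k m) : ℝ := ‖x.2‖ ^ 2 - ‖x.1‖ ^ 2

variable {n : ℕ}

/-- The Gram matrix of a bilinear form on `ℝⁿ`. -/
noncomputable def gramMatrix
    (B : EuclideanSpace ℝ (Fin n) →L[ℝ] EuclideanSpace ℝ (Fin n) →L[ℝ] ℝ) :
    Matrix (Fin n) (Fin n) ℝ :=
  Matrix.of fun i j => B (EuclideanSpace.single i 1) (EuclideanSpace.single j 1)

theorem dotProduct_gramMatrix_mulVec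
    (B : EuclideanSpace ℝ (Fin n) →L[ℝ] EuclideanSpace ℝ (Fin n) →L[ℝ] ℝ) (v w : Fin n → ℝ) :
    v ⬝ᵥ (gramMatrix B).mulVec w = B (WithLp.toLp 2 v) (WithLp.toLp 2 w) := by
  have h : ∀ v : Fin n → ℝ, WithLp.toLp 2 v = ∑ i, v i • EuclideanSpace.single i (1 : ℝ) := by
    intro v
    ext j
    simp [Finset.sum_apply, Pi.single_apply]
  rw [h v, h w]
  simp only [map_sum, map_smul, sum_apply, smul_apply,
    dotProduct, Matrix.mulVec, gramMatrix, Matrix.of_apply, smul_eq_mul, Finset.mul_sum]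
  rw [Finset.sum_comm]
  exact Finset.sum_congr rfl fun i _ => Finset.sum_congr rfl fun j _ => by ring

theorem exists_splitForm_of_det_ne_zero
    (B : EuclideanSpace ℝ (Fin n) →L[ℝ] EuclideanSpace ℝ (Fin n) →L[ℝ] ℝ)
    (hB : ∀ x y, B x y = B y x) (hdet : (gramMatrix B).det ≠ 0) :
    ∃ k m : ℕ, ∃ L : SplitSpace k m ≃L[ℝ] EuclideanSpace ℝ (Fin n),
      ∀ x, B (L x) (L x) = 2 * splitForm x := by
  classical
  let b : LinearMap.BilinForm ℝ (EuclideanSpace ℝ (Fin n)) :=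
    LinearMap.mk₂ ℝ (fun x y => (1 / 2) * B x y) (fun x x' y => by simp [mul_add])
      (fun c x y => by simp; ring) (fun x y y' => by simp [mul_add]) (fun c x y => by simp; ring)
  have hbs : ∀ x y, b x y = b y x := fun x y => by simp [b, hB x y]
  have hsep : b.SeparatingLeft := by
    intro x hx
    have := Matrix.separatingLeft_iff_det_ne_zero.2 hdet
    rw [Matrix.separatingLeft_def] at this
    have h0 := this (WithLp.ofLp x) fun w => by
      rw [dotProduct_gramMatrix_mulVec]
      have := hx (WithLp.toLp 2 w)
      simpa [b] using this
    exact (WithLp.ofLp_eq_zero 2).1 h0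
  obtain ⟨w, hw, ⟨φ⟩⟩ :=
    QuadraticForm.equivalent_one_neg_one_weighted_sum_squared b.toQuadraticMap (by
      rwa [QuadraticMap.associated_left_inverse ℝ hbs])
  let p := Fintype.card {i // w i = -1}
  let q := Fintype.card {i // ¬ w i = -1}
  let e : Fin p ⊕ Fin q ≃ Fin (Module.finrank ℝ (EuclideanSpace ℝ (Fin n))) :=
    (Equiv.sumCongr (Fintype.equivFin _).symm (Fintype.equivFin _).symm).trans
      (Equiv.sumCompl fun i => w i = -1)
  have he₁ : ∀ i, w (e (Sum.inl i)) = -1 := fun i => ((Fintype.equivFin {i // w i = -1}).symm i).2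
  have he₂ : ∀ i, w (e (Sum.inr i)) = 1 := fun i =>
    (hw _).resolve_left ((Fintype.equivFin {i // ¬ w i = -1}).symm i).2
  let L : SplitSpace p q ≃ₗ[ℝ] EuclideanSpace ℝ (Fin n) :=
    ((((WithLp.linearEquiv 2 ℝ (Fin p → ℝ)).prodCongr (WithLp.linearEquiv 2 ℝ (Fin q → ℝ))).trans
      (LinearEquiv.sumArrowLequivProdArrow (Fin p) (Fin q) ℝ ℝ).symm).trans
      (LinearEquiv.funCongrLeft ℝ ℝ e.symm)).trans φ.toLinearEquiv.symm
  refine ⟨p, q, L.toContinuousLinearEquiv, fun x => ?_⟩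
  have h1 : B (L x) (L x) = 2 * b.toQuadraticMap (L x) := by
    simp [b, LinearMap.BilinMap.toQuadraticMap_apply]
  have h2 : b.toQuadraticMap (L x) = QuadraticMap.weightedSumSquares ℝ w (φ (L x)) :=
    (φ.map_app _).symm
  have h3 : φ (L x) = fun i => Sum.elim x.1.ofLp x.2.ofLp (e.symm i) :=
    φ.toLinearEquiv.apply_symm_apply _
  change B (L x) (L x) = _
  rw [h1, h2, h3, QuadraticMap.weightedSumSquares_apply, ← e.sum_comp, Fintype.sum_sum_type]
  simp only [he₁, he₂, Equiv.symm_apply_apply, Sum.elim_inl, Sum.elim_inr, splitForm,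
    EuclideanSpace.real_norm_sq_eq, smul_eq_mul]
  simp only [neg_mul, one_mul, Finset.sum_neg_distrib, pow_two]
  ring

theorem isMatrixIndex_gramMatrix_unique
    (B : EuclideanSpace ℝ (Fin n) →L[ℝ] EuclideanSpace ℝ (Fin n) →L[ℝ] ℝ) {k m d : ℕ}
    (L : SplitSpace k m ≃L[ℝ] EuclideanSpace ℝ (Fin n))
    (hL : ∀ x, B (L x) (L x) = 2 * splitForm x) (hd : IsMatrixIndex (gramMatrix B) d) : k = d := by
  refine le_antisymm (hd.2 ?_) ?_
  · let j : EuclideanSpace ℝ (Fin k) →ₗ[ℝ] (Fin n → ℝ) :=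
      (WithLp.linearEquiv 2 ℝ (Fin n → ℝ)).toLinearMap ∘ₗ L.toLinearEquiv.toLinearMap ∘ₗ
        LinearMap.inl ℝ _ _
    have hj : Function.Injective j := by
      intro x y hxy
      have h1 := L.injective ((WithLp.linearEquiv 2 ℝ (Fin n → ℝ)).injective hxy)
      exact (Prod.ext_iff.1 h1).1
    refine ⟨LinearMap.range j, ?_, ?_⟩
    · rw [LinearMap.finrank_range_of_inj hj, finrank_euclideanSpace_fin]
    · rintro _ ⟨u, rfl⟩ hu
      rw [dotProduct_gramMatrix_mulVec]
      have e : WithLp.toLp 2 (j u) = L (u, 0) := rfl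
      have hu' : u ≠ 0 := fun h => hu (by rw [h, map_zero])
      rw [e, hL]
      have := norm_pos_iff.2 hu'
      simp only [splitForm, norm_zero]
      nlinarith
  · obtain ⟨W, hW, hneg⟩ := hd.1
    let j : W →ₗ[ℝ] EuclideanSpace ℝ (Fin k) :=
      LinearMap.fst ℝ _ _ ∘ₗ L.symm.toLinearEquiv.toLinearMap ∘ₗ
        (WithLp.linearEquiv 2 ℝ (Fin n → ℝ)).symm.toLinearMap ∘ₗ W.subtype
    have hj : Function.Injective j := by
      rw [injective_iff_map_eq_zero]
      intro v hv
      by_contra hne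
      have h1 := hneg v.1 v.2 fun h => hne (Subtype.ext h)
      rw [dotProduct_gramMatrix_mulVec, ← L.apply_symm_apply (WithLp.toLp 2 v.1), hL] at h1
      have h2 : (L.symm (WithLp.toLp 2 v.1)).1 = 0 := hv
      simp only [splitForm, h2, norm_zero] at h1
      nlinarith [sq_nonneg ‖(L.symm (WithLp.toLp 2 v.1)).2‖]
    have := LinearMap.finrank_le_finrank_of_injective hj
    rwa [hW, finrank_euclideanSpace_fin] at this

theorem exists_splitForm_of_isMatrixIndex
    (B : EuclideanSpace ℝ (Fin n) →L[ℝ] EuclideanSpace ℝ (Fin n) →L[ℝ] ℝ)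
    (hB : ∀ x y, B x y = B y x) (hdet : (gramMatrix B).det ≠ 0) {k : ℕ}
    (hk : IsMatrixIndex (gramMatrix B) k) :
    ∃ m : ℕ, ∃ L : SplitSpace k m ≃L[ℝ] EuclideanSpace ℝ (Fin n),
      ∀ x, B (L x) (L x) = 2 * splitForm x := by
  obtain ⟨k', m, L, hL⟩ := exists_splitForm_of_det_ne_zero B hB hdet
  obtain rfl := isMatrixIndex_gramMatrix_unique B L hL hk
  exact ⟨m, L, hL⟩

end LinearNormalForm

/-! ### Families of functions in charts -/

section ChartCalculus

open Filter Topology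

theorem le_sub_mul_of_hasFDerivAt {F : Type*} [NormedAddCommGroup F] [NormedSpace ℝ F]
    {h : F → ℝ} {h' : F → F →L[ℝ] ℝ} {s : Set F} (hs : Convex ℝ s) {v : F} {c : ℝ}
    (hd : ∀ y ∈ s, HasFDerivAt h (h' y) y ∧ h' y v ≤ -c) {y : F} (hy : y ∈ s) {σ : ℝ} (hσ : 0 ≤ σ)
    (hyσ : y + σ • v ∈ s) : h (y + σ • v) ≤ h y - c * σ := by
  have hmem : ∀ τ ∈ Set.Icc 0 σ, y + τ • v ∈ s := by
    intro τ hτ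
    rcases hσ.eq_or_lt with h0 | h0
    · have : τ = 0 := le_antisymm (h0 ▸ hτ.2) hτ.1
      simpa [this] using hy
    · have := hs.add_smul_mem (x := y) (y := σ • v) hy hyσ
        (t := τ / σ) ⟨div_nonneg hτ.1 hσ, div_le_one_of_le₀ hτ.2 hσ⟩
      rwa [smul_smul, div_mul_cancel₀ _ h0.ne'] at this
  have hder : ∀ τ ∈ Set.Icc 0 σ, HasDerivAt (fun τ : ℝ => h (y + τ • v)) (h' (y + τ • v) v) τ := by
    intro τ hτ
    have h1 : HasDerivAt (fun τ : ℝ => y + τ • v) v τ := by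
      simpa using ((hasDerivAt_id τ).smul_const v).const_add y
    exact (hd _ (hmem τ hτ)).1.comp_hasDerivAt τ h1
  have := (convex_Icc 0 σ).image_sub_le_mul_sub_of_deriv_le (f := fun τ : ℝ => h (y + τ • v))
    (C := -c) (fun τ hτ => (hder τ hτ).continuousAt.continuousWithinAt)
    (fun τ hτ => (hder τ (interior_subset hτ)).differentiableAt.differentiableWithinAt)
    (fun τ hτ => by
      rw [(hder τ (interior_subset hτ)).deriv]
      exact (hd _ (hmem τ (interior_subset hτ))).2)
    0 ⟨le_rfl, hσ⟩ σ ⟨hσ, le_rfl⟩ hσ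
  simp only [zero_smul, add_zero] at this
  linarith

/-- If the derivatives in a chart are negative in a fixed direction, then the functions can be
pushed down. -/
theorem localPush_of_hasFDerivAt {M T : Type*} [TopologicalSpace M] [T2Space M] {l : Filter T}
    {Φ : T → M → ℝ} {F : Type*} [NormedAddCommGroup F] [NormedSpace ℝ F] [ProperSpace F]
    (e : OpenPartialHomeomorph M F) {x₀ : M} (hx₀ : x₀ ∈ e.source) (v : F) {c : ℝ} (hc : 0 < c)
    (D : T → F → F →L[ℝ] ℝ)
    (h : ∀ᶠ p in l ×ˢ 𝓝 (e x₀),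
      HasFDerivAt (fun y => Φ p.1 (e.symm y)) (D p.1 p.2) p.2 ∧ D p.1 p.2 v ≤ -c) :
    LocalPush l Φ x₀ := by
  refine localPush_of_chart e hx₀ v hc ?_
  obtain ⟨L, hL, Q, hQ, hLQ⟩ := eventually_prod_iff.1 h
  obtain ⟨r, hr, hball⟩ := Metric.eventually_nhds_iff_ball.1 hQ
  have h₁ : ∀ᶠ q in 𝓝 (e x₀) ×ˢ 𝓝[≥] (0 : ℝ), q.1 ∈ Metric.ball (e x₀) r ∧ 0 ≤ q.2 ∧
      q.1 + q.2 • v ∈ Metric.ball (e x₀) r := by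
    refine Filter.Eventually.and ?_ (Filter.Eventually.and ?_ ?_)
    · exact tendsto_fst.eventually (Metric.ball_mem_nhds _ hr)
    · exact tendsto_snd.eventually self_mem_nhdsWithin
    · have hcont : Tendsto (fun q : F × ℝ => q.1 + q.2 • v) (𝓝 (e x₀) ×ˢ 𝓝[≥] (0 : ℝ))
          (𝓝 (e x₀ + (0 : ℝ) • v)) :=
        Tendsto.add tendsto_fst
          ((tendsto_snd.mono_right nhdsWithin_le_nhds).smul tendsto_const_nhds)
      rw [zero_smul, add_zero] at hcont
      exact hcont.eventually (Metric.ball_mem_nhds _ hr)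
  filter_upwards [Filter.prod_mem_prod hL h₁] with p hp
  exact le_sub_mul_of_hasFDerivAt (h := fun y => Φ p.1 (e.symm y))
    (h' := D p.1) (convex_ball _ _) (fun y hy => hLQ hp.1 (hball y hy)) hp.2.1
    hp.2.2.1 hp.2.2.2

section Family

variable {F : Type*} [NormedAddCommGroup F] [NormedSpace ℝ F]

/-- The part of `F × [0,1]` over an open set. -/
abbrev overUnitInterval (O : Set (F × ℝ)) : Set (F × ℝ) := O ∩ Set.univ ×ˢ Set.Icc (0 : ℝ) 1

theorem uniqueDiffOn_overUnitInterval {O : Set (F × ℝ)} (hO : IsOpen O) :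
    UniqueDiffOn ℝ (overUnitInterval O) := by
  rw [overUnitInterval, Set.inter_comm]
  exact (uniqueDiffOn_univ.prod uniqueDiffOn_Icc_zero_one).inter hO

/-- The partial derivative along `F` of a function on part of `F × [0,1]`. -/
noncomputable def spaceDeriv (O : Set (F × ℝ)) (g : F × ℝ → ℝ) (t : ℝ) (y : F) : F →L[ℝ] ℝ :=
  (fderivWithin ℝ g (overUnitInterval O) (y, t)).comp (ContinuousLinearMap.inl ℝ F ℝ)

variable {O : Set (F × ℝ)} (hO : IsOpen O) {g : F × ℝ → ℝ}

theorem hasFDerivAt_spaceDeriv (hO : IsOpen O) (hg : ContDiffOn ℝ 1 g (overUnitInterval O)) {y : F}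
    {t : ℝ} (h : (y, t) ∈ overUnitInterval O) :
    HasFDerivAt (fun y => g (y, t)) (spaceDeriv O g t y) y := by
  have h₁ := ((hg.differentiableOn one_ne_zero) _ h).hasFDerivWithinAt
  have h₂ : HasFDerivAt (fun y : F => (y, t)) (ContinuousLinearMap.inl ℝ F ℝ) y :=
    hasFDerivAt_prodMk_left y t
  have hV : {y : F | (y, t) ∈ O} ∈ 𝓝 y :=
    (Continuous.prodMk_left t).continuousAt.preimage_mem_nhds (hO.mem_nhds h.1)
  have h₃ := h₁.comp y (h₂.hasFDerivWithinAt (s := {y : F | (y, t) ∈ O}))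
    (fun y' hy' => (⟨hy', trivial, h.2.2⟩ : (y', t) ∈ overUnitInterval O))
  exact h₃.hasFDerivAt hV

theorem continuousOn_spaceDeriv (hO : IsOpen O) (hg : ContDiffOn ℝ 1 g (overUnitInterval O)) :
    ContinuousOn (fun z : F × ℝ => spaceDeriv O g z.2 z.1) (overUnitInterval O) :=
  (hg.continuousOn_fderivWithin (uniqueDiffOn_overUnitInterval hO) le_rfl).clm_comp
    continuousOn_const

theorem hasDerivWithinAt_time (hO : IsOpen O) (hg : ContDiffOn ℝ 1 g (overUnitInterval O)) {y : F}
    {t : ℝ} (h : (y, t) ∈ overUnitInterval O) :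
    HasDerivWithinAt (fun t => g (y, t)) (fderivWithin ℝ g (overUnitInterval O) (y, t) (0, 1))
      (Set.Icc 0 1) t := by
  have h₁ := ((hg.differentiableOn one_ne_zero) _ h).hasFDerivWithinAt
  have h₂ : HasDerivAt (fun t : ℝ => (y, t)) ((0 : F), (1 : ℝ)) t :=
    (hasDerivAt_const t y).prodMk (hasDerivAt_id t)
  have hV : {t : ℝ | (y, t) ∈ O} ∈ 𝓝 t :=
    (Continuous.prodMk_right y).continuousAt.preimage_mem_nhds (hO.mem_nhds h.1)
  have h₃ := h₁.comp_hasDerivWithinAt t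
    (h₂.hasDerivWithinAt (s := Set.Icc 0 1 ∩ {t : ℝ | (y, t) ∈ O}))
    fun t' ht' => ⟨ht'.2, trivial, ht'.1⟩
  exact (hasDerivWithinAt_inter hV).1 h₃

/-- Moving a function in time: Lipschitz dependence of the space derivative and strict decrease,
near a point at which the time derivative is negative. -/
theorem exists_time_estimates {t₀ : ℝ} {y₀ : F} (hO : IsOpen O)
    (hg : ContDiffOn ℝ 2 g (overUnitInterval O)) (h : (y₀, t₀) ∈ overUnitInterval O)
    (hneg : derivWithin (fun t => g (y₀, t)) (Set.Icc 0 1) t₀ < 0) :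
    ∃ R > 0, ∃ κ > 0, ∃ C > 0,
      (∀ t ∈ Set.Icc (0 : ℝ) 1, |t - t₀| < R → ∀ y ∈ Metric.ball y₀ R,
        (y, t) ∈ overUnitInterval O ∧ ‖spaceDeriv O g t y - spaceDeriv O g t₀ y‖ ≤ C * |t - t₀| ∧
        (t₀ ≤ t → g (y, t) - g (y, t₀) ≤ -κ * (t - t₀)) ∧
        (t ≤ t₀ → κ * (t₀ - t) ≤ g (y, t) - g (y, t₀))) := by
  have hg₁ : ContDiffOn ℝ 1 g (overUnitInterval O) := hg.of_le (by norm_num)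
  set s := overUnitInterval O with hs
  have hu : UniqueDiffOn ℝ s := uniqueDiffOn_overUnitInterval hO
  have hd1 : ContDiffOn ℝ 1 (fderivWithin ℝ g s) s := hg.fderivWithin hu (by norm_num)
  obtain ⟨r₀, hr₀, hball⟩ := Metric.isOpen_iff.1 hO _ h.1
  let B : Set (F × ℝ) := Metric.ball (y₀, t₀) r₀ ∩ Set.univ ×ˢ Set.Icc (0 : ℝ) 1
  have hB : B ⊆ s := Set.inter_subset_inter_left _ hball
  have hBc : Convex ℝ B := (convex_ball _ _).inter (convex_univ.prod (convex_Icc 0 1))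
  have hzB : (y₀, t₀) ∈ B := ⟨Metric.mem_ball_self hr₀, h.2⟩
  obtain ⟨K, V, hV, hKV⟩ := ((hd1 _ h).mono hB).exists_lipschitzOnWith hBc
  let c : ℝ := -derivWithin (fun t => g (y₀, t)) (Set.Icc 0 1) t₀
  have hc : 0 < c := neg_pos.2 hneg
  have ht₀ := h.2.2
  have hval : fderivWithin ℝ g s (y₀, t₀) (0, 1) = -c := by
    have := (hasDerivWithinAt_time hO hg₁ h).derivWithin (uniqueDiffOn_Icc_zero_one _ ht₀)
    rw [← this, neg_neg]
  have hcont : ContinuousWithinAt (fun z => fderivWithin ℝ g s z (0, 1)) B (y₀, t₀) :=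
    ((hd1.continuousOn _ h).clm_apply continuousWithinAt_const).mono hB
  have hlt : ∀ᶠ z in 𝓝[B] (y₀, t₀), fderivWithin ℝ g s z (0, 1) < -(c / 2) :=
    hcont.eventually_lt_const (by simp only [hval]; linarith)
  have hall := (inter_mem (inter_mem hV hlt) self_mem_nhdsWithin)
  obtain ⟨R, hR, hsub⟩ := Metric.mem_nhdsWithin_iff.1 hall
  have hRB : ∀ t ∈ Set.Icc (0 : ℝ) 1, |t - t₀| < min R r₀ → ∀ y ∈ Metric.ball y₀ (min R r₀),
      (y, t) ∈ (V ∩ {z | fderivWithin ℝ g s z (0, 1) < -(c / 2)}) ∩ B := by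
    intro t ht htR y hy
    refine hsub ⟨?_, ?_, trivial, ht⟩
    · rw [Metric.mem_ball, Prod.dist_eq, max_lt_iff]
      exact ⟨lt_of_lt_of_le hy (min_le_left _ _), lt_of_lt_of_le htR (min_le_left _ _)⟩
    · rw [Metric.mem_ball, Prod.dist_eq, max_lt_iff]
      exact ⟨lt_of_lt_of_le hy (min_le_right _ _), lt_of_lt_of_le htR (min_le_right _ _)⟩
  refine ⟨min R r₀, lt_min hR hr₀, c / 2, half_pos hc, K * ‖ContinuousLinearMap.inl ℝ F ℝ‖ + 1,
    by positivity, fun t ht htR y hy => ?_⟩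
  have hz := hRB t ht htR y hy
  have hz₀ := hRB t₀ ht₀ (by simpa using ⟨hR, hr₀⟩) y hy
  have hmono : ∀ t₁ ∈ Set.Icc (0 : ℝ) 1, ∀ t₂ ∈ Set.Icc (0 : ℝ) 1, |t₁ - t₀| < min R r₀ →
      |t₂ - t₀| < min R r₀ → t₁ ≤ t₂ → g (y, t₂) - g (y, t₁) ≤ -(c / 2) * (t₂ - t₁) := by
    intro t₁ h₁ t₂ h₂ h₁' h₂' h₁₂
    have hin : ∀ τ ∈ Set.Icc t₁ t₂, τ ∈ Set.Icc (0 : ℝ) 1 ∧ |τ - t₀| < min R r₀ := by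
      intro τ hτ
      refine ⟨⟨h₁.1.trans hτ.1, hτ.2.trans h₂.2⟩, ?_⟩
      rw [abs_lt] at h₁' h₂' ⊢
      exact ⟨by linarith [hτ.1], by linarith [hτ.2]⟩
    have hder : ∀ τ ∈ interior (Set.Icc t₁ t₂), HasDerivAt (fun t => g (y, t))
        (fderivWithin ℝ g s (y, τ) (0, 1)) τ := by
      intro τ hτ
      have hτ' := hin τ (interior_subset hτ)
      refine (hasDerivWithinAt_time hO hg₁ (hB (hRB τ hτ'.1 hτ'.2 y hy).2)).hasDerivAt ?_
      exact mem_of_superset (isOpen_interior.mem_nhds hτ)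
        (interior_subset.trans (Set.Icc_subset_Icc h₁.1 h₂.2))
    refine (convex_Icc t₁ t₂).image_sub_le_mul_sub_of_deriv_le (f := fun t => g (y, t))
      (fun τ hτ => ?_) (fun τ hτ => (hder τ hτ).differentiableAt.differentiableWithinAt)
      (fun τ hτ => ?_) t₁ ⟨le_rfl, h₁₂⟩ t₂ ⟨h₁₂, le_rfl⟩ h₁₂
    · have hτ' := hin τ hτ
      exact ((hasDerivWithinAt_time hO hg₁
        (hB (hRB τ hτ'.1 hτ'.2 y hy).2)).continuousWithinAt).mono (Set.Icc_subset_Icc h₁.1 h₂.2)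
    · have hτ' := hin τ (interior_subset hτ)
      rw [(hder τ hτ).deriv]
      exact (hRB τ hτ'.1 hτ'.2 y hy).1.2.le
  have hself : |t₀ - t₀| < min R r₀ := by simpa using ⟨hR, hr₀⟩
  refine ⟨hB hz.2, ?_, fun h' => ?_, fun h' => ?_⟩
  · have h₁ := hKV.norm_sub_le hz.1.1 hz₀.1.1
    have h₂ : ‖((y, t) : F × ℝ) - (y, t₀)‖ = |t - t₀| := by
      simp [Prod.norm_def]
    rw [h₂] at h₁
    calc ‖spaceDeriv O g t y - spaceDeriv O g t₀ y‖
        = ‖(fderivWithin ℝ g s (y, t) - fderivWithin ℝ g s (y, t₀)).comp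
            (ContinuousLinearMap.inl ℝ F ℝ)‖ := by
          rw [ContinuousLinearMap.sub_comp]; rfl
      _ ≤ ‖fderivWithin ℝ g s (y, t) - fderivWithin ℝ g s (y, t₀)‖ *
            ‖ContinuousLinearMap.inl ℝ F ℝ‖ := ContinuousLinearMap.opNorm_comp_le _ _
      _ ≤ K * |t - t₀| * ‖ContinuousLinearMap.inl ℝ F ℝ‖ := by gcongr
      _ ≤ (K * ‖ContinuousLinearMap.inl ℝ F ℝ‖ + 1) * |t - t₀| := by
          nlinarith [abs_nonneg (t - t₀)]
  · exact hmono t₀ ht₀ t ht hself htR h'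
  · have := hmono t ht t₀ ht₀ htR hself h'
    linarith

end Family

end ChartCalculus

/-! ### Adapted charts at non-degenerate critical points -/

section SplitForm

open Filter Topology

variable {k m : ℕ}

/-- The differential of `splitForm`. -/
noncomputable def splitFormDeriv (y : SplitSpace k m) : SplitSpace k m →L[ℝ] ℝ :=
  (2 : ℝ) • (innerSL ℝ y.2).comp (ContinuousLinearMap.snd ℝ _ _) -
    (2 : ℝ) • (innerSL ℝ y.1).comp (ContinuousLinearMap.fst ℝ _ _)

theorem splitFormDeriv_apply (y x : SplitSpace k m) :
    splitFormDeriv y x = 2 * inner ℝ y.2 x.2 - 2 * inner ℝ y.1 x.1 := by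
  simp [splitFormDeriv]

theorem continuous_splitFormDeriv : Continuous (splitFormDeriv (k := k) (m := m)) := by
  unfold splitFormDeriv
  have h₁ : Continuous fun y : SplitSpace k m => innerSL ℝ y.2 :=
    (innerSL ℝ (E := EuclideanSpace ℝ (Fin m))).continuous.comp continuous_snd
  have h₂ : Continuous fun y : SplitSpace k m => innerSL ℝ y.1 :=
    (innerSL ℝ (E := EuclideanSpace ℝ (Fin k))).continuous.comp continuous_fst
  have h₃ : Continuous fun y : SplitSpace k m => (innerSL ℝ y.2).comp (ContinuousLinearMap.snd ℝ
      (EuclideanSpace ℝ (Fin k)) (EuclideanSpace ℝ (Fin m))) := h₁.clm_comp continuous_const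
  have h₄ : Continuous fun y : SplitSpace k m => (innerSL ℝ y.1).comp (ContinuousLinearMap.fst ℝ
      (EuclideanSpace ℝ (Fin k)) (EuclideanSpace ℝ (Fin m))) := h₂.clm_comp continuous_const
  fun_prop

theorem hasFDerivAt_splitForm (y : SplitSpace k m) :
    HasFDerivAt splitForm (splitFormDeriv y) y := by
  have h₁ : HasFDerivAt (fun y : SplitSpace k m => ‖y.1‖ ^ 2) _ y :=
    (hasStrictFDerivAt_norm_sq y.1).hasFDerivAt.comp y hasFDerivAt_fst
  have h₂ : HasFDerivAt (fun y : SplitSpace k m => ‖y.2‖ ^ 2) _ y :=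
    (hasStrictFDerivAt_norm_sq y.2).hasFDerivAt.comp y hasFDerivAt_snd
  refine (h₂.sub h₁).congr_fderiv ?_
  ext x <;> simp [splitFormDeriv]

theorem two_mul_norm_le_norm_splitFormDeriv (y : SplitSpace k m) :
    2 * ‖y‖ ≤ ‖splitFormDeriv y‖ := by
  have key : ∀ x : SplitSpace k m, ‖x‖ = ‖y‖ → |splitFormDeriv y x| = 2 * ‖y‖ ^ 2 →
      2 * ‖y‖ ≤ ‖splitFormDeriv y‖ := by
    intro x hx h
    have h₁ := (splitFormDeriv y).le_opNorm x
    rw [Real.norm_eq_abs, h, hx] at h₁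
    rcases (norm_nonneg y).eq_or_lt with h0 | h0
    · rw [← h0, mul_zero]; exact norm_nonneg _
    · nlinarith
  rcases le_total ‖y.1‖ ‖y.2‖ with h | h
  · have hy : ‖y‖ = ‖y.2‖ := max_eq_right h
    refine key (0, y.2) (by simp [hy, Prod.norm_def]) ?_
    rw [splitFormDeriv_apply, hy]
    simp
  · have hy : ‖y‖ = ‖y.1‖ := max_eq_left h
    refine key (y.1, 0) (by simp [hy, Prod.norm_def]) ?_
    rw [splitFormDeriv_apply, hy]
    simp

/-- A function with prescribed non-degenerate second order behaviour at a critical point is close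
to `splitForm` in linear coordinates. -/
theorem exists_splitForm_approx {E : Type*} [NormedAddCommGroup E] [NormedSpace ℝ E] {ψ : E → ℝ}
    {ψ' : E → E →L[ℝ] ℝ} {B : E →L[ℝ] E →L[ℝ] ℝ} {y₀ : E} (L : SplitSpace k m ≃L[ℝ] E)
    (hψ : ∀ᶠ y in 𝓝 y₀, HasFDerivAt ψ (ψ' y) y) (h₀ : ψ' y₀ = 0) (hB : HasFDerivAt ψ' B y₀)
    (hsymm : ∀ x y, B x y = B y x) (hL : ∀ x, B (L x) (L x) = 2 * splitForm x) {η : ℝ}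
    (hη : 0 < η) :
    ∃ r > 0, ∀ w ∈ Metric.ball (0 : SplitSpace k m) r,
      HasFDerivAt (fun w => ψ (y₀ + L w)) ((ψ' (y₀ + L w)).comp L.toContinuousLinearMap) w ∧
      |ψ (y₀ + L w) - ψ y₀ - splitForm w| ≤ η * ‖w‖ ^ 2 ∧
      ‖(ψ' (y₀ + L w)).comp L.toContinuousLinearMap - splitFormDeriv w‖ ≤ η * ‖w‖ := by
  let Lc : SplitSpace k m →L[ℝ] E := L.toContinuousLinearMap
  have hpol : ∀ w, (B (L w)).comp Lc = splitFormDeriv w := by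
    intro w
    refine ContinuousLinearMap.ext fun x => ?_
    have h1 := hL (w + x)
    have e : splitForm (w + x) = splitForm w + splitForm x +
        (2 * inner ℝ w.2 x.2 - 2 * inner ℝ w.1 x.1) := by
      simp only [splitForm, Prod.fst_add, Prod.snd_add, norm_add_sq_real]
      ring
    rw [e] at h1
    simp only [map_add, add_apply, hL, hsymm (L x) (L w)] at h1
    rw [splitFormDeriv_apply, ContinuousLinearMap.comp_apply]
    change B (L w) (L x) = _
    linarith
  have hc : Continuous fun w : SplitSpace k m => y₀ + L w := by fun_prop
  have hc₀ : Tendsto (fun w : SplitSpace k m => y₀ + L w) (𝓝 0) (𝓝 y₀) := by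
    simpa using hc.tendsto 0
  let ε : ℝ := η / (‖Lc‖ * ‖Lc‖ + 1)
  have hε : 0 < ε := by positivity
  have hB' := (hB.isLittleO).def hε
  obtain ⟨r, hr, hball⟩ := Metric.eventually_nhds_iff_ball.1
    ((hc₀.eventually hB').and (hc₀.eventually hψ))
  have hder : ∀ w ∈ Metric.ball (0 : SplitSpace k m) r,
      HasFDerivAt (fun w => ψ (y₀ + L w)) ((ψ' (y₀ + L w)).comp Lc) w := by
    intro w hw
    have h1 : HasFDerivAt (fun w : SplitSpace k m => y₀ + L w) Lc w :=
      (L.hasFDerivAt).const_add y₀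
    exact (hball w hw).2.comp w h1
  have hclose : ∀ w ∈ Metric.ball (0 : SplitSpace k m) r,
      ‖(ψ' (y₀ + L w)).comp Lc - splitFormDeriv w‖ ≤ η * ‖w‖ := by
    intro w hw
    have h1 := (hball w hw).1
    rw [h₀, sub_zero, add_sub_cancel_left] at h1
    rw [← hpol, ← ContinuousLinearMap.sub_comp]
    have h2 : ‖L w‖ ≤ ‖Lc‖ * ‖w‖ := Lc.le_opNorm w
    calc ‖(ψ' (y₀ + L w) - B (L w)).comp Lc‖ ≤ ‖ψ' (y₀ + L w) - B (L w)‖ * ‖Lc‖ :=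
          ContinuousLinearMap.opNorm_comp_le _ _
      _ ≤ ε * (‖Lc‖ * ‖w‖) * ‖Lc‖ := by gcongr; exact h1.trans (by gcongr)
      _ = η * ‖w‖ * ((‖Lc‖ * ‖Lc‖) / (‖Lc‖ * ‖Lc‖ + 1)) := by simp only [ε]; ring
      _ ≤ η * ‖w‖ * 1 := by
          gcongr
          exact div_le_one_of_le₀ (by linarith) (by positivity)
      _ = η * ‖w‖ := mul_one _
  refine ⟨r, hr, fun w hw => ⟨hder w hw, ?_, hclose w hw⟩⟩
  have hsub : Metric.closedBall (0 : SplitSpace k m) ‖w‖ ⊆ Metric.ball 0 r :=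
    Metric.closedBall_subset_ball (by simpa using hw)
  have := (convex_closedBall (0 : SplitSpace k m) ‖w‖).norm_image_sub_le_of_norm_hasFDerivWithin_le
    (f := fun w => ψ (y₀ + L w) - splitForm w) (C := η * ‖w‖)
    (fun x hx => ((hder x (hsub hx)).sub (hasFDerivAt_splitForm x)).hasFDerivWithinAt)
    (fun x hx => (hclose x (hsub hx)).trans (by
      have : ‖x‖ ≤ ‖w‖ := by simpa using hx
      gcongr)) (x := 0) (y := w) (by simp) (by simp)
  have e0 : splitForm (0 : SplitSpace k m) = 0 := by simp [splitForm]
  rw [map_zero, add_zero, e0, sub_zero, sub_zero, Real.norm_eq_abs] at this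
  calc |ψ (y₀ + L w) - ψ y₀ - splitForm w| = |ψ (y₀ + L w) - splitForm w - ψ y₀| := by
        rw [sub_right_comm]
    _ ≤ η * ‖w‖ * ‖w‖ := this
    _ = η * ‖w‖ ^ 2 := by ring

end SplitForm

section ManifoldCalculus

open Filter Topology

variable {n : ℕ} {M : Type*} [TopologicalSpace M] [ChartedSpace (EuclideanSpace ℝ (Fin n)) M]

theorem contDiffOn_of_contMDiffOn_family {f : M × ℝ → ℝ} {r : ℕ∞ω}
    {e : OpenPartialHomeomorph M (EuclideanSpace ℝ (Fin n))}
    (he : e ∈ IsManifold.maximalAtlas (𝓡 n) r M) {U : Set (M × ℝ)}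
    (hf : ContMDiffOn ((𝓡 n).prod 𝓘(ℝ, ℝ)) 𝓘(ℝ, ℝ) r f (U ∩ familyDomain M)) :
    ContDiffOn ℝ r (fun z : EuclideanSpace ℝ (Fin n) × ℝ => f (e.symm z.1, z.2))
      (overUnitInterval {z | z.1 ∈ e.target ∧ (e.symm z.1, z.2) ∈ U}) := by
  rw [← contMDiffOn_iff_contDiffOn]
  have h₁ : ContMDiffOn 𝓘(ℝ, EuclideanSpace ℝ (Fin n) × ℝ) (𝓡 n) r
      (fun z : EuclideanSpace ℝ (Fin n) × ℝ => e.symm z.1)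
      (overUnitInterval {z | z.1 ∈ e.target ∧ (e.symm z.1, z.2) ∈ U}) :=
    (contMDiffOn_symm_of_mem_maximalAtlas he).comp contDiff_fst.contMDiff.contMDiffOn
      fun z hz => hz.1.1
  have h₂ : ContMDiffOn 𝓘(ℝ, EuclideanSpace ℝ (Fin n) × ℝ) 𝓘(ℝ, ℝ) r
      (fun z : EuclideanSpace ℝ (Fin n) × ℝ => z.2)
      (overUnitInterval {z | z.1 ∈ e.target ∧ (e.symm z.1, z.2) ∈ U}) :=
    contDiff_snd.contMDiff.contMDiffOn
  exact hf.comp (h₁.prodMk h₂) fun z hz => ⟨hz.1.2, trivial, hz.2.2⟩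

theorem isCriticalPt_iff_hasFDerivAt {g : M → ℝ} {x : M}
    {e : OpenPartialHomeomorph M (EuclideanSpace ℝ (Fin n))}
    (he : e ∈ IsManifold.maximalAtlas (𝓡 n) 1 M) (hx : x ∈ e.source) :
    IsCriticalPt n g x ↔
      HasFDerivAt (g ∘ e.symm) (0 : EuclideanSpace ℝ (Fin n) →L[ℝ] ℝ) (e x) := by
  have hy := e.map_source hx
  have h₁ : MDifferentiableAt (𝓡 n) (𝓡 n) e.symm (e x) :=
    ((contMDiffOn_symm_of_mem_maximalAtlas he).contMDiffAt
      (e.open_target.mem_nhds hy)).mdifferentiableAt one_ne_zero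
  have h₂ : MDifferentiableAt (𝓡 n) (𝓡 n) e x :=
    ((contMDiffOn_of_mem_maximalAtlas he).contMDiffAt
      (e.open_source.mem_nhds hx)).mdifferentiableAt one_ne_zero
  constructor
  · rintro ⟨hd, h0⟩
    have h₃ := hd.hasMFDerivAt
    rw [h0] at h₃
    have h₄ : HasMFDerivAt (𝓡 n) 𝓘(ℝ, ℝ) g (e.symm (e x)) 0 := by
      rw [e.left_inv hx]; exact h₃
    exact ((h₄.comp (e x) h₁.hasMFDerivAt).congr_mfderiv
      (ContinuousLinearMap.zero_comp _)).hasFDerivAt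
  · intro h
    have h₃ := (h.hasMFDerivAt.comp x h₂.hasMFDerivAt).congr_mfderiv (ContinuousLinearMap.zero_comp _)
    have h₄ : HasMFDerivAt (𝓡 n) 𝓘(ℝ, ℝ) g x 0 := by
      refine h₃.congr_of_eventuallyEq ?_
      filter_upwards [e.open_source.mem_nhds hx] with x' hx'
      simp [e.left_inv hx']
    exact ⟨h₄.mdifferentiableAt, h₄.mfderiv⟩

theorem isOpen_chart_preimage {F : Type*} [NormedAddCommGroup F]
    (e : OpenPartialHomeomorph M F) {U : Set (M × ℝ)} (hU : IsOpen U) :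
    IsOpen {z : F × ℝ | z.1 ∈ e.target ∧ (e.symm z.1, z.2) ∈ U} := by
  have h : ContinuousOn (fun z : F × ℝ => (e.symm z.1, z.2)) (e.target ×ˢ Set.univ) :=
    (e.continuousOn_symm.comp continuous_fst.continuousOn fun z hz => hz.1).prodMk
      continuous_snd.continuousOn
  have := h.isOpen_inter_preimage (e.open_target.prod isOpen_univ) hU
  convert this using 1
  ext z
  simp

variable (n) in
/-- A chart around a critical point `p` of `f_{t₀}` with value `a` in which `f_{t₀} - a` agrees
with `-|u|² + |v|²` up to second order, together with control of the dependence on the time. -/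
structure MorseChart (f : M × ℝ → ℝ) (a : ℝ) (p : M) (t₀ : ℝ) (k : ℕ) where
  /-- The coindex. -/
  m : ℕ
  /-- The chart. -/
  e : OpenPartialHomeomorph M (SplitSpace k m)
  mem_source : p ∈ e.source
  map_eq : e p = 0
  /-- The size of the chart. -/
  R : ℝ
  R_pos : 0 < R
  ball_subset : Metric.ball 0 R ⊆ e.target
  /-- The space derivative. -/
  D : ℝ → SplitSpace k m → SplitSpace k m →L[ℝ] ℝ
  hasFDerivAt : ∀ t ∈ Set.Icc (0 : ℝ) 1, |t - t₀| < R → ∀ y ∈ Metric.ball 0 R,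
    HasFDerivAt (fun y => f (e.symm y, t)) (D t y) y
  continuousOn_D : ∀ t ∈ Set.Icc (0 : ℝ) 1, |t - t₀| < R → ContinuousOn (D t) (Metric.ball 0 R)
  eq_zero : ∀ t ∈ Set.Icc (0 : ℝ) 1, |t - t₀| < R → ∀ y ∈ Metric.ball 0 R,
    IsCriticalPt n (slice f t) (e.symm y) → D t y = 0
  approx : ∀ η > 0, ∃ r > 0, r ≤ R ∧ ∀ y ∈ Metric.ball 0 r,
    |f (e.symm y, t₀) - a - splitForm y| ≤ η * ‖y‖ ^ 2 ∧ ‖D t₀ y - splitFormDeriv y‖ ≤ η * ‖y‖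
  /-- The speed of decrease in time. -/
  κ : ℝ
  κ_pos : 0 < κ
  /-- The Lipschitz constant of the space derivative in time. -/
  C : ℝ
  C_pos : 0 < C
  decr : ∀ t ∈ Set.Icc (0 : ℝ) 1, |t - t₀| < R → t₀ ≤ t → ∀ y ∈ Metric.ball 0 R,
    f (e.symm y, t) - f (e.symm y, t₀) ≤ -κ * (t - t₀)
  incr : ∀ t ∈ Set.Icc (0 : ℝ) 1, |t - t₀| < R → t ≤ t₀ → ∀ y ∈ Metric.ball 0 R,
    κ * (t₀ - t) ≤ f (e.symm y, t) - f (e.symm y, t₀)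
  lip : ∀ t ∈ Set.Icc (0 : ℝ) 1, |t - t₀| < R → ∀ y ∈ Metric.ball 0 R,
    ‖D t y - D t₀ y‖ ≤ C * |t - t₀|

theorem nonempty_morseChart {f : M × ℝ → ℝ} {a : ℝ} {q : M × ℝ} (hq : q ∈ critSet n f a) {k : ℕ}
    (hnd : IsNondegenerateCriticalPt n (slice f q.2) q.1 k)
    (hnear : ∃ U : Set (M × ℝ), IsOpen U ∧ q ∈ U ∧
      ContMDiffOn ((𝓡 n).prod 𝓘(ℝ, ℝ)) 𝓘(ℝ, ℝ) ∞ f (U ∩ familyDomain M) ∧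
      ∀ r ∈ U ∩ familyDomain M, timeDeriv f r < 0) :
    Nonempty (MorseChart n f a q.1 q.2 k) := by
  have two_le : (2 : ℕ∞ω) ≤ ∞ := WithTop.coe_le_coe.2 le_top
  obtain ⟨p, t₀⟩ := q
  obtain ⟨hcrit, ⟨U₂, hU₂, hpU₂, hsm⟩, e₀, he₀, hpe, hdet, hidx⟩ := hnd
  obtain ⟨U, hU, hqU, hfU, htime⟩ := hnear
  obtain ⟨⟨-, ht₀⟩, -, hfa⟩ := hq
  simp only at hcrit hU₂ hpU₂ hsm hpe hdet hidx ht₀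
  have he₁ : e₀ ∈ IsManifold.maximalAtlas (𝓡 n) 1 M :=
    IsManifold.maximalAtlas_subset_of_le (by simp) he₀
  set y₀ := e₀ p with hy₀
  have hy₀t : y₀ ∈ e₀.target := e₀.map_source hpe
  let ψ : EuclideanSpace ℝ (Fin n) → ℝ := slice f t₀ ∘ e₀.symm
  have hψ : ContDiffAt ℝ ∞ ψ y₀ := by
    rw [← contMDiffAt_iff_contDiffAt]
    refine ContMDiffAt.comp (I' := 𝓡 n) y₀ ?_ ((contMDiffOn_symm_of_mem_maximalAtlas he₀).contMDiffAt
      (e₀.open_target.mem_nhds hy₀t))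
    rw [e₀.left_inv hpe]
    exact hsm.contMDiffAt (hU₂.mem_nhds hpU₂)
  have hψ₂ : ContDiffAt ℝ 2 ψ y₀ := hψ.of_le two_le
  have hψd : ∀ᶠ y in 𝓝 y₀, HasFDerivAt ψ (fderiv ℝ ψ y) y := by
    filter_upwards [hψ₂.eventually (by simp)] with y hy
    exact (hy.differentiableAt two_ne_zero).hasFDerivAt
  have hB : HasFDerivAt (fderiv ℝ ψ) (fderiv ℝ (fderiv ℝ ψ) y₀) y₀ :=
    ((hψ₂.fderiv_right (m := 1) (by norm_num)).differentiableAt one_ne_zero).hasFDerivAt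
  have hsymm : ∀ x y, fderiv ℝ (fderiv ℝ ψ) y₀ x y = fderiv ℝ (fderiv ℝ ψ) y₀ y x :=
    hψ₂.isSymmSndFDerivAt (by simp)
  have hz : fderiv ℝ ψ y₀ = 0 := ((isCriticalPt_iff_hasFDerivAt he₁ hpe).1 hcrit).fderiv
  obtain ⟨m, L, hL⟩ := exists_splitForm_of_isMatrixIndex (fderiv ℝ (fderiv ℝ ψ) y₀) hsymm hdet hidx
  let h : EuclideanSpace ℝ (Fin n) ≃ₜ SplitSpace k m :=
    (Homeomorph.addRight (-y₀)).trans L.symm.toHomeomorph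
  let e : OpenPartialHomeomorph M (SplitSpace k m) := e₀.transHomeomorph h
  have hes : ∀ w, e.symm w = e₀.symm (y₀ + L w) := fun w => by
    simp [e, h, OpenPartialHomeomorph.transHomeomorph, Homeomorph.addRight_symm, add_comm]
  have hpe' : p ∈ e.source := hpe
  have hep : e p = 0 := by
    simp [e, h, OpenPartialHomeomorph.transHomeomorph, ← hy₀]
  have het : ∀ w, w ∈ e.target ↔ y₀ + L w ∈ e₀.target := fun w => by
    simp [e, h, OpenPartialHomeomorph.transHomeomorph, Homeomorph.addRight_symm, add_comm]
  let g : SplitSpace k m × ℝ → ℝ := fun z => f (e.symm z.1, z.2)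
  let O : Set (SplitSpace k m × ℝ) := {z | z.1 ∈ e.target ∧ (e.symm z.1, z.2) ∈ U}
  have hO : IsOpen O := isOpen_chart_preimage e hU
  have hg : ContDiffOn ℝ ∞ g (overUnitInterval O) := by
    have h₁ := contDiffOn_of_contMDiffOn_family he₀ hfU
    have h₂ : ContDiff ℝ ∞ fun z : SplitSpace k m × ℝ => (y₀ + L z.1, z.2) :=
      (contDiff_const.add (L.contDiff.comp contDiff_fst)).prodMk contDiff_snd
    refine (h₁.comp h₂.contDiffOn fun z hz => ?_).congr fun z hz => ?_
    · exact ⟨⟨(het _).1 hz.1.1, by rw [← hes]; exact hz.1.2⟩, trivial, hz.2.2⟩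
    · simp [g, hes]
  have hg₂ : ContDiffOn ℝ 2 g (overUnitInterval O) := hg.of_le two_le
  have hg₁ : ContDiffOn ℝ 1 g (overUnitInterval O) := hg.of_le (mod_cast (le_top : (1 : ℕ∞) ≤ ⊤))
  have hep' : e.symm 0 = p := by rw [← hep, e.left_inv hpe']
  have hzO : ((0 : SplitSpace k m), t₀) ∈ overUnitInterval O :=
    ⟨⟨hep ▸ e.map_source hpe', by simpa only [hep'] using hqU⟩, trivial, ht₀⟩
  have hneg : derivWithin (fun t => g (0, t)) (Set.Icc 0 1) t₀ < 0 := by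
    have := htime _ ⟨hqU, trivial, ht₀⟩
    simpa [timeDeriv, g, hep'] using this
  obtain ⟨R, hR, κ, hκ, C, hC, hest⟩ := exists_time_estimates hO hg₂ hzO hneg
  have hD : ∀ t ∈ Set.Icc (0 : ℝ) 1, |t - t₀| < R → ∀ y ∈ Metric.ball 0 R,
      HasFDerivAt (fun y => f (e.symm y, t)) (spaceDeriv O g t y) y :=
    fun t ht htR y hy => hasFDerivAt_spaceDeriv hO hg₁ (hest t ht htR y hy).1
  have h0R : |t₀ - t₀| < R := by simpa using hR
  refine ⟨⟨m, e, hpe', hep, R, hR, fun y hy => (hest t₀ ht₀ h0R y hy).1.1.1,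
    spaceDeriv O g, hD, fun t ht htR => ?_, fun t ht htR y hy hcr => ?_, fun η hη => ?_, κ, hκ, C,
    hC, fun t ht htR h y hy => (hest t ht htR y hy).2.2.1 h,
    fun t ht htR h y hy => (hest t ht htR y hy).2.2.2 h,
    fun t ht htR y hy => (hest t ht htR y hy).2.1⟩⟩
  · exact (continuousOn_spaceDeriv hO hg₁).comp (f := fun y => (y, t))
      (Continuous.prodMk_left t).continuousOn fun y hy => (hest t ht htR y hy).1
  · have hyt := (hest t ht htR y hy).1.1.1
    have hyt' := (het y).1 hyt
    rw [hes, isCriticalPt_iff_hasFDerivAt he₁ (e₀.map_target hyt'), e₀.right_inv hyt'] at hcr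
    have h₁ : HasFDerivAt (fun w : SplitSpace k m => y₀ + L w) L.toContinuousLinearMap y :=
      (L.hasFDerivAt).const_add y₀
    have h₂ := hcr.comp y h₁
    rw [ContinuousLinearMap.zero_comp] at h₂
    refine (hD t ht htR y hy).unique (h₂.congr_of_eventuallyEq (Eventually.of_forall fun w => ?_))
    simp [hes, slice]
  · obtain ⟨r, hr, happ⟩ := exists_splitForm_approx L hψd hz hB hsymm hL hη
    refine ⟨min r R, lt_min hr hR, min_le_right _ _, fun y hy => ?_⟩
    obtain ⟨a₁, a₂, a₃⟩ := happ y (Metric.ball_subset_ball (min_le_left _ _) hy)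
    have e₁ : ∀ w, f (e.symm w, t₀) = ψ (y₀ + L w) := fun w => by simp [hes, ψ, slice]
    have e₂ : ψ y₀ = a := by
      simp only [ψ, Function.comp, slice, hy₀, e₀.left_inv hpe]; exact hfa
    have e₃ := (hD t₀ ht₀ h0R y (Metric.ball_subset_ball (min_le_right _ _) hy)).unique
      (a₁.congr_of_eventuallyEq (Eventually.of_forall e₁))
    rw [e₁, e₃, ← e₂]
    exact ⟨a₂, a₃⟩

end ManifoldCalculus

/-! ### Regular points of the family, and finiteness of the critical set -/

section Regular

open Filter Topology

variable {n : ℕ} {M : Type*} [TopologicalSpace M] [ChartedSpace (EuclideanSpace ℝ (Fin n)) M]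
  {f : M × ℝ → ℝ}

theorem abs_splitForm_le {k m : ℕ} (y : SplitSpace k m) : |splitForm y| ≤ ‖y‖ ^ 2 := by
  have h₁ : ‖y.1‖ ≤ ‖y‖ := norm_fst_le y
  have h₂ : ‖y.2‖ ≤ ‖y‖ := norm_snd_le y
  have h₃ := norm_nonneg y.1
  have h₄ := norm_nonneg y.2
  rw [abs_le]
  constructor <;> simp only [splitForm] <;> nlinarith

theorem continuous_slice (hf : ContinuousOn f (familyDomain M)) {t : ℝ}
    (ht : t ∈ Set.Icc (0 : ℝ) 1) : Continuous (slice f t) := by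
  rw [← continuousOn_univ]
  exact hf.comp (f := fun x => (x, t)) (Continuous.prodMk_left t).continuousOn
    fun x _ => ⟨trivial, ht⟩

theorem eventually_slice_sub_lt [CompactSpace M] (hf : ContinuousOn f (familyDomain M)) {t₀ : ℝ}
    (ht₀ : t₀ ∈ Set.Icc (0 : ℝ) 1) {ε : ℝ} (hε : 0 < ε) :
    ∀ᶠ t in 𝓝[Set.Icc 0 1] t₀, ∀ x, |f (x, t) - f (x, t₀)| < ε := by
  have := isCompact_univ.eventually_forall_of_forall_eventually (x₀ := t₀)
    (P := fun t (x : M) => t ∈ Set.Icc (0 : ℝ) 1 → |f (x, t) - f (x, t₀)| < ε) fun x _ => by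
      have h₁ : ContinuousWithinAt (fun q : M × ℝ => |f q - f (q.1, t₀)|) (familyDomain M)
          (x, t₀) := by
        have h₂ : Continuous fun q : M × ℝ => f (q.1, t₀) :=
          (continuous_slice hf ht₀).comp continuous_fst
        exact ((hf _ ⟨trivial, ht₀⟩).sub h₂.continuousWithinAt).abs
      have h₂ := h₁.eventually_lt_const (show |f (x, t₀) - f (x, t₀)| < ε by simpa using hε)
      have h₃ := eventually_nhdsWithin_iff.1 h₂
      have h₄ : Tendsto (fun z : ℝ × M => (z.2, z.1)) (𝓝 (t₀, x)) (𝓝 (x, t₀)) :=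
        continuous_swap.tendsto _
      filter_upwards [h₄.eventually h₃] with z hz hzt
      exact hz ⟨trivial, hzt⟩
  filter_upwards [nhdsWithin_le_nhds this, self_mem_nhdsWithin] with t ht ht' x
  exact ht x trivial ht'

theorem MorseChart.eventually_eq {a : ℝ} {p : M} {t₀ : ℝ} {k : ℕ} (c : MorseChart n f a p t₀ k)
    (ht₀ : t₀ ∈ Set.Icc (0 : ℝ) 1) :
    ∀ᶠ q in 𝓝 (p, t₀), q ∈ critSet n f a → q = (p, t₀) := by
  obtain ⟨r, hr, hrR, happ⟩ := c.approx (1 / 4) (by norm_num)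
  obtain ⟨ρ, hρ, hρR, hρκ⟩ : ∃ ρ > 0, ρ ≤ r ∧ 5 / 4 * c.C ^ 2 * ρ ≤ c.κ := by
    refine ⟨min r (c.κ / (5 / 4 * c.C ^ 2)), lt_min hr ?_, min_le_left _ _, ?_⟩
    · have := c.κ_pos; have := c.C_pos; positivity
    · have := c.C_pos
      calc 5 / 4 * c.C ^ 2 * min r (c.κ / (5 / 4 * c.C ^ 2))
          ≤ 5 / 4 * c.C ^ 2 * (c.κ / (5 / 4 * c.C ^ 2)) := by gcongr; exact min_le_right _ _
        _ = c.κ := by field_simp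
  have h₁ : ∀ᶠ x in 𝓝 p, x ∈ c.e.source := c.e.open_source.mem_nhds c.mem_source
  have h₂ : ∀ᶠ x in 𝓝 p, c.e x ∈ Metric.ball 0 ρ :=
    (c.e.continuousAt c.mem_source).preimage_mem_nhds (by
      rw [c.map_eq]; exact Metric.ball_mem_nhds _ hρ)
  have h₃ : ∀ᶠ q : M × ℝ in 𝓝 (p, t₀), (q.1 ∈ c.e.source ∧ c.e q.1 ∈ Metric.ball 0 ρ) ∧
      q.2 ∈ Metric.ball t₀ ρ := by
    rw [nhds_prod_eq]
    exact (tendsto_fst.eventually (h₁.and h₂)).and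
      (tendsto_snd.eventually (Metric.ball_mem_nhds _ hρ))
  filter_upwards [h₃] with ⟨x, t⟩ ⟨⟨hxe, hxρ⟩, htρ⟩ ⟨⟨_, ht⟩, hcr, hfa⟩
  simp only at hxe hxρ htρ ht hcr hfa ⊢
  set y := c.e x with hy
  have hex : c.e.symm y = x := c.e.left_inv hxe
  have htρ' : |t - t₀| < ρ := htρ
  have htR : |t - t₀| < c.R := htρ'.trans_le (hρR.trans hrR)
  have hyr : y ∈ Metric.ball 0 r := Metric.ball_subset_ball hρR hxρ
  have hyR : y ∈ Metric.ball 0 c.R := Metric.ball_subset_ball hrR hyr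
  have hD := c.eq_zero t ht htR y hyR (by rwa [hex])
  have hlip := c.lip t ht htR y hyR
  rw [hD, zero_sub, norm_neg] at hlip
  obtain ⟨a₁, a₂⟩ := happ y hyr
  have hn : ‖splitFormDeriv y‖ ≤ c.C * |t - t₀| + 1 / 4 * ‖y‖ := by
    calc ‖splitFormDeriv y‖ = ‖c.D t₀ y - (c.D t₀ y - splitFormDeriv y)‖ := by
          rw [sub_sub_cancel]
      _ ≤ _ := (norm_sub_le _ _).trans (add_le_add hlip a₂)
  have hn' := two_mul_norm_le_norm_splitFormDeriv y
  have hy0 := norm_nonneg y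
  have hC := c.C_pos
  have hκ := c.κ_pos
  have hδ0 := abs_nonneg (t - t₀)
  have hyC : ‖y‖ ≤ c.C * |t - t₀| := by
    have : 0 ≤ c.C * |t - t₀| := by positivity
    linarith
  have hy2 : ‖y‖ ^ 2 ≤ c.C ^ 2 * |t - t₀| ^ 2 := by
    rw [← mul_pow]; gcongr
  have hs := abs_le.1 (abs_splitForm_le y)
  have a₁ := abs_le.1 a₁
  rw [hex] at a₁
  have key : t = t₀ := by
    by_contra hne
    have hpos : 0 < |t - t₀| := abs_pos.2 (sub_ne_zero.2 hne)
    have hfin : 5 / 4 * (c.C ^ 2 * |t - t₀| ^ 2) < c.κ * |t - t₀| := by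
      have h1 : 5 / 4 * c.C ^ 2 * |t - t₀| < c.κ := by
        refine lt_of_lt_of_le ?_ hρκ
        have : 0 < 5 / 4 * c.C ^ 2 := by positivity
        exact mul_lt_mul_of_pos_left htρ' this
      nlinarith
    rcases le_total t₀ t with h | h
    · have h1 := c.decr t ht htR h y hyR
      rw [hex, hfa] at h1
      rw [abs_of_nonneg (sub_nonneg.2 h)] at *
      linarith [hs.2, a₁.2]
    · have h1 := c.incr t ht htR h y hyR
      rw [hex, hfa] at h1
      rw [abs_sub_comm, abs_of_nonneg (sub_nonneg.2 h)] at *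
      linarith [hs.1, a₁.1]
  subst key
  rw [sub_self, abs_zero, mul_zero] at hyC
  have hy00 : y = 0 := norm_le_zero_iff.1 hyC
  rw [← hex, hy00, ← c.map_eq, c.e.left_inv c.mem_source]

theorem isCriticalPt_iff_of_hasFDerivAt {x₀ : M} {t : ℝ}
    {e : OpenPartialHomeomorph M (EuclideanSpace ℝ (Fin n))}
    (he : e ∈ IsManifold.maximalAtlas (𝓡 n) 1 M) (hx : x₀ ∈ e.source)
    {D : EuclideanSpace ℝ (Fin n) →L[ℝ] ℝ} (h : HasFDerivAt (fun y => f (e.symm y, t)) D (e x₀)) :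
    IsCriticalPt n (slice f t) x₀ ↔ D = 0 := by
  rw [isCriticalPt_iff_hasFDerivAt he hx]
  exact ⟨fun h' => h.unique h', fun h' => h' ▸ h⟩

variable [IsManifold (𝓡 n) ∞ M]

theorem chartAt_mem_maximalAtlas_one (x : M) :
    chartAt (EuclideanSpace ℝ (Fin n)) x ∈ IsManifold.maximalAtlas (𝓡 n) 1 M :=
  IsManifold.maximalAtlas_subset_of_le (n := ∞) (by simp) (IsManifold.chart_mem_maximalAtlas x)

/-- The space derivative of a `C¹` family in the preferred chart at `x₀` exists and is
continuous. -/
theorem exists_chart_deriv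
    (hf : ContMDiffOn ((𝓡 n).prod 𝓘(ℝ, ℝ)) 𝓘(ℝ, ℝ) 1 f (familyDomain M)) (x₀ : M) {t₀ : ℝ}
    (ht₀ : t₀ ∈ Set.Icc (0 : ℝ) 1) :
    ∃ D : ℝ → EuclideanSpace ℝ (Fin n) → EuclideanSpace ℝ (Fin n) →L[ℝ] ℝ,
      (∀ᶠ z in 𝓝 (chartAt (EuclideanSpace ℝ (Fin n)) x₀ x₀, t₀), z.2 ∈ Set.Icc (0 : ℝ) 1 →
        HasFDerivAt (fun y => f ((chartAt (EuclideanSpace ℝ (Fin n)) x₀).symm y, z.2))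
          (D z.2 z.1) z.1) ∧
      ContinuousWithinAt (fun z : EuclideanSpace ℝ (Fin n) × ℝ => D z.2 z.1)
        (Set.univ ×ˢ Set.Icc 0 1) (chartAt (EuclideanSpace ℝ (Fin n)) x₀ x₀, t₀) := by
  set e := chartAt (EuclideanSpace ℝ (Fin n)) x₀ with he
  let O : Set (EuclideanSpace ℝ (Fin n) × ℝ) :=
    {z | z.1 ∈ e.target ∧ (e.symm z.1, z.2) ∈ (Set.univ : Set (M × ℝ))}
  have hO : IsOpen O := isOpen_chart_preimage e isOpen_univ
  have hg := contDiffOn_of_contMDiffOn_family (chartAt_mem_maximalAtlas_one x₀)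
    (U := Set.univ) (by rwa [Set.univ_inter])
  have hz : (e x₀, t₀) ∈ overUnitInterval O :=
    ⟨⟨e.map_source (mem_chart_source _ x₀), trivial⟩, trivial, ht₀⟩
  refine ⟨spaceDeriv O fun z => f (e.symm z.1, z.2), ?_, ?_⟩
  · filter_upwards [hO.mem_nhds hz.1] with z hzO hzt
    exact hasFDerivAt_spaceDeriv hO hg ⟨hzO, trivial, hzt⟩
  · have := continuousOn_spaceDeriv hO hg _ hz
    refine this.mono_of_mem_nhdsWithin ?_
    exact inter_mem (mem_nhdsWithin_of_mem_nhds (hO.mem_nhds hz.1)) self_mem_nhdsWithin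

theorem exists_descent_direction
    (hf : ContMDiffOn ((𝓡 n).prod 𝓘(ℝ, ℝ)) 𝓘(ℝ, ℝ) 1 f (familyDomain M)) {x₀ : M} {t₀ : ℝ}
    (ht₀ : t₀ ∈ Set.Icc (0 : ℝ) 1) (hx₀ : ¬ IsCriticalPt n (slice f t₀) x₀) :
    ∃ v : EuclideanSpace ℝ (Fin n), ∃ c > 0,
      ∃ D : ℝ → EuclideanSpace ℝ (Fin n) → EuclideanSpace ℝ (Fin n) →L[ℝ] ℝ,
      ∀ᶠ z in 𝓝 (chartAt (EuclideanSpace ℝ (Fin n)) x₀ x₀, t₀), z.2 ∈ Set.Icc (0 : ℝ) 1 →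
        HasFDerivAt (fun y => f ((chartAt (EuclideanSpace ℝ (Fin n)) x₀).symm y, z.2))
          (D z.2 z.1) z.1 ∧ D z.2 z.1 v ≤ -c := by
  obtain ⟨D, hD, hDc⟩ := exists_chart_deriv hf x₀ ht₀
  set e := chartAt (EuclideanSpace ℝ (Fin n)) x₀ with he
  have h₀ : D t₀ (e x₀) ≠ 0 := fun h => hx₀ <|
    (isCriticalPt_iff_of_hasFDerivAt (chartAt_mem_maximalAtlas_one x₀) (mem_chart_source _ x₀)
      (hD.self_of_nhds ht₀)).2 h
  obtain ⟨w, hw⟩ : ∃ w, D t₀ (e x₀) w < 0 := by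
    obtain ⟨w, hw⟩ := DFunLike.ne_iff.1 h₀
    rcases lt_or_gt_of_ne hw with h | h
    · exact ⟨w, h⟩
    · exact ⟨-w, by rw [map_neg]; exact neg_neg_of_pos h⟩
  have hlt : ∀ᶠ z in 𝓝[Set.univ ×ˢ Set.Icc 0 1] (e x₀, t₀),
      D z.2 z.1 w < D t₀ (e x₀) w / 2 :=
    (hDc.clm_apply continuousWithinAt_const).eventually_lt_const (by
      change D t₀ (e x₀) w < _; linarith)
  refine ⟨w, -(D t₀ (e x₀) w / 2), by linarith, D, ?_⟩
  filter_upwards [hD, eventually_nhdsWithin_iff.1 hlt] with z h₁ h₂ hz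
  exact ⟨h₁ hz, by rw [neg_neg]; exact (h₂ ⟨trivial, hz⟩).le⟩

theorem localPush_slice [T2Space M]
    (hf : ContMDiffOn ((𝓡 n).prod 𝓘(ℝ, ℝ)) 𝓘(ℝ, ℝ) 1 f (familyDomain M)) {x₀ : M} {t₀ : ℝ}
    (ht₀ : t₀ ∈ Set.Icc (0 : ℝ) 1) (hx₀ : ¬ IsCriticalPt n (slice f t₀) x₀) :
    LocalPush (𝓝[Set.Icc 0 1] t₀) (fun t x => f (x, t)) x₀ := by
  obtain ⟨v, c, hc, D, hD⟩ := exists_descent_direction hf ht₀ hx₀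
  refine localPush_of_hasFDerivAt _ (mem_chart_source _ x₀) v hc D ?_
  have h₁ : Tendsto (fun p : ℝ × EuclideanSpace ℝ (Fin n) => (p.2, p.1))
      (𝓝[Set.Icc 0 1] t₀ ×ˢ 𝓝 (chartAt (EuclideanSpace ℝ (Fin n)) x₀ x₀))
      (𝓝 (chartAt (EuclideanSpace ℝ (Fin n)) x₀ x₀, t₀)) := by
    rw [nhds_prod_eq]
    exact tendsto_snd.prodMk (tendsto_fst.mono_right nhdsWithin_le_nhds)
  filter_upwards [h₁.eventually hD, tendsto_fst.eventually self_mem_nhdsWithin] with p h₂ h₃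
  exact h₂ h₃

theorem eventually_localPush_interpolation [T2Space M]
    (hf : ContMDiffOn ((𝓡 n).prod 𝓘(ℝ, ℝ)) 𝓘(ℝ, ℝ) 1 f (familyDomain M)) {x₀ : M} {t₀ : ℝ}
    (ht₀ : t₀ ∈ Set.Icc (0 : ℝ) 1) (hx₀ : ¬ IsCriticalPt n (slice f t₀) x₀) :
    ∀ᶠ q : ℝ × M in 𝓝 (t₀, x₀), q.1 ∈ Set.Icc (0 : ℝ) 1 → ∀ G : M → ℝ,
      G =ᶠ[𝓝 q.2] slice f t₀ → ∀ θ ∈ Set.Icc (0 : ℝ) 1, LocalPush (𝓝[Set.Icc 0 1] θ)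
        (fun θ x => (1 - θ) * f (x, q.1) + θ * G x) q.2 := by
  obtain ⟨v, c, hc, D, hD⟩ := exists_descent_direction hf ht₀ hx₀
  set e := chartAt (EuclideanSpace ℝ (Fin n)) x₀ with he
  obtain ⟨r, hr, hball⟩ := Metric.eventually_nhds_iff_ball.1 hD
  have hmem : ∀ y ∈ Metric.ball (e x₀) r, ∀ t ∈ Metric.ball t₀ r,
      (y, t) ∈ Metric.ball (e x₀, t₀) r := by
    intro y hy t ht
    rw [Metric.mem_ball, Prod.dist_eq]
    exact max_lt hy ht
  have hxs : x₀ ∈ e.source := mem_chart_source _ x₀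
  have h₁ : ∀ᶠ x in 𝓝 x₀, x ∈ e.source ∧ e x ∈ Metric.ball (e x₀) r :=
    (e.open_source.mem_nhds hxs |> fun h => (h : ∀ᶠ x in 𝓝 x₀, x ∈ e.source)).and
      ((e.continuousAt hxs).preimage_mem_nhds (Metric.ball_mem_nhds _ hr))
  have h₂ : ∀ᶠ q : ℝ × M in 𝓝 (t₀, x₀), q.1 ∈ Metric.ball t₀ r ∧ q.2 ∈ e.source ∧
      e q.2 ∈ Metric.ball (e x₀) r := by
    rw [nhds_prod_eq]
    exact (tendsto_fst.eventually (Metric.ball_mem_nhds _ hr)).and (tendsto_snd.eventually h₁)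
  filter_upwards [h₂] with ⟨t, x⟩ ⟨htr, hxe, hxr⟩ ht G hG θ hθ
  simp only at htr hxe hxr ht hG ⊢
  have hG' : ∀ᶠ y in 𝓝 (e x), (fun y => G (e.symm y)) =ᶠ[𝓝 y] fun y => f (e.symm y, t₀) := by
    have h₃ : Tendsto e.symm (𝓝 (e x)) (𝓝 x) := by
      have := e.continuousAt_symm (e.map_source hxe)
      rwa [ContinuousAt, e.left_inv hxe] at this
    exact (h₃.eventually hG).eventually_nhds
  refine localPush_of_hasFDerivAt e hxe v hc
    (fun θ y => (1 - θ) • D t y + θ • D t₀ y) ?_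
  have h₃ : ∀ᶠ p in 𝓝[Set.Icc 0 1] θ ×ˢ 𝓝 (e x), p.1 ∈ Set.Icc (0 : ℝ) 1 ∧
      p.2 ∈ Metric.ball (e x₀) r ∧
      (fun y => G (e.symm y)) =ᶠ[𝓝 p.2] fun y => f (e.symm y, t₀) :=
    (tendsto_fst.eventually self_mem_nhdsWithin).and
      ((tendsto_snd.eventually (Metric.isOpen_ball.mem_nhds hxr)).and (tendsto_snd.eventually hG'))
  filter_upwards [h₃] with ⟨τ, y⟩ ⟨hτ, hy, hGy⟩
  simp only at hτ hy hGy ⊢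
  obtain ⟨a₁, a₂⟩ := hball _ (hmem y hy t htr) ht
  obtain ⟨b₁, b₂⟩ := hball _ (hmem y hy t₀ (Metric.mem_ball_self hr)) ht₀
  refine ⟨(a₁.const_mul _).add ((b₁.congr_of_eventuallyEq hGy).const_mul _), ?_⟩
  simp only [add_apply, smul_apply, smul_eq_mul] at a₂ b₂ ⊢
  nlinarith [hτ.1, hτ.2]

theorem isClosed_critSet
    (hf : ContMDiffOn ((𝓡 n).prod 𝓘(ℝ, ℝ)) 𝓘(ℝ, ℝ) 1 f (familyDomain M)) (a : ℝ) :
    IsClosed (critSet n f a) := by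
  rw [← isOpen_compl_iff, isOpen_iff_eventually]
  rintro ⟨x₀, t₀⟩ hq
  have hdom : IsClosed (familyDomain M) := isClosed_univ.prod isClosed_Icc
  by_cases ht₀ : t₀ ∈ Set.Icc (0 : ℝ) 1
  swap
  · have : (x₀, t₀) ∈ (familyDomain M)ᶜ := fun h => ht₀ h.2
    filter_upwards [hdom.isOpen_compl.mem_nhds this] with q hq hq'
    exact hq hq'.1
  by_cases hfa : f (x₀, t₀) = a
  swap
  · have := (hf.continuousOn _ ⟨trivial, ht₀⟩).eventually_ne hfa
    filter_upwards [eventually_nhdsWithin_iff.1 this] with q hq hq'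
    exact hq hq'.1 hq'.2.2
  obtain ⟨D, hD, hDc⟩ := exists_chart_deriv hf x₀ ht₀
  set e := chartAt (EuclideanSpace ℝ (Fin n)) x₀ with he
  have hxs : x₀ ∈ e.source := mem_chart_source _ x₀
  have hne : D t₀ (e x₀) ≠ 0 := fun h => hq ⟨⟨trivial, ht₀⟩,
    (isCriticalPt_iff_of_hasFDerivAt (chartAt_mem_maximalAtlas_one x₀) hxs
      (hD.self_of_nhds ht₀)).2 h, hfa⟩
  have h₁ := eventually_nhdsWithin_iff.1 (hDc.eventually_ne hne)
  have h₂ : Tendsto (fun q : M × ℝ => (e q.1, q.2)) (𝓝 (x₀, t₀)) (𝓝 (e x₀, t₀)) := by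
    rw [nhds_prod_eq, nhds_prod_eq]
    exact ((e.continuousAt hxs).tendsto.comp tendsto_fst).prodMk tendsto_snd
  have h₃ : ∀ᶠ q : M × ℝ in 𝓝 (x₀, t₀), q.1 ∈ e.source := by
    rw [nhds_prod_eq]
    exact tendsto_fst.eventually (e.open_source.mem_nhds hxs)
  filter_upwards [h₂.eventually h₁, h₂.eventually hD, h₃] with q k₁ k₂ k₃ hq'
  exact k₁ ⟨trivial, hq'.1.2⟩ ((isCriticalPt_iff_of_hasFDerivAt
    (chartAt_mem_maximalAtlas_one x₀) k₃ (k₂ hq'.1.2)).1 hq'.2.1)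

theorem finite_critSet [CompactSpace M]
    (hf : ContMDiffOn ((𝓡 n).prod 𝓘(ℝ, ℝ)) 𝓘(ℝ, ℝ) 1 f (familyDomain M)) (a : ℝ) {ind : M × ℝ → ℕ}
    (hc : ∀ q ∈ critSet n f a, Nonempty (MorseChart n f a q.1 q.2 (ind q))) :
    (critSet n f a).Finite := by
  have hK : IsCompact (critSet n f a) :=
    (isCompact_univ.prod isCompact_Icc : IsCompact (familyDomain M)).of_isClosed_subset
      (isClosed_critSet hf a) fun q hq => hq.1
  have := hK.induction_on (p := fun S => (S ∩ critSet n f a).Finite) (by simp)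
    (fun S S' h h' => h'.subset (Set.inter_subset_inter_left _ h))
    (fun S S' h h' => by rw [Set.union_inter_distrib_right]; exact h.union h')
    (fun q hq => by
      obtain ⟨c⟩ := hc q hq
      refine ⟨_, mem_nhdsWithin_of_mem_nhds (c.eventually_eq hq.1.2), ?_⟩
      exact (Set.finite_singleton (q.1, q.2)).subset fun r hr => hr.1 hr.2)
  rwa [Set.inter_self] at this

end Regular

/-! ### The model of a critical point -/

section Model

open Filter Topology

/-- A bound for the derivative of the smooth transition function. -/
theorem exists_bound_deriv_smoothTransition :
    ∃ C : ℝ, 0 < C ∧ ∀ x, |deriv Real.smoothTransition x| ≤ C := by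
  have hc : Continuous (deriv Real.smoothTransition) :=
    (Real.smoothTransition.contDiff (n := 1)).continuous_deriv le_rfl
  obtain ⟨C, hC⟩ := isCompact_Icc.exists_bound_of_continuousOn (s := Set.Icc (0 : ℝ) 1)
    hc.continuousOn
  refine ⟨max C 1, by positivity, fun x => ?_⟩
  by_cases hx : x ∈ Set.Icc (0 : ℝ) 1
  · exact (hC x hx).trans (le_max_left _ _)
  · have : deriv Real.smoothTransition x = 0 := by
      rw [Set.mem_Icc, not_and_or, not_le, not_le] at hx
      rcases hx with hx | hx
      · refine IsLocalMin.deriv_eq_zero (Eventually.of_forall fun y => ?_)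
        rw [Real.smoothTransition.zero_of_nonpos hx.le]
        exact Real.smoothTransition.nonneg y
      · refine IsLocalMax.deriv_eq_zero (Eventually.of_forall fun y => ?_)
        rw [Real.smoothTransition.one_of_one_le hx.le]
        exact Real.smoothTransition.le_one y
    rw [this, abs_zero]
    positivity

/-- A fixed bound for the derivative of the smooth transition function. -/
noncomputable def transitionBound : ℝ := Classical.choose exists_bound_deriv_smoothTransition

theorem transitionBound_pos : 0 < transitionBound :=
  (Classical.choose_spec exists_bound_deriv_smoothTransition).1

theorem abs_deriv_smoothTransition_le (x : ℝ) : |deriv Real.smoothTransition x| ≤ transitionBound :=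
  (Classical.choose_spec exists_bound_deriv_smoothTransition).2 x

variable {k m : ℕ}

/-- The square of the Euclidean norm on `ℝᵏ × ℝᵐ`. -/
noncomputable def splitNormSq (y : SplitSpace k m) : ℝ := ‖y.1‖ ^ 2 + ‖y.2‖ ^ 2

theorem norm_sq_le_splitNormSq (y : SplitSpace k m) : ‖y‖ ^ 2 ≤ splitNormSq y := by
  unfold splitNormSq
  rcases le_total ‖y.1‖ ‖y.2‖ with h | h
  · rw [show ‖y‖ = ‖y.2‖ from max_eq_right h]; nlinarith [sq_nonneg ‖y.1‖]
  · rw [show ‖y‖ = ‖y.1‖ from max_eq_left h]; nlinarith [sq_nonneg ‖y.2‖]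

theorem splitNormSq_le (y : SplitSpace k m) : splitNormSq y ≤ 2 * ‖y‖ ^ 2 := by
  have h₁ : ‖y.1‖ ≤ ‖y‖ := norm_fst_le y
  have h₂ : ‖y.2‖ ≤ ‖y‖ := norm_snd_le y
  unfold splitNormSq
  nlinarith [norm_nonneg y.1, norm_nonneg y.2]

/-- A smooth cutoff function, `1` on the Euclidean ball of radius `r/√2` and `0` off the ball of
radius `r`. -/
noncomputable def splitBump (r : ℝ) (y : SplitSpace k m) : ℝ :=
  Real.smoothTransition (2 - 2 / r ^ 2 * splitNormSq y)

/-- The derivative of `splitBump`. -/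
noncomputable def splitBumpDeriv (r : ℝ) (y : SplitSpace k m) : SplitSpace k m →L[ℝ] ℝ :=
  (deriv Real.smoothTransition (2 - 2 / r ^ 2 * splitNormSq y) * -(2 / r ^ 2)) •
    ((2 : ℝ) • (innerSL ℝ y.1).comp (ContinuousLinearMap.fst ℝ _ _) +
      (2 : ℝ) • (innerSL ℝ y.2).comp (ContinuousLinearMap.snd ℝ _ _))

theorem continuous_splitNormSq : Continuous (splitNormSq (k := k) (m := m)) := by
  unfold splitNormSq
  fun_prop

theorem continuous_splitForm : Continuous (splitForm (k := k) (m := m)) := by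
  unfold splitForm
  fun_prop

theorem continuous_splitBump (r : ℝ) : Continuous (splitBump (k := k) (m := m) r) :=
  Real.smoothTransition.continuous.comp
    (continuous_const.sub (continuous_const.mul continuous_splitNormSq))

theorem continuous_splitBumpDeriv (r : ℝ) : Continuous (splitBumpDeriv (k := k) (m := m) r) := by
  unfold splitBumpDeriv
  have hc : Continuous (deriv Real.smoothTransition) :=
    (Real.smoothTransition.contDiff (n := 1)).continuous_deriv le_rfl
  have h₀ : Continuous fun y : SplitSpace k m => deriv Real.smoothTransition
      (2 - 2 / r ^ 2 * splitNormSq y) :=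
    hc.comp (continuous_const.sub (continuous_const.mul continuous_splitNormSq))
  have h₁ : Continuous fun y : SplitSpace k m => innerSL ℝ y.2 :=
    (innerSL ℝ (E := EuclideanSpace ℝ (Fin m))).continuous.comp continuous_snd
  have h₂ : Continuous fun y : SplitSpace k m => innerSL ℝ y.1 :=
    (innerSL ℝ (E := EuclideanSpace ℝ (Fin k))).continuous.comp continuous_fst
  have h₃ : Continuous fun y : SplitSpace k m => (innerSL ℝ y.2).comp (ContinuousLinearMap.snd ℝ
      (EuclideanSpace ℝ (Fin k)) (EuclideanSpace ℝ (Fin m))) := h₁.clm_comp continuous_const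
  have h₄ : Continuous fun y : SplitSpace k m => (innerSL ℝ y.1).comp (ContinuousLinearMap.fst ℝ
      (EuclideanSpace ℝ (Fin k)) (EuclideanSpace ℝ (Fin m))) := h₂.clm_comp continuous_const
  fun_prop

theorem hasFDerivAt_splitBump (r : ℝ) (y : SplitSpace k m) :
    HasFDerivAt (splitBump r) (splitBumpDeriv r y) y := by
  have h₁ : HasFDerivAt (fun y : SplitSpace k m => ‖y.1‖ ^ 2) _ y :=
    (hasStrictFDerivAt_norm_sq y.1).hasFDerivAt.comp y hasFDerivAt_fst
  have h₂ : HasFDerivAt (fun y : SplitSpace k m => ‖y.2‖ ^ 2) _ y :=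
    (hasStrictFDerivAt_norm_sq y.2).hasFDerivAt.comp y hasFDerivAt_snd
  have h₃ := ((h₁.add h₂).const_mul (2 / r ^ 2)).const_sub 2
  have h₄ : HasDerivAt Real.smoothTransition
      (deriv Real.smoothTransition (2 - 2 / r ^ 2 * splitNormSq y))
      (2 - 2 / r ^ 2 * splitNormSq y) :=
    ((Real.smoothTransition.contDiff (n := 1)).differentiable one_ne_zero _).hasDerivAt
  refine (h₄.comp_hasFDerivAt y h₃).congr_fderiv ?_
  ext x <;> simp [splitBumpDeriv] <;> ring

theorem splitBump_nonneg (r : ℝ) (y : SplitSpace k m) : 0 ≤ splitBump r y :=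
  Real.smoothTransition.nonneg _

theorem splitBump_le_one (r : ℝ) (y : SplitSpace k m) : splitBump r y ≤ 1 :=
  Real.smoothTransition.le_one _

variable {r : ℝ}

theorem one_le_of_splitNormSq_le (hr : 0 < r) {y : SplitSpace k m}
    (hy : splitNormSq y ≤ r ^ 2 / 2) : 1 ≤ 2 - 2 / r ^ 2 * splitNormSq y := by
  have : 2 / r ^ 2 * splitNormSq y ≤ 2 / r ^ 2 * (r ^ 2 / 2) := by gcongr
  have h : 2 / r ^ 2 * (r ^ 2 / 2) = 1 := by field_simp
  linarith

theorem splitBump_eq_one (hr : 0 < r) {y : SplitSpace k m} (hy : splitNormSq y ≤ r ^ 2 / 2) :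
    splitBump r y = 1 :=
  Real.smoothTransition.one_of_one_le (one_le_of_splitNormSq_le hr hy)

theorem splitBumpDeriv_eq_zero (hr : 0 < r) {y : SplitSpace k m} (hy : splitNormSq y ≤ r ^ 2 / 2) :
    splitBumpDeriv r y = 0 := by
  have : deriv Real.smoothTransition (2 - 2 / r ^ 2 * splitNormSq y) = 0 := by
    refine IsLocalMax.deriv_eq_zero (Eventually.of_forall fun z => ?_)
    rw [Real.smoothTransition.one_of_one_le (one_le_of_splitNormSq_le hr hy)]
    exact Real.smoothTransition.le_one z
  rw [splitBumpDeriv, this, zero_mul, zero_smul]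

theorem nonpos_of_le_splitNormSq (hr : 0 < r) {y : SplitSpace k m}
    (hy : r ^ 2 ≤ splitNormSq y) : 2 - 2 / r ^ 2 * splitNormSq y ≤ 0 := by
  have : 2 / r ^ 2 * r ^ 2 ≤ 2 / r ^ 2 * splitNormSq y := by gcongr
  have h : 2 / r ^ 2 * r ^ 2 = 2 := by field_simp
  linarith

theorem splitBump_eq_zero (hr : 0 < r) {y : SplitSpace k m} (hy : r ≤ ‖y‖) :
    splitBump r y = 0 :=
  Real.smoothTransition.zero_of_nonpos (nonpos_of_le_splitNormSq hr
    ((pow_le_pow_left₀ hr.le hy 2).trans (norm_sq_le_splitNormSq y)))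

theorem norm_splitBumpDeriv_le (hr : 0 < r) (y : SplitSpace k m) :
    ‖splitBumpDeriv r y‖ ≤ 8 * transitionBound / r ^ 2 * ‖y‖ := by
  have hT := transitionBound_pos
  refine ContinuousLinearMap.opNorm_le_bound _ (by positivity) fun x => ?_
  have h₁ : |inner ℝ y.1 x.1| ≤ ‖y‖ * ‖x‖ := (abs_real_inner_le_norm _ _).trans
    (mul_le_mul (norm_fst_le y) (norm_fst_le x) (norm_nonneg _) (norm_nonneg _))
  have h₂ : |inner ℝ y.2 x.2| ≤ ‖y‖ * ‖x‖ := (abs_real_inner_le_norm _ _).trans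
    (mul_le_mul (norm_snd_le y) (norm_snd_le x) (norm_nonneg _) (norm_nonneg _))
  have h₃ : |2 * inner ℝ y.1 x.1 + 2 * inner ℝ y.2 x.2| ≤ 4 * (‖y‖ * ‖x‖) := by
    rw [abs_le] at *
    constructor <;> linarith [h₁.1, h₁.2, h₂.1, h₂.2]
  have h₄ : splitBumpDeriv r y x = (deriv Real.smoothTransition (2 - 2 / r ^ 2 * splitNormSq y) *
      -(2 / r ^ 2)) * (2 * inner ℝ y.1 x.1 + 2 * inner ℝ y.2 x.2) := by
    simp [splitBumpDeriv]
    ring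
  rw [h₄, Real.norm_eq_abs, abs_mul, abs_mul, abs_neg, abs_of_pos (show 0 < 2 / r ^ 2 by positivity)]
  calc _ ≤ transitionBound * (2 / r ^ 2) * (4 * (‖y‖ * ‖x‖)) := by
        gcongr
        exact abs_deriv_smoothTransition_le _
    _ = _ := by ring

theorem splitBumpDeriv_eq_zero_of_le (hr : 0 < r) {y : SplitSpace k m} (hy : r ≤ ‖y‖) :
    splitBumpDeriv r y = 0 := by
  have : deriv Real.smoothTransition (2 - 2 / r ^ 2 * splitNormSq y) = 0 := by
    refine IsLocalMin.deriv_eq_zero (Eventually.of_forall fun z => ?_)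
    rw [Real.smoothTransition.zero_of_nonpos (nonpos_of_le_splitNormSq hr
      ((pow_le_pow_left₀ hr.le hy 2).trans (norm_sq_le_splitNormSq y)))]
    exact Real.smoothTransition.nonneg z
  rw [splitBumpDeriv, this, zero_mul, zero_smul]

/-- The function `F` modified to be `splitForm + ε` near the origin. -/
noncomputable def splitModel (r ε : ℝ) (F : SplitSpace k m → ℝ) (y : SplitSpace k m) : ℝ :=
  F y + splitBump r y * (splitForm y + ε - F y)

/-- The derivative of `splitModel`. -/
noncomputable def splitModelDeriv (r ε : ℝ) (F : SplitSpace k m → ℝ)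
    (D : SplitSpace k m → SplitSpace k m →L[ℝ] ℝ) (y : SplitSpace k m) : SplitSpace k m →L[ℝ] ℝ :=
  D y + (splitBump r y • (splitFormDeriv y - D y) +
    (splitForm y + ε - F y) • splitBumpDeriv r y)

variable {ε η : ℝ} {F : SplitSpace k m → ℝ} {D : SplitSpace k m → SplitSpace k m →L[ℝ] ℝ}
  {y : SplitSpace k m}

theorem hasFDerivAt_splitModel (hF : HasFDerivAt F (D y) y) :
    HasFDerivAt (splitModel r ε F) (splitModelDeriv r ε F D y) y :=
  hF.add ((hasFDerivAt_splitBump r y).mul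
    (((hasFDerivAt_splitForm y).add_const ε).sub hF))

theorem continuousOn_splitModelDeriv {s : Set (SplitSpace k m)} (hF : ContinuousOn F s)
    (hD : ContinuousOn D s) : ContinuousOn (splitModelDeriv r ε F D) s := by
  have h₁ := (continuous_splitBump (k := k) (m := m) r).continuousOn (s := s)
  have h₂ := (continuous_splitBumpDeriv (k := k) (m := m) r).continuousOn (s := s)
  have h₃ := (continuous_splitForm (k := k) (m := m)).continuousOn (s := s)
  have h₄ := (continuous_splitFormDeriv (k := k) (m := m)).continuousOn (s := s)
  exact hD.add ((h₁.smul (h₄.sub hD)).add (((h₃.add continuousOn_const).sub hF).smul h₂))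

theorem splitModel_eq_of_le (hr : 0 < r) (hy : splitNormSq y ≤ r ^ 2 / 2) :
    splitModel r ε F y = splitForm y + ε := by
  rw [splitModel, splitBump_eq_one hr hy]; ring

theorem splitModelDeriv_eq_of_le (hr : 0 < r) (hy : splitNormSq y ≤ r ^ 2 / 2) :
    splitModelDeriv r ε F D y = splitFormDeriv y := by
  rw [splitModelDeriv, splitBump_eq_one hr hy, splitBumpDeriv_eq_zero hr hy, one_smul, smul_zero,
    add_zero, add_sub_cancel]

theorem le_splitModel (h : |F y - splitForm y| ≤ 1 / 4 * ‖y‖ ^ 2) :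
    splitForm y - 1 / 4 * ‖y‖ ^ 2 + splitBump r y * ε ≤ splitModel r ε F y := by
  have h₁ := abs_le.1 h
  have h₂ := splitBump_nonneg r y
  have h₃ := splitBump_le_one r y
  unfold splitModel
  nlinarith [sq_nonneg ‖y‖]

theorem splitModel_le (hε : ε ≤ r ^ 2 / 16)
    (hy : r ^ 2 / 2 ≤ splitNormSq y) (h : |F y - splitForm y| ≤ 1 / 16 * ‖y‖ ^ 2) :
    splitModel r ε F y ≤ splitForm y + 5 / 16 * ‖y‖ ^ 2 := by
  have h₁ := abs_le.1 h
  have h₂ := splitBump_nonneg r y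
  have h₃ := splitBump_le_one r y
  have h₄ := splitNormSq_le y
  have h₅ : ε ≤ 1 / 4 * ‖y‖ ^ 2 := by linarith
  unfold splitModel
  nlinarith [sq_nonneg ‖y‖]

theorem norm_splitModelDeriv_sub_le (hr : 0 < r) (hη : η ≤ 1 / 16)
    (hη' : 8 * transitionBound * η ≤ 1 / 16) (hε₀ : 0 ≤ ε)
    (hε' : 8 * transitionBound * ε ≤ r ^ 2 / 16) (hη₀ : 0 ≤ η)
    (h : |F y - splitForm y| ≤ η * ‖y‖ ^ 2) (h' : ‖D y - splitFormDeriv y‖ ≤ η * ‖y‖) :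
    ‖splitModelDeriv r ε F D y - splitFormDeriv y‖ ≤ 1 / 4 * ‖y‖ := by
  have h₂ := splitBump_nonneg r y
  have h₃ := splitBump_le_one r y
  have hy0 := norm_nonneg y
  have hT := transitionBound_pos
  have e : splitModelDeriv r ε F D y - splitFormDeriv y =
      (1 - splitBump r y) • (D y - splitFormDeriv y) +
        (splitForm y + ε - F y) • splitBumpDeriv r y := by
    unfold splitModelDeriv
    module
  have h₄ : ‖(1 - splitBump r y) • (D y - splitFormDeriv y)‖ ≤ 1 / 16 * ‖y‖ := by
    rw [norm_smul, Real.norm_of_nonneg (by linarith)]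
    calc _ ≤ 1 * (η * ‖y‖) := by gcongr; linarith
      _ ≤ 1 / 16 * ‖y‖ := by rw [one_mul]; gcongr
  have h₅ : ‖(splitForm y + ε - F y) • splitBumpDeriv r y‖ ≤ 1 / 8 * ‖y‖ := by
    rcases le_total r ‖y‖ with hry | hry
    · rw [splitBumpDeriv_eq_zero_of_le hr hry, smul_zero, norm_zero]; positivity
    · have h₆ : |splitForm y + ε - F y| ≤ η * r ^ 2 + ε := by
        have h₇ := abs_le.1 h
        have h₈ : η * ‖y‖ ^ 2 ≤ η * r ^ 2 := by gcongr
        rw [abs_le]; constructor <;> linarith [h₇.1, h₇.2]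
      rw [norm_smul, Real.norm_eq_abs]
      calc _ ≤ (η * r ^ 2 + ε) * (8 * transitionBound / r ^ 2 * ‖y‖) := by
            gcongr
            exact norm_splitBumpDeriv_le hr y
        _ = (8 * transitionBound * η + 8 * transitionBound * ε / r ^ 2) * ‖y‖ := by
            field_simp
        _ ≤ (1 / 16 + 1 / 16) * ‖y‖ := by
            have h₇ : 8 * transitionBound * ε / r ^ 2 ≤ 1 / 16 := by
              rw [div_le_iff₀ (by positivity)]
              linarith
            exact mul_le_mul_of_nonneg_right (add_le_add hη' h₇) hy0
        _ = 1 / 8 * ‖y‖ := by ring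
  rw [e]
  refine (norm_add_le _ _).trans ?_
  linarith

theorem splitFormDeriv_inr (y : SplitSpace k m) : splitFormDeriv y (0, y.2) = 2 * ‖y.2‖ ^ 2 := by
  rw [splitFormDeriv_apply]
  simp

/-- The radial derivative in the positive directions is bounded below. -/
theorem le_apply_inr_of_norm_sub_le {A : SplitSpace k m →L[ℝ] ℝ} {b : ℝ}
    (h : ‖A - splitFormDeriv y‖ ≤ b) : 2 * ‖y.2‖ ^ 2 - b * ‖y.2‖ ≤ A (0, y.2) := by
  have h₁ := (A - splitFormDeriv y).le_opNorm (0, y.2)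
  have h₂ : ‖((0, y.2) : SplitSpace k m)‖ = ‖y.2‖ := by simp [Prod.norm_def]
  rw [h₂, sub_apply, splitFormDeriv_inr, Real.norm_eq_abs] at h₁
  have h₃ : ‖A - splitFormDeriv y‖ * ‖y.2‖ ≤ b * ‖y.2‖ := by gcongr
  linarith [(abs_le.1 h₁).1]

theorem splitModelDeriv_inr_nonneg (hr : 0 < r) (hη : η ≤ 1 / 16)
    (hη' : 8 * transitionBound * η ≤ 1 / 16) (hε₀ : 0 ≤ ε) (hε : ε ≤ r ^ 2 / 16)
    (hε' : 8 * transitionBound * ε ≤ r ^ 2 / 16) (hη₀ : 0 ≤ η)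
    (h : |F y - splitForm y| ≤ η * ‖y‖ ^ 2) (h' : ‖D y - splitFormDeriv y‖ ≤ η * ‖y‖)
    (hpos : 0 < splitModel r ε F y) : 0 ≤ splitModelDeriv r ε F D y (0, y.2) := by
  rcases le_total (splitNormSq y) (r ^ 2 / 2) with hy | hy
  · rw [splitModelDeriv_eq_of_le hr hy, splitFormDeriv_inr]
    positivity
  · have h₁ := splitModel_le (F := F) hε hy (h.trans (by gcongr))
    have h₂ := le_apply_inr_of_norm_sub_le
      (norm_splitModelDeriv_sub_le hr hη hη' hε₀ hε' hη₀ h h')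
    have h₃ := norm_sq_le_splitNormSq y
    have h₄ : ‖y‖ ≤ 2 * ‖y.2‖ := by
      refine abs_le_of_sq_le_sq' ?_ (by positivity) |>.2
      simp only [splitForm, splitNormSq] at h₁ h₃
      nlinarith [sq_nonneg ‖y.2‖]
    nlinarith [norm_nonneg y.2]

theorem deriv_inr_nonneg_of_le {F₀ Ft : SplitSpace k m → ℝ}
    {D₀ Dt : SplitSpace k m → SplitSpace k m →L[ℝ] ℝ} {δ κ C : ℝ} (hδ : 0 ≤ δ)
    (hκ : 2 * C ^ 2 * δ ≤ κ) (h : |F₀ y - splitForm y| ≤ 1 / 4 * ‖y‖ ^ 2)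
    (h' : ‖D₀ y - splitFormDeriv y‖ ≤ 1 / 4 * ‖y‖) (ht : Ft y - F₀ y ≤ -κ * δ)
    (hD : ‖Dt y - D₀ y‖ ≤ C * δ) (hpos : 0 < Ft y) : 0 ≤ Dt y (0, y.2) := by
  have h₀ : ‖Dt y - splitFormDeriv y‖ ≤ C * δ + 1 / 4 * ‖y‖ := by
    calc _ = ‖(Dt y - D₀ y) + (D₀ y - splitFormDeriv y)‖ := by rw [sub_add_sub_cancel]
      _ ≤ _ := (norm_add_le _ _).trans (add_le_add hD h')
  have h₂ := le_apply_inr_of_norm_sub_le h₀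
  have h₃ := norm_sq_le_splitNormSq y
  have h₁ := (abs_le.1 h).2
  simp only [splitForm, splitNormSq] at h₁ h₃
  have hκδ : 2 * (C * δ) ^ 2 ≤ κ * δ := by nlinarith
  have h₄ : ‖y‖ ≤ 2 * ‖y.2‖ := by
    refine abs_le_of_sq_le_sq' ?_ (by positivity) |>.2
    nlinarith [sq_nonneg ‖y.2‖, sq_nonneg (C * δ)]
  have h₅ : C * δ ≤ ‖y.2‖ := by
    refine abs_le_of_sq_le_sq' ?_ (by positivity) |>.2
    nlinarith [sq_nonneg ‖y.2‖, sq_nonneg ‖y‖]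
  nlinarith [norm_nonneg y.2]

/-- A function which increases in the positive directions wherever it is positive: its
nonpositivity set is preserved by contracting the positive directions. -/
theorem nonpos_of_contraction {ρ : ℝ} (hF : ∀ y ∈ Metric.ball (0 : SplitSpace k m) ρ,
      HasFDerivAt F (D y) y ∧ (0 < F y → 0 ≤ D y (0, y.2)))
    (hy : y ∈ Metric.ball (0 : SplitSpace k m) ρ) (hFy : F y ≤ 0) {τ : ℝ}
    (hτ : τ ∈ Set.Icc (0 : ℝ) 1) : F (y.1, τ • y.2) ≤ 0 := by
  by_contra! hpos
  have hball : ∀ σ ∈ Set.Icc (0 : ℝ) 1, (y.1, σ • y.2) ∈ Metric.ball (0 : SplitSpace k m) ρ := by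
    intro σ hσ
    rw [mem_ball_zero_iff] at hy ⊢
    refine lt_of_le_of_lt ?_ hy
    refine max_le_max le_rfl ?_
    rw [norm_smul, Real.norm_of_nonneg hσ.1]
    exact mul_le_of_le_one_left (norm_nonneg _) hσ.2
  let h : ℝ → ℝ := fun σ => F (y.1, σ • y.2)
  have hd : ∀ σ ∈ Set.Icc (0 : ℝ) 1, HasDerivAt h (D (y.1, σ • y.2) (0, y.2)) σ := by
    intro σ hσ
    have h1 : HasDerivAt (fun σ : ℝ => (y.1, σ • y.2)) ((0 : EuclideanSpace ℝ (Fin k)), y.2) σ := by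
      have := (hasDerivAt_const σ y.1).prodMk ((hasDerivAt_id σ).smul_const y.2)
      simpa using this
    exact (hF _ (hball σ hσ)).1.comp_hasDerivAt σ h1
  have hcont : ContinuousOn h (Set.Icc 0 1) := fun σ hσ =>
    (hd σ hσ).continuousAt.continuousWithinAt
  have h1 : h 1 ≤ 0 := by simpa [h] using hFy
  let Z : Set ℝ := Set.Icc τ 1 ∩ h ⁻¹' Set.Iic 0
  have hZne : Z.Nonempty := ⟨1, ⟨hτ.2, le_rfl⟩, h1⟩
  have hZc : IsClosed Z :=
    (hcont.mono (Set.Icc_subset_Icc_left hτ.1)).preimage_isClosed_of_isClosed isClosed_Icc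
      isClosed_Iic
  have hZb : BddBelow Z := ⟨τ, fun x hx => hx.1.1⟩
  have hμ := hZc.csInf_mem hZne hZb
  set μ := sInf Z
  have hlt : ∀ σ ∈ Set.Ico τ μ, 0 < h σ := by
    intro σ hσ
    by_contra! hle
    exact absurd (csInf_le hZb ⟨⟨hσ.1, hσ.2.le.trans hμ.1.2⟩, hle⟩) (not_le.2 hσ.2)
  have hmono : MonotoneOn h (Set.Icc τ μ) := by
    have hsub : Set.Icc τ μ ⊆ Set.Icc 0 1 := Set.Icc_subset_Icc hτ.1 hμ.1.2
    refine monotoneOn_of_deriv_nonneg (convex_Icc _ _) (hcont.mono hsub)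
      (fun σ hσ => (hd σ (hsub (interior_subset hσ))).differentiableAt.differentiableWithinAt)
      fun σ hσ => ?_
    rw [(hd σ (hsub (interior_subset hσ))).deriv]
    rw [interior_Icc] at hσ
    have hσ' := hsub (Set.Ioo_subset_Icc_self hσ)
    have hσ0 : 0 < σ := lt_of_le_of_lt hτ.1 hσ.1
    have h2 := (hF _ (hball σ hσ')).2 (hlt σ ⟨hσ.1.le, hσ.2⟩)
    have h3 : ((0, σ • y.2) : SplitSpace k m) = σ • (0, y.2) := by simp
    rw [h3, map_smul, smul_eq_mul] at h2
    exact nonneg_of_mul_nonneg_right h2 hσ0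
  have := hmono (Set.left_mem_Icc.2 hμ.1.1) (Set.right_mem_Icc.2 hμ.1.1) hμ.1.1
  have hle : h μ ≤ 0 := hμ.2
  exact absurd hpos (not_lt.2 (this.trans hle))

/-- On the way from a slightly earlier function to the model there is no critical point at the
level. -/
theorem interpolation_deriv_ne_zero {F₀ Fs G : SplitSpace k m → ℝ}
    {D₀ Ds DG : SplitSpace k m → SplitSpace k m →L[ℝ] ℝ} {δ κ C β : ℝ} (hδ : 0 < δ) (hC : 0 ≤ C)
    (hκ : 5 / 4 * C ^ 2 * δ < κ) (h : |F₀ y - splitForm y| ≤ 1 / 4 * ‖y‖ ^ 2)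
    (h' : ‖D₀ y - splitFormDeriv y‖ ≤ 1 / 4 * ‖y‖) (ht : κ * δ ≤ Fs y - F₀ y)
    (hD : ‖Ds y - D₀ y‖ ≤ C * δ) (hG : splitForm y - 1 / 4 * ‖y‖ ^ 2 + β ≤ G y)
    (hβ : 0 ≤ β) (hβ₀ : y = 0 → 0 < β) (hDG : ‖DG y - splitFormDeriv y‖ ≤ 1 / 4 * ‖y‖) {θ : ℝ}
    (hθ : θ ∈ Set.Icc (0 : ℝ) 1) (hval : (1 - θ) * Fs y + θ * G y = 0) :
    (1 - θ) • Ds y + θ • DG y ≠ 0 := by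
  intro hzero
  have hθ1 : 0 ≤ 1 - θ := sub_nonneg.2 hθ.2
  have h₀ : ‖Ds y - splitFormDeriv y‖ ≤ C * δ + 1 / 4 * ‖y‖ := by
    calc _ = ‖(Ds y - D₀ y) + (D₀ y - splitFormDeriv y)‖ := by rw [sub_add_sub_cancel]
      _ ≤ _ := (norm_add_le _ _).trans (add_le_add hD h')
  have h₁ : ‖splitFormDeriv y‖ ≤ (1 - θ) * (C * δ) + 1 / 4 * ‖y‖ := by
    have e : splitFormDeriv y = -((1 - θ) • (Ds y - splitFormDeriv y) +
        θ • (DG y - splitFormDeriv y)) := by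
      have : (1 - θ) • (Ds y - splitFormDeriv y) + θ • (DG y - splitFormDeriv y) =
        ((1 - θ) • Ds y + θ • DG y) - splitFormDeriv y := by module
      rw [this, hzero, zero_sub, neg_neg]
    rw [e, norm_neg]
    refine (norm_add_le _ _).trans ?_
    rw [norm_smul, norm_smul, Real.norm_of_nonneg hθ1, Real.norm_of_nonneg hθ.1]
    have a₁ := mul_le_mul_of_nonneg_left h₀ hθ1
    have a₂ := mul_le_mul_of_nonneg_left hDG hθ.1
    linarith
  have h₂ := two_mul_norm_le_norm_splitFormDeriv y
  have hy0 := norm_nonneg y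
  set A := (1 - θ) * (C * δ) with hA
  have hA0 : 0 ≤ A := by positivity
  have h₃ : ‖y‖ ≤ A := by linarith
  have h₄ : ‖y‖ ^ 2 ≤ A ^ 2 := by gcongr
  have h₅ := (abs_le.1 (abs_splitForm_le y)).1
  have h₆ := (abs_le.1 h).1
  have h₇ : (1 - θ) * (κ * δ) + θ * β ≤ 5 / 4 * A ^ 2 := by
    have a₁ : splitForm y - 1 / 4 * ‖y‖ ^ 2 + κ * δ ≤ Fs y := by linarith
    have a₂ := mul_le_mul_of_nonneg_left a₁ hθ1
    have a₃ := mul_le_mul_of_nonneg_left hG hθ.1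
    nlinarith
  rcases hθ1.eq_or_lt with h0 | h0
  · have hθ' : θ = 1 := by linarith
    have hA' : A = 0 := by rw [hA, ← h0, zero_mul]
    rw [hA'] at h₃ h₇
    have := hβ₀ (norm_le_zero_iff.1 h₃)
    rw [← h0, hθ'] at h₇
    linarith
  · have h₈ : 5 / 4 * A ^ 2 ≤ (1 - θ) * ((5 / 4 * C ^ 2 * δ) * δ) := by
      rw [hA]
      have : (1 - θ) * (1 - θ) ≤ (1 - θ) * 1 := by gcongr; linarith [hθ.1]
      have hp : 0 ≤ 5 / 4 * C ^ 2 * δ * δ := by positivity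
      nlinarith
    have h₉ : (1 - θ) * ((5 / 4 * C ^ 2 * δ) * δ) < (1 - θ) * (κ * δ) := by gcongr
    have : 0 ≤ θ * β := mul_nonneg hθ.1 hβ
    linarith

theorem splitModel_nonpos_or (hr : 0 < r) (hε : ε ≤ r ^ 2 / 16)
    {u : EuclideanSpace ℝ (Fin k)}
    (h : |F (u, 0) - splitForm (u, (0 : EuclideanSpace ℝ (Fin m)))| ≤
      1 / 16 * ‖(u, (0 : EuclideanSpace ℝ (Fin m)))‖ ^ 2) :
    splitModel r ε F (u, 0) ≤ 0 ∨ ‖u‖ ^ 2 ≤ ε := by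
  have e₁ : splitNormSq (u, (0 : EuclideanSpace ℝ (Fin m))) = ‖u‖ ^ 2 := by simp [splitNormSq]
  have e₂ : splitForm (u, (0 : EuclideanSpace ℝ (Fin m))) = -‖u‖ ^ 2 := by simp [splitForm]
  have e₃ : ‖(u, (0 : EuclideanSpace ℝ (Fin m)))‖ = ‖u‖ := by simp [Prod.norm_def]
  rcases le_total (‖u‖ ^ 2) (r ^ 2 / 2) with hu | hu
  · rw [splitModel_eq_of_le hr (by rwa [e₁]), e₂]
    rcases le_total (‖u‖ ^ 2) ε with h | h
    · exact Or.inr h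
    · left; linarith
  · left
    have := splitModel_le (F := F) hε (by rwa [e₁]) h
    rw [e₂, e₃] at this
    nlinarith [sq_nonneg ‖u‖]

end Model

/-! ### The critical points at one time -/

section MorseSystem

open Filter Topology unitInterval

theorem exists_deformation_of_disjoint {M ι : Type*} [TopologicalSpace M] [Finite ι]
    (H : ι → C(I × M, M)) (S : ι → Set M) (hH : ∀ i s, ∀ x ∈ S i, H i (s, x) ∈ S i)
    (hH' : ∀ i s, ∀ x ∉ S i, H i (s, x) = x) (hS : ∀ i j, i ≠ j → Disjoint (S i) (S j)) :
    ∃ K : C(I × M, M), (∀ i s, ∀ x ∈ S i, K (s, x) = H i (s, x)) ∧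
      ∀ s x, (∀ i, x ∉ S i) → K (s, x) = x := by
  classical
  have := Fintype.ofFinite ι
  have key : ∀ t : Finset ι, ∃ K : C(I × M, M), (∀ i ∈ t, ∀ s, ∀ x ∈ S i, K (s, x) = H i (s, x)) ∧
      ∀ s x, (∀ i ∈ t, x ∉ S i) → K (s, x) = x := by
    intro t
    induction t using Finset.induction_on with
    | empty => exact ⟨⟨fun q => q.2, by fun_prop⟩, by simp, fun _ _ _ => rfl⟩
    | insert i t hi ih =>
      obtain ⟨K, hK, hK'⟩ := ih
      refine ⟨⟨fun q => H i (q.1, K q), by fun_prop⟩, fun j hj s x hx => ?_, fun s x hx => ?_⟩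
      · rcases Finset.mem_insert.1 hj with rfl | hj
        · have : K (s, x) = x := hK' s x fun l hl hxl =>
            Set.disjoint_left.1 (hS l j fun h => hi (h ▸ hl)) hxl hx
          simp [this]
        · have h₁ := hK j hj s x hx
          have h₂ : H j (s, x) ∉ S i := fun h =>
            Set.disjoint_left.1 (hS i j fun h => hi (h ▸ hj)) h (hH j s x hx)
          simp [h₁, hH' i s _ h₂]
      · have : K (s, x) = x := hK' s x fun j hj => hx j (Finset.mem_insert_of_mem hj)
        simp [this, hH' i s x (hx i (Finset.mem_insert_self _ _))]
  obtain ⟨K, hK, hK'⟩ := key Finset.univ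
  exact ⟨K, fun i => hK i (Finset.mem_univ i), fun s x hx => hK' s x fun i _ => hx i⟩

variable {n : ℕ} {M : Type*} [TopologicalSpace M] [ChartedSpace (EuclideanSpace ℝ (Fin n)) M]
  {f : M × ℝ → ℝ} {a t₀ : ℝ} {ι : Type*}

variable (n) in
/-- The critical points of `f_{t₀}` with value `a`, with adapted charts around them, which are
disjoint and small enough for the estimates with the model. -/
structure MorseSystem (f : M × ℝ → ℝ) (a t₀ : ℝ) (ι : Type*) where
  /-- The critical points. -/
  p : ι → M
  /-- The indices. -/
  k : ι → ℕ
  /-- The charts. -/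
  c : ∀ i, MorseChart n f a (p i) t₀ (k i)
  exists_eq : ∀ x, IsCriticalPt n (slice f t₀) x → f (x, t₀) = a → ∃ i, x = p i
  /-- The radius on which the function is modified. -/
  r : ℝ
  r_pos : 0 < r
  /-- The size of the modification. -/
  ε : ℝ
  ε_pos : 0 < ε
  ε_le : ε ≤ r ^ 2 / 16
  bound_mul_ε_le : 8 * transitionBound * ε ≤ r ^ 2 / 16
  /-- The quality of the approximation by the quadratic form. -/
  η : ℝ
  η_pos : 0 < η
  η_le : η ≤ 1 / 16
  bound_mul_η_le : 8 * transitionBound * η ≤ 1 / 16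
  le_R : ∀ i, 16 * r ≤ (c i).R
  approx : ∀ i, ∀ y ∈ Metric.ball 0 (16 * r),
    |f ((c i).e.symm y, t₀) - a - splitForm y| ≤ η * ‖y‖ ^ 2 ∧
      ‖(c i).D t₀ y - splitFormDeriv y‖ ≤ η * ‖y‖
  eq_of_symm_eq : ∀ i j, ∀ y ∈ Metric.ball 0 (16 * r), ∀ z ∈ Metric.ball 0 (16 * r),
    (c i).e.symm y = (c j).e.symm z → i = j

theorem nonempty_morseSystem [T2Space M] [Finite ι] {p : ι → M} (hp : Function.Injective p)
    {k : ι → ℕ} (c : ∀ i, MorseChart n f a (p i) t₀ (k i))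
    (hc : ∀ x, IsCriticalPt n (slice f t₀) x → f (x, t₀) = a → ∃ i, x = p i) :
    ∃ S : MorseSystem n f a t₀ ι, S.p = p ∧ S.k = k := by
  have hT := transitionBound_pos
  let η : ℝ := min (1 / 16) (1 / (128 * transitionBound))
  have hη : 0 < η := by positivity
  have hη' : 8 * transitionBound * η ≤ 1 / 16 := by
    calc 8 * transitionBound * η ≤ 8 * transitionBound * (1 / (128 * transitionBound)) := by
          gcongr; exact min_le_right _ _
      _ = 1 / 16 := by field_simp; norm_num
  obtain ⟨U, hU, hdisj⟩ := (Set.finite_range p).t2_separation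
  have h₁ : ∀ i, ∀ᶠ ρ in 𝓝[>] (0 : ℝ), ρ ≤ (c i).R ∧
      (∀ y ∈ Metric.ball 0 ρ, |f ((c i).e.symm y, t₀) - a - splitForm y| ≤ η * ‖y‖ ^ 2 ∧
        ‖(c i).D t₀ y - splitFormDeriv y‖ ≤ η * ‖y‖) ∧
      ∀ y ∈ Metric.ball 0 ρ, (c i).e.symm y ∈ U (p i) := by
    intro i
    obtain ⟨ρ₁, hρ₁, hρR, happ⟩ := (c i).approx η hη
    have h₂ : ∀ᶠ y in 𝓝 (0 : SplitSpace (k i) (c i).m), (c i).e.symm y ∈ U (p i) := by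
      have h₀ := (c i).e.continuousAt_symm ((c i).e.map_source (c i).mem_source)
      have h₃ := h₀.preimage_mem_nhds (t := U (p i)) (by
        rw [(c i).e.left_inv (c i).mem_source]
        exact (hU _).2.mem_nhds (hU _).1)
      rwa [(c i).map_eq] at h₃
    obtain ⟨ρ₂, hρ₂, hball⟩ := Metric.eventually_nhds_iff_ball.1 h₂
    filter_upwards [Ioo_mem_nhdsGT (lt_min hρ₁ hρ₂)] with ρ hρ
    have h₄ : ρ ≤ ρ₁ := hρ.2.le.trans (min_le_left _ _)
    have h₅ : ρ ≤ ρ₂ := hρ.2.le.trans (min_le_right _ _)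
    exact ⟨h₄.trans hρR, fun y hy => happ y (Metric.ball_subset_ball h₄ hy),
      fun y hy => hball y (Metric.ball_subset_ball h₅ hy)⟩
  obtain ⟨ρ, hρ, hρ₀⟩ := ((eventually_all.2 h₁).and self_mem_nhdsWithin).exists
  replace hρ₀ : 0 < ρ := hρ₀
  have e : 16 * (ρ / 16) = ρ := by ring
  let ε : ℝ := min ((ρ / 16) ^ 2 / 16) ((ρ / 16) ^ 2 / (128 * transitionBound))
  refine ⟨⟨p, k, c, hc, ρ / 16, by positivity, ε, by positivity, min_le_left _ _, ?_, η, hη,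
    min_le_left _ _, hη', fun i => ?_, fun i => ?_, fun i j y hy z hz h => ?_⟩, rfl, rfl⟩
  · calc 8 * transitionBound * ε
        ≤ 8 * transitionBound * ((ρ / 16) ^ 2 / (128 * transitionBound)) := by
          gcongr; exact min_le_right _ _
      _ = (ρ / 16) ^ 2 / 16 := by field_simp; norm_num
  · rw [e]; exact (hρ i).1
  · rw [e]; exact (hρ i).2.1
  · rw [e] at hy hz
    by_contra hij
    refine Set.disjoint_left.1 (hdisj ⟨i, rfl⟩ ⟨j, rfl⟩ fun h => hij (hp h))
      ((hρ i).2.2 y hy) ?_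
    rw [h]
    exact (hρ j).2.2 z hz

namespace MorseSystem

variable (S : MorseSystem n f a t₀ ι)

/-- The chart around the `i`-th critical point. -/
abbrev e (i : ι) : OpenPartialHomeomorph M (SplitSpace (S.k i) (S.c i).m) := (S.c i).e

/-- The function `f_{t₀} - a` in the `i`-th chart. -/
def value (i : ι) (y : SplitSpace (S.k i) (S.c i).m) : ℝ := f ((S.e i).symm y, t₀) - a

/-- The open neighbourhood of radius `ρ` of the `i`-th critical point. -/
def box (i : ι) (ρ : ℝ) : Set M := (S.e i).symm '' Metric.ball 0 ρ

/-- The closed neighbourhood of radius `ρ` of the `i`-th critical point. -/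
def closedBox (i : ι) (ρ : ℝ) : Set M := (S.e i).symm '' Metric.closedBall 0 ρ

theorem ball_subset_ball_R (i : ι) :
    Metric.ball (0 : SplitSpace (S.k i) (S.c i).m) (16 * S.r) ⊆ Metric.ball 0 (S.c i).R :=
  Metric.ball_subset_ball (S.le_R i)

theorem ball_subset_target (i : ι) :
    Metric.ball (0 : SplitSpace (S.k i) (S.c i).m) (16 * S.r) ⊆ (S.e i).target :=
  (S.ball_subset_ball_R i).trans (S.c i).ball_subset

theorem closedBall_subset_ball {ρ : ℝ} (hρ : ρ < 16 * S.r) (i : ι) :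
    Metric.closedBall (0 : SplitSpace (S.k i) (S.c i).m) ρ ⊆ Metric.ball 0 (16 * S.r) :=
  Metric.closedBall_subset_ball hρ

theorem isOpen_box (i : ι) {ρ : ℝ} (hρ : ρ ≤ 16 * S.r) : IsOpen (S.box i ρ) :=
  (S.e i).symm.isOpen_image_of_subset_source Metric.isOpen_ball
    ((Metric.ball_subset_ball hρ).trans (S.ball_subset_target i))

theorem isClosed_closedBox [T2Space M] (i : ι) {ρ : ℝ} (hρ : ρ < 16 * S.r) :
    IsClosed (S.closedBox i ρ) :=
  ((isCompact_closedBall _ _).image_of_continuousOn ((S.e i).continuousOn_symm.mono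
    ((S.closedBall_subset_ball hρ i).trans (S.ball_subset_target i)))).isClosed

theorem disjoint_closedBox {i j : ι} (hij : i ≠ j) {ρ : ℝ} (hρ : ρ < 16 * S.r) :
    Disjoint (S.closedBox i ρ) (S.closedBox j ρ) := by
  rw [Set.disjoint_left]
  rintro _ ⟨y, hy, rfl⟩ ⟨z, hz, h⟩
  exact hij (S.eq_of_symm_eq j i z (S.closedBall_subset_ball hρ j hz) y
    (S.closedBall_subset_ball hρ i hy) h).symm

/-- A point of the `i`-th chart domain in the closed box of index `j` comes from the ball in the
`i`-th chart. -/
theorem mem_closedBall_of_mem_closedBox {i j : ι} {ρ : ℝ} (hρ : ρ < 16 * S.r)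
    {y : SplitSpace (S.k i) (S.c i).m} (hy : y ∈ Metric.ball 0 (16 * S.r))
    (h : (S.e i).symm y ∈ S.closedBox j ρ) : i = j ∧ ‖y‖ ≤ ρ := by
  obtain ⟨z, hz, h⟩ := h
  have hz' := S.closedBall_subset_ball hρ j hz
  obtain rfl := S.eq_of_symm_eq j i z hz' y hy h
  have := (S.e j).symm.injOn (S.ball_subset_target j hz') (S.ball_subset_target j hy) h
  exact ⟨rfl, this ▸ mem_closedBall_zero_iff.1 hz⟩

/-- `G` is `f_{t₀}` modified near the critical points according to the model. -/
structure IsModel (G : M → ℝ) : Prop where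
  eq_model : ∀ i, ∀ y ∈ Metric.ball 0 (16 * S.r),
    G ((S.e i).symm y) = a + splitModel S.r S.ε (S.value i) y
  eq_off : ∀ x, (∀ i, x ∉ S.closedBox i S.r) → G x = f (x, t₀)

theorem abs_value_sub_le (i : ι) {y : SplitSpace (S.k i) (S.c i).m}
    (hy : y ∈ Metric.ball 0 (16 * S.r)) : |S.value i y - splitForm y| ≤ S.η * ‖y‖ ^ 2 :=
  (S.approx i y hy).1

theorem r_lt : S.r < 16 * S.r := by linarith [S.r_pos]

theorem continuousOn_value (hf : Continuous (slice f t₀)) (i : ι) :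
    ContinuousOn (S.value i) (S.e i).target :=
  (hf.comp_continuousOn (S.e i).continuousOn_symm).sub continuousOn_const

theorem exists_isModel [T2Space M] [Finite ι] (hf : Continuous (slice f t₀)) :
    ∃ G : C(M, ℝ), S.IsModel G := by
  have := Fintype.ofFinite ι
  have h : ∀ i, ∃ d : C(M, ℝ), (∀ y ∈ (S.e i).target, d ((S.e i).symm y) =
      splitBump S.r y * (splitForm y + S.ε - S.value i y)) ∧ ∀ x ∉ S.closedBox i S.r, d x = 0 := by
    intro i
    refine exists_continuousMap_of_chart (S.e i) (isCompact_closedBall _ _)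
      ((S.closedBall_subset_ball S.r_lt i).trans (S.ball_subset_target i)) _ ?_ fun y hy => ?_
    · exact (continuous_splitBump _).continuousOn.mul ((continuous_splitForm.continuousOn.add
        continuousOn_const).sub (S.continuousOn_value hf i))
    · rw [mem_closedBall_zero_iff, not_le] at hy
      rw [splitBump_eq_zero S.r_pos hy.le, zero_mul]
  choose d hd hd' using h
  refine ⟨⟨fun x => slice f t₀ x + ∑ i, d i x,
    hf.add (continuous_finsetSum _ fun i _ => (d i).continuous)⟩, fun i y hy => ?_, fun x hx => ?_⟩
  · have h₁ : ∑ j, d j ((S.e i).symm y) = d i ((S.e i).symm y) := by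
      refine Finset.sum_eq_single_of_mem i (Finset.mem_univ _) fun j _ hj => hd' j _ fun h => ?_
      exact hj (S.mem_closedBall_of_mem_closedBox S.r_lt hy h).1.symm
    change slice f t₀ _ + ∑ j, d j _ = _
    rw [h₁, hd i y (S.ball_subset_target i hy), splitModel, value, slice]
    ring
  · change slice f t₀ _ + ∑ j, d j _ = _
    rw [Finset.sum_eq_zero fun i _ => hd' i x (hx i), add_zero, slice]

variable {S} in
theorem IsModel.eventuallyEq [T2Space M] [Finite ι] {G : M → ℝ} (hG : S.IsModel G) {x : M}
    (hx : ∀ i, x ∉ S.closedBox i S.r) : G =ᶠ[𝓝 x] slice f t₀ := by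
  have h : ∀ᶠ z in 𝓝 x, ∀ i, z ∉ S.closedBox i S.r :=
    eventually_all.2 fun i => (S.isClosed_closedBox i S.r_lt).isOpen_compl.mem_nhds (hx i)
  filter_upwards [h] with z hz
  exact hG.eq_off z hz

theorem notMem_closedBox_of_notMem_box {x : M} {i : ι} {ρ ρ' : ℝ} (hρ : ρ < ρ')
    (hx : x ∉ S.box i ρ') : x ∉ S.closedBox i ρ := fun h =>
  hx (Set.image_mono (Metric.closedBall_subset_ball hρ) h)

end MorseSystem

end MorseSystem

/-! ### The sublevel sets near a critical time -/

section LocalStructure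

open Filter Topology unitInterval

theorem MorseChart.eventually_abs_sub_lt {n : ℕ} {M : Type*} [TopologicalSpace M]
    [ChartedSpace (EuclideanSpace ℝ (Fin n)) M] {f : M × ℝ → ℝ} {a t₀ : ℝ} {p : M} {k : ℕ}
    (c : MorseChart n f a p t₀ k) : ∀ᶠ t in 𝓝[Set.Icc 0 1] t₀, |t - t₀| < c.R ∧
      2 * c.C ^ 2 * |t - t₀| < c.κ := by
  have h₁ : Continuous fun t : ℝ => |t - t₀| := by fun_prop
  have h₂ : Continuous fun t : ℝ => 2 * c.C ^ 2 * |t - t₀| := by fun_prop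
  refine Filter.Eventually.filter_mono nhdsWithin_le_nhds (.and ?_ ?_)
  · exact h₁.continuousAt.eventually_lt_const (by simpa using c.R_pos)
  · exact h₂.continuousAt.eventually_lt_const (by simpa using c.κ_pos)

namespace MorseSystem

variable {n : ℕ} {M : Type*} [TopologicalSpace M] [ChartedSpace (EuclideanSpace ℝ (Fin n)) M]
  {f : M × ℝ → ℝ} {a t₀ : ℝ} {ι : Type*} (S : MorseSystem n f a t₀ ι)

/-- Cut-off for the contraction. -/
noncomputable def cutoff (i : ι) (y : SplitSpace (S.k i) (S.c i).m) : ℝ :=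
  min 1 (max 0 (2 - ‖y‖ / (4 * S.r)))

theorem cutoff_nonneg (i : ι) (y : SplitSpace (S.k i) (S.c i).m) : 0 ≤ S.cutoff i y :=
  le_min zero_le_one (le_max_left _ _)

theorem cutoff_le_one (i : ι) (y : SplitSpace (S.k i) (S.c i).m) : S.cutoff i y ≤ 1 :=
  min_le_left _ _

theorem cutoff_eq_one (i : ι) {y : SplitSpace (S.k i) (S.c i).m} (hy : ‖y‖ ≤ 4 * S.r) :
    S.cutoff i y = 1 := by
  have := S.r_pos
  refine min_eq_left (le_max_of_le_right ?_)
  have : ‖y‖ / (4 * S.r) ≤ 1 := div_le_one_of_le₀ hy (by positivity)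
  linarith

theorem cutoff_eq_zero (i : ι) {y : SplitSpace (S.k i) (S.c i).m} (hy : 8 * S.r ≤ ‖y‖) :
    S.cutoff i y = 0 := by
  have := S.r_pos
  have h : 2 ≤ ‖y‖ / (4 * S.r) := by rw [le_div_iff₀ (by positivity)]; linarith
  rw [cutoff, max_eq_left (by linarith), min_eq_right zero_le_one]

theorem continuous_cutoff (i : ι) : Continuous (S.cutoff i) := by
  unfold cutoff
  fun_prop

theorem one_sub_mul_cutoff_mem (i : ι) (y : SplitSpace (S.k i) (S.c i).m) (s : I) :
    1 - (s : ℝ) * S.cutoff i y ∈ Set.Icc (0 : ℝ) 1 :=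
  Set.Icc.mem_iff_one_sub_mem.1 (unitInterval.mul_mem s.2
    ⟨S.cutoff_nonneg i y, S.cutoff_le_one i y⟩)

/-- `K` contracts the positive directions near the critical points. -/
structure IsContraction (K : C(I × M, M)) : Prop where
  eq_contract : ∀ i s, ∀ y ∈ Metric.closedBall 0 (8 * S.r),
    K (s, (S.e i).symm y) = (S.e i).symm (y.1, (1 - (s : ℝ) * S.cutoff i y) • y.2)
  eq_off : ∀ s x, (∀ i, x ∉ S.closedBox i (8 * S.r)) → K (s, x) = x

theorem norm_smul_snd_le {k m : ℕ} (y : SplitSpace k m) {τ : ℝ} (hτ : τ ∈ Set.Icc (0 : ℝ) 1) :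
    ‖(y.1, τ • y.2)‖ ≤ ‖y‖ := by
  refine max_le_max le_rfl ?_
  rw [norm_smul, Real.norm_of_nonneg hτ.1]
  exact mul_le_of_le_one_left (norm_nonneg _) hτ.2

theorem exists_isContraction [T2Space M] [Finite ι] : ∃ K : C(I × M, M), S.IsContraction K := by
  have hr := S.r_pos
  have h8 : 8 * S.r < 16 * S.r := by linarith
  have ht : ∀ i, Metric.closedBall 0 (8 * S.r) ⊆ (S.e i).target := fun i =>
    (S.closedBall_subset_ball h8 i).trans (S.ball_subset_target i)
  let m : ∀ i, I × SplitSpace (S.k i) (S.c i).m → SplitSpace (S.k i) (S.c i).m :=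
    fun i q => (q.2.1, (1 - (q.1 : ℝ) * S.cutoff i q.2) • q.2.2)
  have hm : ∀ i s, ∀ y ∈ Metric.closedBall 0 (8 * S.r),
      m i (s, y) ∈ Metric.closedBall 0 (8 * S.r) := by
    intro i s y hy
    rw [mem_closedBall_zero_iff] at hy ⊢
    exact (norm_smul_snd_le y (S.one_sub_mul_cutoff_mem i y s)).trans hy
  have h : ∀ i, ∃ H : C(I × M, M),
      (∀ s, ∀ y ∈ (S.e i).target, H (s, (S.e i).symm y) = (S.e i).symm (m i (s, y))) ∧
      ∀ s, ∀ x ∉ (S.e i).symm '' Metric.closedBall 0 (8 * S.r), H (s, x) = x := by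
    intro i
    refine exists_deformation_of_chart (S.e i) (isCompact_closedBall _ _) (ht i) (m i) ?_ (hm i)
      fun s y hy => ?_
    · have := S.continuous_cutoff i
      fun_prop
    · rw [mem_closedBall_zero_iff, not_le] at hy
      simp [m, S.cutoff_eq_zero i hy.le]
  choose H hH hH' using h
  obtain ⟨K, hK, hK'⟩ := exists_deformation_of_disjoint H (fun i => S.closedBox i (8 * S.r))
    (by
      rintro i s _ ⟨y, hy, rfl⟩
      rw [hH i s y (ht i hy)]
      exact ⟨_, hm i s y hy, rfl⟩)
    hH' (fun i j hij => S.disjoint_closedBox hij h8)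
  refine ⟨K, fun i s y hy => ?_, hK'⟩
  rw [hK i s _ ⟨y, hy, rfl⟩, hH i s y (ht i hy)]

variable {S} {K : C(I × M, M)} {G : M → ℝ}

theorem IsContraction.zero (hK : S.IsContraction K) (x : M) : K (0, x) = x := by
  by_cases hx : ∀ i, x ∉ S.closedBox i (8 * S.r)
  · exact hK.eq_off 0 x hx
  · push Not at hx
    obtain ⟨i, y, hy, rfl⟩ := hx
    rw [hK.eq_contract i 0 y hy]
    simp

theorem IsContraction.le (hK : S.IsContraction K) {g : M → ℝ}
    {D : ∀ i, SplitSpace (S.k i) (S.c i).m → SplitSpace (S.k i) (S.c i).m →L[ℝ] ℝ}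
    (hg : ∀ i, ∀ y ∈ Metric.ball 0 (16 * S.r),
      HasFDerivAt (fun y => g ((S.e i).symm y) - a) (D i y) y ∧
        (0 < g ((S.e i).symm y) - a → 0 ≤ D i y (0, y.2)))
    (s : I) {x : M} (hx : g x ≤ a) : g (K (s, x)) ≤ a := by
  by_cases hx' : ∀ i, x ∉ S.closedBox i (8 * S.r)
  · rwa [hK.eq_off s x hx']
  · push Not at hx'
    obtain ⟨i, y, hy, rfl⟩ := hx'
    rw [hK.eq_contract i s y hy]
    exact sub_nonpos.1 (nonpos_of_contraction (hg i)
      (S.closedBall_subset_ball (by linarith [S.r_pos]) i hy) (sub_nonpos.2 hx)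
      (S.one_sub_mul_cutoff_mem i y s))

theorem hasFDerivAt_value (ht₀ : t₀ ∈ Set.Icc (0 : ℝ) 1) (i : ι)
    {y : SplitSpace (S.k i) (S.c i).m} (hy : y ∈ Metric.ball 0 (16 * S.r)) :
    HasFDerivAt (S.value i) ((S.c i).D t₀ y) y :=
  ((S.c i).hasFDerivAt t₀ ht₀ (by rw [sub_self, abs_zero]; exact (S.c i).R_pos) y
    (S.ball_subset_ball_R i hy)).sub_const a

theorem IsModel.hasFDerivAt (hG : S.IsModel G) (ht₀ : t₀ ∈ Set.Icc (0 : ℝ) 1) (i : ι)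
    {y : SplitSpace (S.k i) (S.c i).m} (hy : y ∈ Metric.ball 0 (16 * S.r)) :
    HasFDerivAt (fun y => G ((S.e i).symm y) - a)
      (splitModelDeriv S.r S.ε (S.value i) ((S.c i).D t₀) y) y := by
  refine (hasFDerivAt_splitModel (hasFDerivAt_value ht₀ i hy)).congr_of_eventuallyEq ?_
  filter_upwards [Metric.isOpen_ball.mem_nhds hy] with z hz
  rw [hG.eq_model i z hz, add_sub_cancel_left]

theorem IsModel.contraction_le (hG : S.IsModel G) (hK : S.IsContraction K)
    (ht₀ : t₀ ∈ Set.Icc (0 : ℝ) 1) (s : I) {x : M} (hx : G x ≤ a) : G (K (s, x)) ≤ a := by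
  refine hK.le (D := fun i => splitModelDeriv S.r S.ε (S.value i) ((S.c i).D t₀))
    (fun i y hy => ⟨hG.hasFDerivAt ht₀ i hy, fun hpos => ?_⟩) s hx
  rw [hG.eq_model i y hy, add_sub_cancel_left] at hpos
  exact splitModelDeriv_inr_nonneg S.r_pos S.η_le S.bound_mul_η_le S.ε_pos.le S.ε_le
    S.bound_mul_ε_le S.η_pos.le (S.approx i y hy).1 (S.approx i y hy).2 hpos

theorem abs_value_sub_le_of_le {b : ℝ} (hb : 1 / 16 ≤ b) (i : ι)
    {y : SplitSpace (S.k i) (S.c i).m} (hy : y ∈ Metric.ball 0 (16 * S.r)) :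
    |S.value i y - splitForm y| ≤ b * ‖y‖ ^ 2 :=
  (S.abs_value_sub_le i hy).trans (by gcongr; exact S.η_le.trans hb)

theorem norm_deriv_sub_le (i : ι)
    {y : SplitSpace (S.k i) (S.c i).m} (hy : y ∈ Metric.ball 0 (16 * S.r)) :
    ‖(S.c i).D t₀ y - splitFormDeriv y‖ ≤ 1 / 4 * ‖y‖ :=
  (S.approx i y hy).2.trans (by gcongr; exact S.η_le.trans (by norm_num))

theorem IsContraction.eventually_le [Finite ι] (hK : S.IsContraction K) :
    ∀ᶠ t in 𝓝[Set.Icc 0 1] t₀, t₀ ≤ t → ∀ s : I, ∀ x, f (x, t) ≤ a → f (K (s, x), t) ≤ a := by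
  filter_upwards [eventually_all.2 fun i => (S.c i).eventually_abs_sub_lt, self_mem_nhdsWithin] with t ht htI hle s x hx
  refine hK.le (g := slice f t) (D := fun i => (S.c i).D t)
    (fun i y hy => ⟨?_, fun hpos => ?_⟩) s hx
  · exact ((S.c i).hasFDerivAt t htI (ht i).1 y (S.ball_subset_ball_R i hy)).sub_const a
  · have hy' := S.ball_subset_ball_R i hy
    have e : |t - t₀| = t - t₀ := abs_of_nonneg (sub_nonneg.2 hle)
    refine deriv_inr_nonneg_of_le (F₀ := S.value i) (Ft := fun y => f ((S.e i).symm y, t) - a)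
      (sub_nonneg.2 hle) (C := (S.c i).C) (κ := (S.c i).κ) ?_
      (abs_value_sub_le_of_le (by norm_num) i hy) (norm_deriv_sub_le i hy) ?_ ?_ hpos
    · rw [← e]; exact (ht i).2.le
    · have := (S.c i).decr t htI (ht i).1 hle y hy'
      simp only [value]
      linarith
    · rw [← e]; exact (S.c i).lip t htI (ht i).1 y hy'

/-- Outside the boxes of radius `4r`, points of small value stay away from the critical points
under the contraction. -/
theorem IsContraction.notMem_box (hK : S.IsContraction K) {x : M}
    (hx : ∀ i, x ∉ S.closedBox i (4 * S.r)) (hfx : f (x, t₀) ≤ a + S.r ^ 2) (s : I) (i : ι) :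
    K (s, x) ∉ S.box i (2 * S.r) := by
  have hr := S.r_pos
  rintro ⟨w, hw, hwK⟩
  rw [mem_ball_zero_iff] at hw
  by_cases hx' : ∀ j, x ∉ S.closedBox j (8 * S.r)
  · rw [hK.eq_off s x hx'] at hwK
    exact hx i ⟨w, mem_closedBall_zero_iff.2 (by linarith), hwK⟩
  push Not at hx'
  obtain ⟨j, y, hy, rfl⟩ := hx'
  rw [hK.eq_contract j s y hy] at hwK
  have hyb := S.closedBall_subset_ball (by linarith) j hy
  have hy4 : 4 * S.r < ‖y‖ := by
    by_contra! h
    exact hx j ⟨y, mem_closedBall_zero_iff.2 h, rfl⟩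
  have hz : (y.1, (1 - (s : ℝ) * S.cutoff j y) • y.2) ∈ Metric.ball 0 (16 * S.r) := by
    rw [mem_ball_zero_iff] at hyb ⊢
    exact (norm_smul_snd_le y (S.one_sub_mul_cutoff_mem j y s)).trans_lt hyb
  have hz2 := (S.mem_closedBall_of_mem_closedBox (ρ := ‖w‖) (i := j) (j := i)
    (by linarith) hz (by rw [← hwK]; exact ⟨w, mem_closedBall_zero_iff.2 le_rfl, rfl⟩)).2
  have hu : ‖y.1‖ ≤ ‖w‖ := (le_max_left _ _).trans hz2
  have hv : ‖y‖ = ‖y.2‖ := by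
    rcases max_choice ‖y.1‖ ‖y.2‖ with h | h
    · rw [show ‖y‖ = ‖y.1‖ from h] at hy4; linarith
    · exact h
  have h₁ := (abs_le.1 (abs_value_sub_le_of_le (b := 1 / 4) (by norm_num) j hyb)).1
  simp only [value, splitForm] at h₁
  rw [hv] at h₁ hy4
  have h₂ : ‖y.1‖ ^ 2 ≤ (2 * S.r) ^ 2 := by gcongr; linarith
  have h₃ : (4 * S.r) ^ 2 ≤ ‖y.2‖ ^ 2 := by gcongr
  nlinarith

/-! #### The cells -/

theorem norm_cell_le (i : ι) (y : Cell (S.k i)) :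
    ‖((√S.ε • y.1, 0) : SplitSpace (S.k i) (S.c i).m)‖ ≤ S.r / 4 := by
  have hr := S.r_pos
  have h₁ : ‖y.1‖ ≤ 1 := mem_closedBall_zero_iff.1 y.2
  have h₂ : √S.ε ≤ S.r / 4 := Real.sqrt_le_left (by positivity) |>.2 (by linarith [S.ε_le])
  have h₃ : ‖√S.ε • y.1‖ ≤ S.r / 4 := by
    rw [norm_smul, Real.norm_of_nonneg (Real.sqrt_nonneg _)]
    calc _ ≤ √S.ε * 1 := by gcongr
      _ ≤ _ := by linarith
  rw [Prod.norm_def, norm_zero]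
  exact max_le h₃ (by positivity)

theorem cell_mem_ball (i : ι) (y : Cell (S.k i)) :
    ((√S.ε • y.1, 0) : SplitSpace (S.k i) (S.c i).m) ∈ Metric.ball 0 (16 * S.r) := by
  rw [mem_ball_zero_iff]
  linarith [norm_cell_le (S := S) i y, S.r_pos]

variable (S) in
/-- The core of the handle at the `i`-th critical point. -/
noncomputable def cell (i : ι) : C(Cell (S.k i), M) :=
  ⟨fun y => (S.e i).symm (√S.ε • y.1, 0),
    (S.e i).continuousOn_symm.comp_continuous (by fun_prop)
      fun y => S.ball_subset_target i (cell_mem_ball i y)⟩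

theorem cell_injective (i : ι) : Function.Injective (S.cell i) := by
  intro y z h
  have h₁ := (S.e i).symm.injOn (S.ball_subset_target i (cell_mem_ball i y))
    (S.ball_subset_target i (cell_mem_ball i z)) h
  have h₂ : √S.ε • y.1 = √S.ε • z.1 := (Prod.ext_iff.1 h₁).1
  exact Subtype.ext (smul_right_injective _ (Real.sqrt_pos.2 S.ε_pos).ne' h₂)

theorem range_cell_subset (i : ι) : Set.range (S.cell i) ⊆ S.closedBox i S.r := by
  rintro _ ⟨y, rfl⟩
  exact ⟨_, mem_closedBall_zero_iff.2 ((norm_cell_le i y).trans (by linarith [S.r_pos])), rfl⟩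

theorem mem_range_cell (i : ι) {u : EuclideanSpace ℝ (Fin (S.k i))} (hu : ‖u‖ ^ 2 ≤ S.ε) :
    (S.e i).symm (u, 0) ∈ Set.range (S.cell i) := by
  have hε := Real.sqrt_pos.2 S.ε_pos
  have h : ‖(√S.ε)⁻¹ • u‖ ≤ 1 := by
    rw [norm_smul, norm_inv, Real.norm_of_nonneg hε.le, inv_mul_le_iff₀ hε, mul_one]
    exact Real.le_sqrt_of_sq_le hu
  refine ⟨⟨(√S.ε)⁻¹ • u, mem_closedBall_zero_iff.2 h⟩, ?_⟩
  change (S.e i).symm (√S.ε • (√S.ε)⁻¹ • u, 0) = _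
  rw [smul_inv_smul₀ hε.ne']

theorem IsModel.cell_le_iff (hG : S.IsModel G) (i : ι) (y : Cell (S.k i)) :
    G (S.cell i y) ≤ a ↔ ‖y.1‖ = 1 := by
  have h₁ : ‖y.1‖ ≤ 1 := mem_closedBall_zero_iff.1 y.2
  have h₂ : ‖√S.ε • y.1‖ ^ 2 = S.ε * ‖y.1‖ ^ 2 := by
    rw [norm_smul, Real.norm_of_nonneg (Real.sqrt_nonneg _), mul_pow, Real.sq_sqrt S.ε_pos.le]
  have h₃ : splitNormSq ((√S.ε • y.1, 0) : SplitSpace (S.k i) (S.c i).m) ≤ S.r ^ 2 / 2 := by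
    have h₄ := splitNormSq_le ((√S.ε • y.1, 0) : SplitSpace (S.k i) (S.c i).m)
    have h₅ := pow_le_pow_left₀ (norm_nonneg _) (norm_cell_le (S := S) i y) 2
    nlinarith [S.r_pos]
  have h₆ : G (S.cell i y) = a + (S.ε - S.ε * ‖y.1‖ ^ 2) := by
    change G ((S.e i).symm _) = _
    rw [hG.eq_model i _ (cell_mem_ball i y), splitModel_eq_of_le S.r_pos h₃, splitForm]
    simp only [h₂, norm_zero]
    ring
  have hε := S.ε_pos
  rw [h₆]
  constructor
  · intro h
    have h₇ : S.ε * 1 ≤ S.ε * ‖y.1‖ ^ 2 := by linarith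
    have h₈ := le_of_mul_le_mul_left h₇ hε
    nlinarith [norm_nonneg y.1]
  · intro h
    rw [h]
    linarith

variable (S) in
/-- The sublevel set of the model together with the cells. -/
def handleSet (G : M → ℝ) (l : List ι) : Set M :=
  {x | G x ≤ a} ∪ ⋃ i ∈ l, Set.range (S.cell i)

theorem IsModel.homotopyEquivAttachCells [T2Space M] (hG : S.IsModel G) (hGc : Continuous G)
    {l : List ι} (hl : l.Nodup) :
    HomotopyEquivAttachCells (S.handleSet G l) (l.map S.k) {x | G x ≤ a} :=
  homotopyEquivAttachCells_union l hl S.k S.cell (isClosed_le hGc continuous_const)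
    (fun i _ => cell_injective i) (fun i _ y => hG.cell_le_iff i y) fun _ _ _ _ hij =>
      (S.disjoint_closedBox hij S.r_lt).mono (range_cell_subset _) (range_cell_subset _)

theorem IsContraction.eq_symm (hK : S.IsContraction K) (i : ι) {y : SplitSpace (S.k i) (S.c i).m}
    (hy : ‖y‖ ≤ 4 * S.r) : K (1, (S.e i).symm y) = (S.e i).symm (y.1, 0) := by
  rw [hK.eq_contract i 1 y (mem_closedBall_zero_iff.2 (by linarith [S.r_pos])),
    S.cutoff_eq_one i hy]
  simp

theorem IsContraction.eq_self (hK : S.IsContraction K) (s : I) (i : ι) {x : M}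
    (hx : x ∈ Set.range (S.cell i)) : K (s, x) = x := by
  obtain ⟨y, rfl⟩ := hx
  change K (s, (S.e i).symm _) = (S.e i).symm _
  rw [hK.eq_contract i s _ (mem_closedBall_zero_iff.2
    ((norm_cell_le i y).trans (by linarith [S.r_pos])))]
  simp

/-- After the critical time, the sublevel sets are those of the model with the cells attached. -/
theorem IsModel.eventually_nonempty_homotopyEquiv_handleSet [T2Space M] [CompactSpace M] [Finite ι]
    [IsManifold (𝓡 n) ∞ M]
    (hf : ContMDiffOn ((𝓡 n).prod 𝓘(ℝ, ℝ)) 𝓘(ℝ, ℝ) 1 f (familyDomain M))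
    (ht₀ : t₀ ∈ Set.Icc (0 : ℝ) 1) (hG : S.IsModel G) {l : List ι} (hl : ∀ i, i ∈ l) :
    ∀ᶠ t in 𝓝[Set.Icc 0 1] t₀, t₀ ≤ t →
      Nonempty (ContinuousMap.HomotopyEquiv {x | f (x, t) ≤ a} (S.handleSet G l)) := by
  have hr := S.r_pos
  obtain ⟨K, hK⟩ := S.exists_isContraction
  let W : Set M := ⋂ i, (S.closedBox i S.r)ᶜ
  have hWo : IsOpen W :=
    isOpen_iInter_of_finite fun i => (S.isClosed_closedBox i S.r_lt).isOpen_compl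
  have hWm : ∀ {x}, x ∈ W ↔ ∀ i, x ∉ S.closedBox i S.r := by simp [W]
  let Q : Set M := ⋂ i, (S.box i (2 * S.r))ᶜ
  have hQ : IsCompact Q :=
    (isClosed_iInter fun i => (S.isOpen_box i (by linarith)).isClosed_compl).isCompact
  have hQW : Q ⊆ W := fun x hx => hWm.2 fun i =>
    S.notMem_closedBox_of_notMem_box (by linarith) (Set.mem_iInter.1 hx i)
  obtain ⟨H, d, hH, m, hm, hdrop⟩ := exists_isPush_drop (l := 𝓝[Set.Icc 0 1] t₀)
    (Φ := fun t x => f (x, t)) (W := W) hQ (continuous_slice hf.continuousOn ht₀)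
    (fun ε hε => eventually_slice_sub_lt hf.continuousOn ht₀ hε) a
    (fun x hx _ => hWo.mem_nhds (hQW hx))
    (fun x hx hxa => localPush_slice hf ht₀ fun hcrit => by
      obtain ⟨i, rfl⟩ := S.exists_eq x hcrit hxa
      refine Set.mem_iInter.1 hx i ⟨0, Metric.mem_ball_self (by positivity), ?_⟩
      rw [← (S.c i).map_eq, (S.e i).left_inv (S.c i).mem_source])
  have hGW : ∀ {x}, x ∈ W → G x = f (x, t₀) := fun hx => hG.eq_off _ (hWm.1 hx)
  have hHB : ∀ s : I, ∀ x ∈ S.handleSet G l, H (s, x) ∈ S.handleSet G l := by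
    intro s x hx
    by_cases hxW : x ∈ W
    · have hxB : G x ≤ a := by
        rcases hx with hx | hx
        · exact hx
        · simp only [Set.mem_iUnion] at hx
          obtain ⟨i, -, hx⟩ := hx
          exact absurd (range_cell_subset i hx) (hWm.1 hxW i)
      left
      change G _ ≤ a
      rw [hGW (hH.mem s x hxW)]
      rw [hGW hxW] at hxB
      exact ((hH.decr.self_of_nhdsWithin ht₀ x).1 s).trans hxB
    · rwa [hH.fixed s x (hH.off x hxW)]
  have hKB : ∀ s : I, ∀ x ∈ S.handleSet G l, K (s, x) ∈ S.handleSet G l := by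
    intro s x hx
    rcases hx with hx | hx
    · exact Or.inl (hG.contraction_le hK ht₀ s hx)
    · simp only [Set.mem_iUnion] at hx
      obtain ⟨i, hi, hx⟩ := hx
      rw [hK.eq_self s i hx]
      exact Or.inr (Set.mem_biUnion hi hx)
  have hQK : ∀ {x}, (∀ i, x ∉ S.closedBox i (4 * S.r)) → f (x, t₀) ≤ a + S.r ^ 2 →
      K (1, x) ∈ Q := fun hx hxa => Set.mem_iInter.2 fun i => hK.notMem_box hx hxa 1 i
  filter_upwards [hK.eventually_le, hH.decr, hdrop,
    eventually_slice_sub_lt hf.continuousOn ht₀ (show 0 < S.r ^ 2 by positivity),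
    eventually_slice_sub_lt hf.continuousOn ht₀ hm, self_mem_nhdsWithin,
    eventually_all.2 fun i => (S.c i).eventually_abs_sub_lt]
    with t hKA hHA hdropt hr' hm' htI htR hle
  refine nonempty_homotopyEquiv_of_deformation
    ⟨fun q => H (q.1, K q), H.continuous.comp (continuous_fst.prodMk K.continuous)⟩
    (fun x => by simp [hK.zero, hH.zero])
    (fun s x hx => ((hHA _).1 s).trans (hKA hle s x hx))
    (fun s x hx => hHB s _ (hKB s x hx)) (fun x hx => ?_) (fun x hx => ?_)
  · change H (1, K (1, x)) ∈ S.handleSet G l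
    by_cases hx' : ∀ i, x ∉ S.closedBox i (4 * S.r)
    · have hxa : f (x, t) ≤ a := hx
      have hz := hQK hx' (by linarith [(abs_lt.1 (hr' x)).1])
      have h₁ := hdropt _ hz (hKA hle 1 x hx)
      left
      change G _ ≤ a
      rw [hGW (hH.mem 1 _ (hQW hz))]
      linarith [(abs_lt.1 (hm' (H (1, K (1, x))))).1]
    · push Not at hx'
      obtain ⟨i, y, hy, rfl⟩ := hx'
      rw [mem_closedBall_zero_iff] at hy
      refine hHB 1 _ ?_
      rw [hK.eq_symm i hy]
      have hyb : ((y.1, 0) : SplitSpace (S.k i) (S.c i).m) ∈ Metric.ball 0 (16 * S.r) := by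
        rw [mem_ball_zero_iff]
        exact lt_of_le_of_lt (by simpa using norm_fst_le y) (hy.trans_lt (by linarith))
      rcases splitModel_nonpos_or S.r_pos S.ε_le (abs_value_sub_le_of_le le_rfl i hyb) with h | h
      · left
        change G _ ≤ a
        rw [hG.eq_model i _ hyb]
        linarith
      · exact Or.inr (Set.mem_biUnion (hl i) (mem_range_cell i h))
  · change f (H (1, K (1, x)), t) ≤ a
    by_cases hx' : ∀ i, x ∉ S.closedBox i (4 * S.r)
    · have hxr : ∀ i, x ∉ S.closedBox i S.r := fun i h =>
        hx' i (Set.image_mono (Metric.closedBall_subset_closedBall (by linarith)) h)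
      have hxB : G x ≤ a := by
        rcases hx with hx | hx
        · exact hx
        · simp only [Set.mem_iUnion] at hx
          obtain ⟨i, -, hx⟩ := hx
          exact absurd (range_cell_subset i hx) (hxr i)
      have hz := hQK hx' (by rw [← hG.eq_off x hxr]; nlinarith)
      have hzB := hG.contraction_le hK ht₀ 1 hxB
      rw [hGW (hQW hz)] at hzB
      have h₁ := hdrop.self_of_nhdsWithin ht₀ _ hz hzB
      linarith [(abs_lt.1 (hm' (H (1, K (1, x))))).2]
    · push Not at hx'
      obtain ⟨i, y, hy, rfl⟩ := hx'
      rw [mem_closedBall_zero_iff] at hy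
      refine ((hHA _).1 1).trans ?_
      rw [hK.eq_symm i hy]
      have hyb : ((y.1, 0) : SplitSpace (S.k i) (S.c i).m) ∈ Metric.ball 0 (16 * S.r) := by
        rw [mem_ball_zero_iff]
        exact lt_of_le_of_lt (by simpa using norm_fst_le y) (hy.trans_lt (by linarith))
      have h₁ := (S.c i).decr t htI (htR i).1 hle _ (S.ball_subset_ball_R i hyb)
      have h₂ := (abs_le.1 (abs_value_sub_le_of_le (b := 1 / 4) (by norm_num) i hyb)).2
      have h₃ : 0 ≤ (S.c i).κ * (t - t₀) := mul_nonneg (S.c i).κ_pos.le (sub_nonneg.2 hle)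
      have h₄ : ‖((y.1, 0) : SplitSpace (S.k i) (S.c i).m)‖ = ‖y.1‖ := by simp [Prod.norm_def]
      rw [h₄] at h₂
      simp only [value, splitForm, norm_zero] at h₂
      nlinarith [sq_nonneg ‖y.1‖]

end MorseSystem

end LocalStructure

/-! ### The sublevel sets just before a critical time -/

section BeforeCritical

open Filter Topology

namespace MorseSystem

variable {n : ℕ} {M : Type*} [TopologicalSpace M] [ChartedSpace (EuclideanSpace ℝ (Fin n)) M]
  {f : M × ℝ → ℝ} {a t₀ : ℝ} {ι : Type*} {S : MorseSystem n f a t₀ ι} {G : M → ℝ}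

/-- Near the critical points the interpolation between a slightly earlier function and the model
has no critical points at the level. -/
theorem IsModel.localPush_of_mem_box [T2Space M] (hG : S.IsModel G)
    (ht₀ : t₀ ∈ Set.Icc (0 : ℝ) 1) {s : ℝ}
    (hs : s ∈ Set.Icc (0 : ℝ) 1) (hst : s < t₀) (i : ι) (hsR : |s - t₀| < (S.c i).R)
    (hsκ : 2 * (S.c i).C ^ 2 * |s - t₀| < (S.c i).κ) {x : M} (hx : x ∈ S.box i (16 * S.r)) {θ : ℝ}
    (hθ : θ ∈ Set.Icc (0 : ℝ) 1) (hval : (1 - θ) * f (x, s) + θ * G x = a) :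
    LocalPush (𝓝[Set.Icc 0 1] θ) (fun θ x => (1 - θ) * f (x, s) + θ * G x) x := by
  obtain ⟨y, hy, rfl⟩ := hx
  have hyR := S.ball_subset_ball_R i hy
  have e : |s - t₀| = t₀ - s := by rw [abs_sub_comm]; exact abs_of_pos (sub_pos.2 hst)
  let DG := splitModelDeriv S.r S.ε (S.value i) ((S.c i).D t₀)
  let L : ℝ → SplitSpace (S.k i) (S.c i).m → SplitSpace (S.k i) (S.c i).m →L[ℝ] ℝ :=
    fun θ y => (1 - θ) • (S.c i).D s y + θ • DG y
  have hball : Metric.ball 0 (16 * S.r) ∈ 𝓝 y := Metric.isOpen_ball.mem_nhds hy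
  have hne : L θ y ≠ 0 := by
    rw [hG.eq_model i y hy] at hval
    have hb := splitBump_nonneg S.r y
    have hC := (S.c i).C_pos
    refine interpolation_deriv_ne_zero (F₀ := S.value i) (D₀ := (S.c i).D t₀)
      (Fs := fun y => f ((S.e i).symm y, s) - a) (G := splitModel S.r S.ε (S.value i))
      (C := (S.c i).C) (κ := (S.c i).κ) (β := splitBump S.r y * S.ε)
      (sub_pos.2 hst) hC.le ?_ (abs_value_sub_le_of_le (by norm_num) i hy)
      (norm_deriv_sub_le i hy) ?_ ?_ (le_splitModel (abs_value_sub_le_of_le (by norm_num) i hy))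
      (mul_nonneg hb S.ε_pos.le) ?_ ?_ hθ (by linarith)
    · rw [e] at hsκ
      have : 0 ≤ (S.c i).C ^ 2 * (t₀ - s) := mul_nonneg (sq_nonneg _) (sub_pos.2 hst).le
      linarith
    · have := (S.c i).incr s hs hsR hst.le y hyR
      simp only [value]
      linarith
    · rw [← e]; exact (S.c i).lip s hs hsR y hyR
    · rintro rfl
      rw [splitBump_eq_one S.r_pos (by simp [splitNormSq]; positivity), one_mul]
      exact S.ε_pos
    · exact norm_splitModelDeriv_sub_le S.r_pos S.η_le S.bound_mul_η_le S.ε_pos.le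
        S.bound_mul_ε_le S.η_pos.le (S.approx i y hy).1 (S.approx i y hy).2
  obtain ⟨v, hv⟩ : ∃ v, L θ y v < 0 := by
    obtain ⟨w, hw⟩ := DFunLike.ne_iff.1 hne
    rcases lt_or_gt_of_ne hw with h | h
    · exact ⟨w, h⟩
    · exact ⟨-w, by rw [map_neg]; exact neg_neg_iff_pos.2 h⟩
  have hDs : ContinuousAt ((S.c i).D s) y :=
    ((S.c i).continuousOn_D s hs hsR).continuousAt (Metric.isOpen_ball.mem_nhds hyR)
  have hD₀ : ContinuousOn ((S.c i).D t₀) (Metric.ball 0 (16 * S.r)) :=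
    ((S.c i).continuousOn_D t₀ ht₀ (by rw [sub_self, abs_zero]; exact (S.c i).R_pos)).mono
      (S.ball_subset_ball_R i)
  have hDG : ContinuousAt DG y :=
    (continuousOn_splitModelDeriv (fun z hz =>
      (hasFDerivAt_value ht₀ i hz).continuousAt.continuousWithinAt) hD₀).continuousAt hball
  have hLc : ContinuousAt (fun q : ℝ × SplitSpace (S.k i) (S.c i).m => L q.1 q.2 v) (θ, y) := by
    have h₁ : ContinuousAt (fun q : ℝ × SplitSpace (S.k i) (S.c i).m => (S.c i).D s q.2) (θ, y) :=
      hDs.comp (f := Prod.snd) continuousAt_snd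
    have h₂ : ContinuousAt (fun q : ℝ × SplitSpace (S.k i) (S.c i).m => DG q.2) (θ, y) :=
      ContinuousAt.comp (g := DG) (f := Prod.snd) (x := (θ, y)) hDG continuousAt_snd
    exact (((continuousAt_const.sub continuousAt_fst).smul h₁).add
      (continuousAt_fst.smul h₂)).clm_apply continuousAt_const
  have hey : S.e i ((S.e i).symm y) = y := (S.e i).right_inv (S.ball_subset_target i hy)
  refine localPush_of_hasFDerivAt (S.e i) ((S.e i).map_target (S.ball_subset_target i hy)) v
    (c := -L θ y v / 2) (by linarith) L ?_
  rw [hey]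
  have h₁ : ∀ᶠ q in 𝓝[Set.Icc 0 1] θ ×ˢ 𝓝 y, L q.1 q.2 v ≤ -(-L θ y v / 2) := by
    have h₂ : (𝓝[Set.Icc 0 1] θ ×ˢ 𝓝 y) ≤ 𝓝 (θ, y) := by
      exact (prod_mono nhdsWithin_le_nhds le_rfl).trans_eq nhds_prod_eq.symm
    refine Filter.Eventually.filter_mono h₂ ?_
    filter_upwards [hLc.eventually_lt_const (show L θ y v < L θ y v / 2 by linarith)] with q hq
    linarith
  filter_upwards [h₁, tendsto_snd.eventually hball] with q hq hqb
  refine ⟨?_, hq⟩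
  have h₃ := (S.c i).hasFDerivAt s hs hsR q.2 (S.ball_subset_ball_R i hqb)
  have h₄ := (hG.hasFDerivAt ht₀ i hqb).add_const a
  simp only [sub_add_cancel] at h₄
  exact (h₃.const_mul (1 - q.1)).add (h₄.const_mul q.1)

theorem IsModel.eventually_localPush [T2Space M] [Finite ι] [IsManifold (𝓡 n) ∞ M]
    (hf : ContMDiffOn ((𝓡 n).prod 𝓘(ℝ, ℝ)) 𝓘(ℝ, ℝ) 1 f (familyDomain M))
    (ht₀ : t₀ ∈ Set.Icc (0 : ℝ) 1) (hG : S.IsModel G) {x₀ : M}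
    (hx₀ : ∀ i, x₀ ∉ S.box i (2 * S.r)) :
    ∀ᶠ q : ℝ × M in 𝓝 (t₀, x₀), q.1 ∈ Set.Icc (0 : ℝ) 1 → ∀ θ ∈ Set.Icc (0 : ℝ) 1,
      (1 - θ) * f (q.2, q.1) + θ * G q.2 = a →
      LocalPush (𝓝[Set.Icc 0 1] θ) (fun θ x => (1 - θ) * f (x, q.1) + θ * G x) q.2 := by
  have hr := S.r_pos
  have hGe : ∀ᶠ q : ℝ × M in 𝓝 (t₀, x₀), G =ᶠ[𝓝 q.2] slice f t₀ :=
    continuousAt_snd.eventually (eventually_eventually_nhds.2 (hG.eventuallyEq fun i =>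
      S.notMem_closedBox_of_notMem_box (by linarith) (hx₀ i)))
  by_cases hxa : f (x₀, t₀) = a
  · have hcrit : ¬ IsCriticalPt n (slice f t₀) x₀ := fun hcrit => by
      obtain ⟨i, rfl⟩ := S.exists_eq x₀ hcrit hxa
      refine hx₀ i ⟨0, Metric.mem_ball_self (by positivity), ?_⟩
      rw [← (S.c i).map_eq, (S.e i).left_inv (S.c i).mem_source]
    filter_upwards [hGe, eventually_localPush_interpolation hf ht₀ hcrit] with q hq hq' hqI θ hθ _
    exact hq' hqI G hq θ hθ
  · have hb : 0 < |f (x₀, t₀) - a| := abs_pos.2 (sub_ne_zero.2 hxa)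
    have h₁ : ∀ᶠ q : ℝ × M in 𝓝 (t₀, x₀), q.1 ∈ Set.Icc (0 : ℝ) 1 →
        f (q.2, q.1) ∈ Metric.ball (f (x₀, t₀)) |f (x₀, t₀) - a| := by
      have h₂ := (hf.continuousOn (x₀, t₀) ⟨trivial, ht₀⟩).eventually (Metric.ball_mem_nhds _ hb)
      have h₃ : Tendsto (fun z : ℝ × M => (z.2, z.1)) (𝓝 (t₀, x₀)) (𝓝 (x₀, t₀)) :=
        continuous_swap.tendsto _
      filter_upwards [h₃.eventually (eventually_nhdsWithin_iff.1 h₂)] with q hq hqI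
      exact hq ⟨trivial, hqI⟩
    have h₂ : ∀ᶠ q : ℝ × M in 𝓝 (t₀, x₀),
        f (q.2, t₀) ∈ Metric.ball (f (x₀, t₀)) |f (x₀, t₀) - a| :=
      ((continuous_slice hf.continuousOn ht₀).comp continuous_snd).continuousAt
        (Metric.ball_mem_nhds _ hb)
    filter_upwards [hGe, h₁, h₂] with q hq hq₁ hq₂ hqI θ hθ hval
    have h₃ := convex_ball (f (x₀, t₀)) |f (x₀, t₀) - a| (hq₁ hqI) hq₂ (sub_nonneg.2 hθ.2) hθ.1
      (sub_add_cancel 1 θ)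
    have h₄ : G q.2 = f (q.2, t₀) := hq.self_of_nhds
    rw [smul_eq_mul, smul_eq_mul, ← h₄, hval, Metric.mem_ball, Real.dist_eq, abs_sub_comm] at h₃
    exact absurd h₃ (lt_irrefl _)

/-- Before the critical time, the sublevel sets are homotopy equivalent to that of the model. -/
theorem IsModel.eventually_nonempty_homotopyEquiv [T2Space M] [CompactSpace M] [Finite ι]
    [IsManifold (𝓡 n) ∞ M]
    (hf : ContMDiffOn ((𝓡 n).prod 𝓘(ℝ, ℝ)) 𝓘(ℝ, ℝ) 1 f (familyDomain M))
    (ht₀ : t₀ ∈ Set.Icc (0 : ℝ) 1) (hG : S.IsModel G) (hGc : Continuous G) :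
    ∀ᶠ s in 𝓝[Set.Icc 0 1] t₀, s < t₀ →
      Nonempty (ContinuousMap.HomotopyEquiv {x | f (x, s) ≤ a} {x | G x ≤ a}) := by
  have hr := S.r_pos
  let Q : Set M := ⋂ i, (S.box i (2 * S.r))ᶜ
  have hQ : IsCompact Q :=
    (isClosed_iInter fun i => (S.isOpen_box i (by linarith)).isClosed_compl).isCompact
  have h₁ := hQ.eventually_forall_of_forall_eventually (x₀ := t₀)
    (P := fun s x => s ∈ Set.Icc (0 : ℝ) 1 → ∀ θ ∈ Set.Icc (0 : ℝ) 1,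
      (1 - θ) * f (x, s) + θ * G x = a →
      LocalPush (𝓝[Set.Icc 0 1] θ) (fun θ x => (1 - θ) * f (x, s) + θ * G x) x) fun x hx =>
    hG.eventually_localPush hf ht₀ (Set.mem_iInter.1 hx)
  filter_upwards [mem_nhdsWithin_of_mem_nhds h₁, self_mem_nhdsWithin,
    eventually_all.2 fun i => (S.c i).eventually_abs_sub_lt] with s hs hsI hsR hst
  have hc : Continuous fun x => f (x, s) := continuous_slice hf.continuousOn hsI
  have hΦ : Continuous fun q : ℝ × M => (1 - q.1) * f (q.2, s) + q.1 * G q.2 :=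
    ((continuous_const.sub continuous_fst).mul (hc.comp continuous_snd)).add
      (continuous_fst.mul (hGc.comp continuous_snd))
  have := nonempty_homotopyEquiv_of_path (fun θ x => (1 - θ) * f (x, s) + θ * G x)
    hΦ a fun θ hθ x hval => by
      by_cases hx : x ∈ Q
      · exact hs x hx hsI θ hθ hval
      · simp only [Q, Set.mem_iInter, Set.mem_compl_iff, not_forall, not_not] at hx
        obtain ⟨i, hx⟩ := hx
        exact hG.localPush_of_mem_box ht₀ hsI hst i (hsR i).1 (hsR i).2
          (Set.image_mono (Metric.ball_subset_ball (by linarith)) hx) hθ hval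
  have e₀ : {x | (1 - 0) * f (x, s) + 0 * G x ≤ a} = {x | f (x, s) ≤ a} := by simp
  have e₁ : {x | (1 - 1) * f (x, s) + 1 * G x ≤ a} = {x | G x ≤ a} := by simp
  rwa [e₀, e₁] at this

end MorseSystem

end BeforeCritical

/-! ### Passing the critical times -/

section Global

open Filter Topology

variable {n : ℕ} {M : Type*} [TopologicalSpace M] [T2Space M] [CompactSpace M]
  [ChartedSpace (EuclideanSpace ℝ (Fin n)) M] [IsManifold (𝓡 n) ∞ M] {f : M × ℝ → ℝ} {a : ℝ}
  {ind : M × ℝ → ℕ}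

/-- Passing a time attaches one cell for each critical point at this time. -/
theorem exists_attachCells_at_time
    (hf : ContMDiffOn ((𝓡 n).prod 𝓘(ℝ, ℝ)) 𝓘(ℝ, ℝ) 1 f (familyDomain M))
    (hc : ∀ q ∈ critSet n f a, Nonempty (MorseChart n f a q.1 q.2 (ind q))) {t₀ : ℝ}
    (ht₀ : t₀ ∈ Set.Icc (0 : ℝ) 1) :
    ∃ (l : List (M × ℝ)) (B X : Set M), l.Nodup ∧
      (∀ q, q ∈ l ↔ q ∈ critSet n f a ∧ q.2 = t₀) ∧ HomotopyEquivAttachCells X (l.map ind) B ∧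
      (∀ᶠ s in 𝓝[Set.Icc 0 1] t₀, s < t₀ →
        Nonempty (ContinuousMap.HomotopyEquiv {x | f (x, s) ≤ a} B)) ∧
      ∀ᶠ t in 𝓝[Set.Icc 0 1] t₀, t₀ ≤ t →
        Nonempty (ContinuousMap.HomotopyEquiv {x | f (x, t) ≤ a} X) := by
  let ι := {q // q ∈ critSet n f a ∧ q.2 = t₀}
  have : Finite ι := ((finite_critSet hf a hc).subset fun q hq => hq.1 :
    {q | q ∈ critSet n f a ∧ q.2 = t₀}.Finite)
  have := Fintype.ofFinite ι
  have hc' : ∀ i : ι, Nonempty (MorseChart n f a i.1.1 t₀ (ind i.1)) := by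
    rintro ⟨⟨x, t⟩, hq, rfl⟩
    exact hc _ hq
  obtain ⟨S, -, hk⟩ := nonempty_morseSystem (t₀ := t₀) (p := fun i : ι => i.1.1)
    (fun i j h => Subtype.ext (Prod.ext h (i.2.2.trans j.2.2.symm)))
    (fun i => (hc' i).some) fun x hx hxa => ⟨⟨(x, t₀), ⟨⟨trivial, ht₀⟩, hx, hxa⟩, rfl⟩, rfl⟩
  obtain ⟨G, hG⟩ := S.exists_isModel (continuous_slice hf.continuousOn ht₀)
  let L : List ι := Finset.univ.toList
  have hL : ∀ i, i ∈ L := fun i => Finset.mem_toList.2 (Finset.mem_univ i)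
  have hL' : L.Nodup := Finset.nodup_toList _
  refine ⟨L.map Subtype.val, {x | G x ≤ a}, S.handleSet G L, hL'.map Subtype.val_injective,
    fun q => ?_, ?_, hG.eventually_nonempty_homotopyEquiv hf ht₀ G.continuous,
    hG.eventually_nonempty_homotopyEquiv_handleSet hf ht₀ hL⟩
  · rw [List.mem_map]
    exact ⟨fun ⟨i, _, h⟩ => h ▸ i.2, fun h => ⟨⟨q, h⟩, hL _, rfl⟩⟩
  · have := hG.homotopyEquivAttachCells G.continuous hL'
    rw [hk] at this
    rwa [List.map_map]

/-- The sublevel set at the time `t` arises from that at the time `0` by attaching cells for the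
critical points up to the time `t`. -/
def ArisesByAttaching (n : ℕ) {M : Type*} [TopologicalSpace M]
    [ChartedSpace (EuclideanSpace ℝ (Fin n)) M] (f : M × ℝ → ℝ) (a : ℝ) (ind : M × ℝ → ℕ)
    (t : ℝ) : Prop :=
  ∃ l : List (M × ℝ), l.Nodup ∧ (∀ q, q ∈ l ↔ q ∈ critSet n f a ∧ q.2 ≤ t) ∧
    l.Pairwise (fun q r => q.2 ≤ r.2) ∧
    HomotopyEquivAttachCells {x : M | f (x, t) ≤ a} (l.map ind) {x : M | f (x, 0) ≤ a}

theorem eventually_le_iff_le {n : ℕ} {M : Type*} [TopologicalSpace M]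
    [ChartedSpace (EuclideanSpace ℝ (Fin n)) M] {f : M × ℝ → ℝ} {a : ℝ}
    (hfin : (critSet n f a).Finite) (t₀ : ℝ) :
    ∀ᶠ t in 𝓝 t₀, ∀ q ∈ critSet n f a, q.2 ≠ t₀ → (q.2 ≤ t ↔ q.2 ≤ t₀) := by
  refine (eventually_all_finite hfin).2 fun q _ => ?_
  rcases lt_trichotomy q.2 t₀ with h | h | h
  · filter_upwards [lt_mem_nhds h] with t ht _
    exact iff_of_true ht.le h.le
  · exact Eventually.of_forall fun t ht => absurd h ht
  · filter_upwards [gt_mem_nhds h] with t ht _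
    exact iff_of_false ht.not_ge h.not_ge

theorem ArisesByAttaching.eventually_step
    (hf : ContMDiffOn ((𝓡 n).prod 𝓘(ℝ, ℝ)) 𝓘(ℝ, ℝ) 1 f (familyDomain M))
    (hc : ∀ q ∈ critSet n f a, Nonempty (MorseChart n f a q.1 q.2 (ind q))) {t₀ : ℝ}
    (ht₀ : t₀ ∈ Set.Icc (0 : ℝ) 1) :
    ∀ᶠ s in 𝓝[Set.Icc 0 1] t₀, s < t₀ → ArisesByAttaching n f a ind s →
      ∀ᶠ t in 𝓝[Set.Icc 0 1] t₀, t₀ ≤ t → ArisesByAttaching n f a ind t := by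
  obtain ⟨l₀, B, X, hl₀, hmem₀, hX, hbefore, hafter⟩ := exists_attachCells_at_time hf hc ht₀
  have hsep : ∀ᶠ t in 𝓝[Set.Icc 0 1] t₀, ∀ q ∈ critSet n f a, q.2 ≠ t₀ → (q.2 ≤ t ↔ q.2 ≤ t₀) :=
    (eventually_le_iff_le (finite_critSet hf a hc) t₀).filter_mono nhdsWithin_le_nhds
  filter_upwards [hbefore, hsep] with s hsB hs hst hP
  obtain ⟨l, hl, hmem, hpw, hA⟩ := hP
  obtain ⟨eB⟩ := hsB hst
  filter_upwards [hafter, hsep] with t htX ht htt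
  obtain ⟨eX⟩ := htX htt
  refine ⟨l ++ l₀, ?_, fun q => ?_, ?_, ?_⟩
  · refine List.nodup_append.2 ⟨hl, hl₀, ?_⟩
    rintro q hq q' hq' rfl
    have h₁ := ((hmem q).1 hq).2
    have h₂ := ((hmem₀ q).1 hq').2
    linarith
  · rw [List.mem_append, hmem, hmem₀]
    constructor
    · rintro (⟨h₁, h₂⟩ | ⟨h₁, h₂⟩)
      · exact ⟨h₁, by linarith⟩
      · exact ⟨h₁, by linarith⟩
    · rintro ⟨h₁, h₂⟩
      by_cases h : q.2 = t₀
      · exact Or.inr ⟨h₁, h⟩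
      · exact Or.inl ⟨h₁, (hs q h₁ h).2 ((ht q h₁ h).1 h₂)⟩
  · refine List.pairwise_append.2 ⟨hpw,
      List.pairwise_iff_forall_sublist.2 fun {q r} hqr => ?_, fun q hq r hr => ?_⟩
    · rw [((hmem₀ q).1 (hqr.subset (by simp))).2, ((hmem₀ r).1 (hqr.subset (by simp))).2]
    · rw [((hmem₀ r).1 hr).2]
      exact ((hmem q).1 hq).2.trans hst.le
  · rw [List.map_append]
    exact hA.trans _ _ ((hX.congr_left _ eX).congr_base _ eB.symm)

theorem ArisesByAttaching.eventually_start
    (hf : ContMDiffOn ((𝓡 n).prod 𝓘(ℝ, ℝ)) 𝓘(ℝ, ℝ) 1 f (familyDomain M))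
    (hc : ∀ q ∈ critSet n f a, Nonempty (MorseChart n f a q.1 q.2 (ind q)))
    (hstart : ∀ x : M, (x, 0) ∉ critSet n f a) :
    ∀ᶠ t in 𝓝[Set.Icc 0 1] (0 : ℝ), 0 ≤ t → ArisesByAttaching n f a ind t := by
  have h0 : (0 : ℝ) ∈ Set.Icc (0 : ℝ) 1 := by simp
  obtain ⟨-, -, X, -, -, -, -, hafter⟩ := exists_attachCells_at_time hf hc h0
  obtain ⟨e₀⟩ := hafter.self_of_nhdsWithin h0 le_rfl
  filter_upwards [hafter, mem_nhdsWithin_of_mem_nhds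
    (eventually_le_iff_le (finite_critSet hf a hc) 0)] with t htX ht h0t
  obtain ⟨e⟩ := htX h0t
  refine ⟨[], List.nodup_nil, fun q => iff_of_false (by simp) ?_, List.Pairwise.nil,
    ⟨e.trans e₀.symm⟩⟩
  rintro ⟨h₁, h₂⟩
  have hne : q.2 ≠ 0 := fun h => hstart q.1 (by rw [← h]; exact h₁)
  exact hne (le_antisymm ((ht q h₁ hne).1 h₂) h₁.1.2.1)

theorem ArisesByAttaching.of_mem_Icc
    (hf : ContMDiffOn ((𝓡 n).prod 𝓘(ℝ, ℝ)) 𝓘(ℝ, ℝ) 1 f (familyDomain M))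
    (hc : ∀ q ∈ critSet n f a, Nonempty (MorseChart n f a q.1 q.2 (ind q)))
    (hstart : ∀ x : M, (x, 0) ∉ critSet n f a) {t : ℝ} (ht : t ∈ Set.Icc (0 : ℝ) 1) :
    ArisesByAttaching n f a ind t := by
  have h0 : (0 : ℝ) ∈ Set.Icc (0 : ℝ) 1 := by simp
  have hs := ArisesByAttaching.eventually_start hf hc hstart
  let T : Set ℝ := {t | ∀ u ∈ Set.Icc 0 t, ArisesByAttaching n f a ind u}
  suffices h : Set.Icc 0 1 ⊆ T from h ht t ⟨ht.1, le_rfl⟩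
  refine IsClosed.Icc_subset_of_forall_mem_nhdsWithin ?_ ?_ ?_
  · refine isClosed_of_closure_subset fun x hx => ?_
    have hxI : x ∈ Set.Icc (0 : ℝ) 1 := closure_minimal Set.inter_subset_right isClosed_Icc hx
    refine ⟨fun u hu => ?_, hxI⟩
    rcases hu.2.eq_or_lt with rfl | hux
    · obtain ⟨w, hw, hwT, hwI⟩ := mem_closure_iff_nhds.1 hx _
        (eventually_nhdsWithin_iff.1 (ArisesByAttaching.eventually_step hf hc hxI))
      rcases le_or_gt u w with h | h
      · exact hwT u ⟨hu.1, h⟩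
      · exact (hw hwI h (hwT w ⟨hwI.1, le_rfl⟩)).self_of_nhdsWithin hxI le_rfl
    · obtain ⟨w, hw, hwT, -⟩ := mem_closure_iff_nhds.1 hx _ (Ioi_mem_nhds hux)
      exact hwT u ⟨hu.1, le_of_lt hw⟩
  · rintro u ⟨hu, hu'⟩
    obtain rfl := le_antisymm hu' hu
    exact hs.self_of_nhdsWithin h0 le_rfl
  · rintro x ⟨hxT, hxI⟩
    have hx1 : x ∈ Set.Icc (0 : ℝ) 1 := ⟨hxI.1, hxI.2.le⟩
    have key : ∀ᶠ t in 𝓝[Set.Icc 0 1] x, x ≤ t → ArisesByAttaching n f a ind t := by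
      rcases hxI.1.eq_or_lt with rfl | hx0
      · exact hs
      · have h₁ := eventually_nhdsWithin_iff.1 (ArisesByAttaching.eventually_step hf hc hx1)
        obtain ⟨w, hw, hwx⟩ := ((h₁.filter_mono nhdsWithin_le_nhds).and
          (Ioo_mem_nhdsLT hx0)).exists
        exact hw ⟨hwx.1.le, (hwx.2.trans hxI.2).le⟩ hwx.2 (hxT w ⟨hwx.1.le, hwx.2.le⟩)
    obtain ⟨δ, hδ, hball⟩ := Metric.eventually_nhds_iff_ball.1 (eventually_nhdsWithin_iff.1 key)
    filter_upwards [Ioo_mem_nhdsGT (show x < min (x + δ) 1 from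
      lt_min (by linarith) hxI.2)] with w hw u hu
    rcases le_or_gt u x with h | h
    · exact hxT u ⟨hu.1, h⟩
    · have h₁ := lt_min_iff.1 hw.2
      refine hball u ?_ ⟨hu.1, hu.2.trans h₁.2.le⟩ h.le
      rw [Metric.mem_ball, Real.dist_eq, abs_of_pos (sub_pos.2 h)]
      linarith [hu.2]

end Global

theorem mainTheorem3 {n : ℕ} {M : Type*} [TopologicalSpace M] [T2Space M] [CompactSpace M]
    [ChartedSpace (EuclideanSpace ℝ (Fin n)) M] [IsManifold (𝓡 n) ∞ M]
    (f : M × ℝ → ℝ) (a : ℝ)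
    (hC1 : ContMDiffOn ((𝓡 n).prod 𝓘(ℝ, ℝ)) 𝓘(ℝ, ℝ) 1 f (familyDomain M))
    (hLip : ∀ t ∈ Set.Icc (0 : ℝ) 1, HasLipschitzDifferential n (slice f t))
    (hmono : ∀ q ∈ familyDomain M, timeDeriv f q ≤ 0)
    (ind : M × ℝ → ℕ)
    (hnondeg : ∀ q ∈ critSet n f a, IsNondegenerateCriticalPt n (slice f q.2) q.1 (ind q))
    (hnear : ∀ q ∈ critSet n f a, ∃ U : Set (M × ℝ), IsOpen U ∧ q ∈ U ∧
      ContMDiffOn ((𝓡 n).prod 𝓘(ℝ, ℝ)) 𝓘(ℝ, ℝ) ∞ f (U ∩ familyDomain M) ∧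
      ∀ r ∈ U ∩ familyDomain M, timeDeriv f r < 0)
    (hstart : ∀ x : M, (x, 0) ∉ critSet n f a) :
    ∃ l : List (M × ℝ), l.Nodup ∧ (∀ q, q ∈ l ↔ q ∈ critSet n f a) ∧
      l.Pairwise (fun q r => q.2 ≤ r.2) ∧
      HomotopyEquivAttachCells {x : M | f (x, 1) ≤ a} (l.map ind) {x : M | f (x, 0) ≤ a} := by
  have hc : ∀ q ∈ critSet n f a, Nonempty (MorseChart n f a q.1 q.2 (ind q)) := fun q hq =>
    nonempty_morseChart hq (hnondeg q hq) (hnear q hq)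
  obtain ⟨l, hl, hmem, hpw, hA⟩ :=
    ArisesByAttaching.of_mem_Icc hC1 hc hstart (show (1 : ℝ) ∈ Set.Icc (0 : ℝ) 1 by simp)
  exact ⟨l, hl, fun q => (hmem q).trans ⟨fun h => h.1, fun h => ⟨h, h.1.2.2⟩⟩, hpw, hA⟩
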